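/- Let $N,p\ge 1$ and let $\theta^1,\dots,\theta^N\in\{\pm1\}$ be such that $\theta^i\theta^{i'}=\theta_0$ does not depend on $i$, where $i'=N+1-i$ (so $\theta_0=1$ if $N$ is odd). All algebras are over $\mathbb C$. **Truncated classical twisted Yangian.** Let $Y^\tau_p(N)$ be the commutative algebra generated by $S^{ij}_{(m)}$ ($m\ge1$, $1\le i,j\le N$; $S^{ij}_{(0)}=\delta^{ij}$) modulo the relations $S^{ij}_{(m)}=(-1)^m\theta^i\theta^jS^{j'i'}_{(m)}$ and $S_{(m)}=0$ for $m>p$, with the bracket (a biderivation) determined by $$\{S_1(u),S_2(v)\}=[r_{12}(u-v),S_1(u)S_2(v)]+S_2(v)r'_{12}(u+v)S_1(u)-S_1(u)r'_{12}(u+v)S_2(v),$$ where $S(u)=\sum_{m\ge0}u^{-m}\sum_{i,j}S^{ij}_{(m)}E_{ij}$, $r_{12}(x)=\frac1x\sum_{i,j}E_{ij}\otimes E_{ji}$ and $r'_{12}(x)=\frac1x\sum_{i,j}\theta^i\theta^jE_{ij}\otimes E_{i'j'}$. Write $Y_p^+(N)$ for the case $\theta^i=1$ for all $i$, and $Y_p^-(2n)$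 for the case $N=2n$, $\theta^i=1$ for $i\le n$, $\theta^i=-1$ for $i>n$. **Classical finite W-algebras.** Let $\mathfrak g$ be one of the matrix Lie algebras below, $\mathfrak s\subset\mathfrak g$ the subalgebra indicated, and $e,f$ the raising and lowering elements of the principal $\mathfrak{sl}(2)$ of $\mathfrak s$. Choose a basis of $\mathfrak g$ that consists of elements $W_i\in\ker(\mathrm{ad}\,e)$ and of elements $x_\alpha\in\mathrm{im}(\mathrm{ad}\,f)$. On the polynomial algebra $S(\mathfrak g)$ with its Lie–Poisson bracket impose the constraints $\varphi_\alpha=x_\alpha-\mathrm{tr}(e\,x_\alpha)=0$. Then $\mathcal W[\mathfrak g,\mathfrak s]$ is the polynomial algebra in the $W_i$ with the Dirac bracket $$\{X,Y\}_*\sim\{X,Y\}-\sum_{\alpha,\beta}\{X,\varphi_\alpha\}C^{\alpha\beta}\{\varphi_\beta,Y\},$$ where $(C^{\alpha\beta})$ is the inverse of the matrix $C_{\alpha\beta}\sim\{\varphi_\alpha,\varphi_\beta\}$, and $\sim$ means that the constraints are applied after the brackets have been computed. **Folding.** Let $\tau$ be the automorphism of $gl(Np)=gl(N)\otimes gl(p)$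 given by $\tau(E_{ab}\otimes E_{kl})=(-1)^{k-l+1}\theta^a\theta^b\,E_{b'a'}\otimes E_{p+1-l,\,p+1-k}$, let $gl(Np)^\tau$ be its fixed-point subalgebra, and let $[N.sl(p)]^\tau$ be the fixed-point subalgebra of $N.sl(p)$ (the direct sum of the $N$ diagonal copies of $sl(p)$); the $\mathfrak{sl}(2)$ used is the one spanned by $1\otimes e_p,\ 1\otimes h_p,\ 1\otimes f_p$, with $e_p=\sum_k k(p-k)E_{k,k+1}$, $f_p=\sum_kE_{k+1,k}$, $h_p=[e_p,f_p]$. **Theorem.** In all the cases below, bases as above exist, and for every such basis the matrix $C_{\alpha\beta}$ is invertible, both brackets are Poisson brackets, and the following algebras are isomorphic as Poisson algebras. 1. For all $N,p\ge1$ and all signs $\theta^i$ as above: $Y^\tau_p(N)\cong\mathcal W(gl(Np)^\tau,[N.sl(p)]^\tau)$. 2. For $n\ge1$ and $p$ odd: $Y_p^-(2n)\cong\mathcal W[sp(2np),n.sl(p)]$ and $Y_p^+(2n)\cong\mathcal W[so(2np),n.sl(p)]$. 3. For $n\ge1$ and $p$ even: $Y_p^-(2n)\cong\mathcal W[so(2np),n.sl(p)]$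 and $Y_p^+(2n)\cong\mathcal W[sp(2np),n.sl(p)]$. 4. For $n\ge0$ and $p=2k+1$ odd: $Y_p^+(2n+1)\cong\mathcal W[so((2n+1)p),n.sl(p)\oplus so(p)]$. Here $n.sl(p)$ is the direct sum of $n$ diagonal copies of $sl(p)$ in $gl(np)$, embedded into $sp(2np)$ or $so(2np)$ by $M\mapsto\mathrm{diag}(M,-M^t)$, and $so(p)$ acts on the orthogonal complement of $\mathbb C^{2np}$. -/

import Mathlib

open MvPolynomial
open scoped Kronecker

noncomputable section

namespace FoldedW

attribute [local instance 100] LieRing.ofAssociativeRing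

/-! ### Poisson brackets -/

/-- A `ℂ`-bilinear, skew-symmetric biderivation of a commutative algebra satisfying the Jacobi
identity. (Linearity and the Leibniz rule in the second slot follow by skew-symmetry.) -/
structure IsPoissonBracket {A : Type*} [CommRing A] [Algebra ℂ A] (br : A → A → A) : Prop where
  add_left : ∀ a b c, br (a + b) c = br a c + br b c
  smul_left : ∀ (z : ℂ) (a b : A), br (z • a) b = z • br a b
  skew : ∀ a b, br a b = -br b a
  leibniz : ∀ a b c, br (a * b) c = a * br b c + br a c * b
  jacobi : ∀ a b c, br a (br b c) + br b (br c a) + br c (br a b) = 0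

/-- `(A, brA)` and `(B, brB)` are Poisson algebras, isomorphic as Poisson algebras. -/
def PoissonIsomorphic {A B : Type*} [CommRing A] [Algebra ℂ A] [CommRing B] [Algebra ℂ B]
    (brA : A → A → A) (brB : B → B → B) : Prop :=
  IsPoissonBracket brA ∧ IsPoissonBracket brB ∧
    ∃ Φ : A ≃ₐ[ℂ] B, ∀ a b, Φ (brA a b) = brB (Φ a) (Φ b)

section PolyBracket

variable {σ : Type*}

/-- The biderivation of a polynomial ring with prescribed values `c x y` on the variables:
`{f, g} = ∑ x y, ∂f/∂x * ∂g/∂y * c x y`. -/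
def polyBracket (c : σ → σ → MvPolynomial σ ℂ) (f g : MvPolynomial σ ℂ) : MvPolynomial σ ℂ :=
  mkDerivation ℂ (fun x => mkDerivation ℂ (c x) g) f

variable (c : σ → σ → MvPolynomial σ ℂ)

theorem polyBracket_X_X (x y : σ) : polyBracket c (X x) (X y) = c x y := by
  simp [polyBracket, mkDerivation_X]

theorem polyBracket_X (x : σ) (g : MvPolynomial σ ℂ) :
    polyBracket c (X x) g = mkDerivation ℂ (c x) g := by
  simp [polyBracket, mkDerivation_X]

theorem polyBracket_add_left (f f' g : MvPolynomial σ ℂ) :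
    polyBracket c (f + f') g = polyBracket c f g + polyBracket c f' g := by
  simp [polyBracket]

theorem polyBracket_mul_left (f f' g : MvPolynomial σ ℂ) :
    polyBracket c (f * f') g = f * polyBracket c f' g + f' * polyBracket c f g := by
  simp [polyBracket]

theorem polyBracket_C_left (z : ℂ) (g : MvPolynomial σ ℂ) : polyBracket c (C z) g = 0 := by
  simp [polyBracket]

theorem polyBracket_add_right (f g g' : MvPolynomial σ ℂ) :
    polyBracket c f (g + g') = polyBracket c f g + polyBracket c f g' := by
  induction f using MvPolynomial.induction_on with
  | C z => simp [polyBracket_C_left]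
  | add p q hp hq => simp only [polyBracket_add_left, hp, hq]; ring
  | mul_X p x hp =>
    simp only [polyBracket_mul_left, hp, polyBracket_X, map_add]; ring

theorem polyBracket_mul_right (f g g' : MvPolynomial σ ℂ) :
    polyBracket c f (g * g') = g * polyBracket c f g' + g' * polyBracket c f g := by
  induction f using MvPolynomial.induction_on with
  | C z => simp [polyBracket_C_left]
  | add p q hp hq => simp only [polyBracket_add_left, hp, hq]; ring
  | mul_X p x hp =>
    simp only [polyBracket_mul_left, hp, polyBracket_X, Derivation.leibniz, smul_eq_mul]; ring

theorem polyBracket_C_right (f : MvPolynomial σ ℂ) (z : ℂ) : polyBracket c f (C z) = 0 := by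
  induction f using MvPolynomial.induction_on with
  | C z => simp [polyBracket_C_left]
  | add p q hp hq => simp only [polyBracket_add_left, hp, hq]; ring
  | mul_X p x hp => simp [polyBracket_mul_left, hp, polyBracket_X]

theorem polyBracket_sub_left (f f' g : MvPolynomial σ ℂ) :
    polyBracket c (f - f') g = polyBracket c f g - polyBracket c f' g := by
  simp [polyBracket]

theorem polyBracket_sub_right (f g g' : MvPolynomial σ ℂ) :
    polyBracket c f (g - g') = polyBracket c f g - polyBracket c f g' := by
  have h := polyBracket_add_right c f (g - g') g'
  rw [sub_add_cancel] at h
  rw [h]; ring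

variable {c} in
/-- An ideal generated by `G` is stable under the bracket as soon as the brackets of the elements
of `G` with the variables lie in it. -/
theorem polyBracket_mem {G : Set (MvPolynomial σ ℂ)} {I : Ideal (MvPolynomial σ ℂ)}
    (hI : I = Ideal.span G)
    (hl : ∀ g ∈ G, ∀ x, polyBracket c g (X x) ∈ I)
    (hr : ∀ g ∈ G, ∀ x, polyBracket c (X x) g ∈ I) :
    (∀ f ∈ I, ∀ g, polyBracket c f g ∈ I) ∧ (∀ f, ∀ g ∈ I, polyBracket c f g ∈ I) := by
  have hG : ∀ f ∈ I, f ∈ Submodule.span (MvPolynomial σ ℂ) G := fun f hf => by rwa [hI] at hf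
  have hl' : ∀ f ∈ I, ∀ x, polyBracket c f (X x) ∈ I := by
    intro f hf x
    induction hG f hf using Submodule.span_induction with
    | mem g hg => exact hl g hg x
    | zero => simp [polyBracket]
    | add a b ha hb h1 h2 =>
      rw [polyBracket_add_left]
      exact I.add_mem (h1 (hI ▸ ha)) (h2 (hI ▸ hb))
    | smul a b hb h =>
      have hb' : b ∈ I := hI ▸ hb
      rw [smul_eq_mul, polyBracket_mul_left]
      exact I.add_mem (I.mul_mem_left _ (h hb')) (I.mul_mem_right _ hb')
  have hr' : ∀ f ∈ I, ∀ x, polyBracket c (X x) f ∈ I := by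
    intro f hf x
    induction hG f hf using Submodule.span_induction with
    | mem g hg => exact hr g hg x
    | zero => simp [polyBracket]
    | add a b ha hb h1 h2 =>
      rw [polyBracket_add_right]
      exact I.add_mem (h1 (hI ▸ ha)) (h2 (hI ▸ hb))
    | smul a b hb h =>
      have hb' : b ∈ I := hI ▸ hb
      rw [smul_eq_mul, polyBracket_mul_right]
      exact I.add_mem (I.mul_mem_left _ (h hb')) (I.mul_mem_right _ hb')
  constructor
  · intro f hf g
    induction g using MvPolynomial.induction_on with
    | C z => rw [polyBracket_C_right]; exact I.zero_mem
    | add p q hp hq => rw [polyBracket_add_right]; exact I.add_mem hp hq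
    | mul_X p x hp =>
      rw [polyBracket_mul_right]
      exact I.add_mem (I.mul_mem_left _ (hl' f hf x)) (I.mul_mem_left _ hp)
  · intro f g hg
    induction f using MvPolynomial.induction_on with
    | C z => rw [polyBracket_C_left]; exact I.zero_mem
    | add p q hp hq => rw [polyBracket_add_left]; exact I.add_mem hp hq
    | mul_X p x hp =>
      rw [polyBracket_mul_left]
      exact I.add_mem (I.mul_mem_left _ (hr' g hg x)) (I.mul_mem_left _ hp)

end PolyBracket

/-! ### Truncated classical twisted Yangians -/

/-- The signs `θ^i = ± 1`, with `θ^i θ^(N+1-i) = θ₀` for all `i`, that define an involution `τ`.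
The index `N + 1 - i` is `Fin.rev i`. -/
structure Signs (N : ℕ) where
  sgn : Fin N → ℤˣ
  sgn₀ : ℤˣ
  sgn_mul_rev : ∀ i, sgn i * sgn i.rev = sgn₀

/-- `θ^i = 1` for all `i`, so that `θ₀ = 1`: the choice that gives `Y⁺(N)`. -/
def signsPlus (N : ℕ) : Signs N where
  sgn _ := 1
  sgn₀ := 1
  sgn_mul_rev _ := rfl

/-- `θ^i = 1` for `i ≤ n` and `θ^i = -1` for `i > n`, so that `θ₀ = -1`: the choice that gives
`Y⁻(2n)`. -/
def signsMinus (n : ℕ) : Signs (2 * n) where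
  sgn i := if (i : ℕ) < n then 1 else -1
  sgn₀ := -1
  sgn_mul_rev i := by
    have hi := i.isLt
    have hr : (i.rev : ℕ) = 2 * n - (i + 1) := Fin.val_rev i
    by_cases h : (i : ℕ) < n
    · have h' : ¬ ((i.rev : ℕ) < n) := by omega
      rw [if_pos h, if_neg h', one_mul]
    · have h' : (i.rev : ℕ) < n := by omega
      rw [if_neg h, if_pos h', mul_one]

namespace Signs

variable {N : ℕ} (θ : Signs N)

/-- The generator `S_(m)^{ij}` as a polynomial: the variable `(m, i, j)` stands for
`S_(m+1)^{ij}`, and `S_(0)^{ij} = δ^{ij}`. -/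
def symS : ℕ → Fin N → Fin N → MvPolynomial (ℕ × Fin N × Fin N) ℂ
  | 0, i, j => if i = j then 1 else 0
  | m + 1, i, j => X (m, i, j)

/-- The coefficient of `u^{-m} v^{-n}` in the entry `(ij, kl)` of
`[r₁₂(u-v), S₁(u) S₂(v)] + S₂(v) r'₁₂(u+v) S₁(u) - S₁(u) r'₁₂(u+v) S₂(v)`, where
`r(x) = x⁻¹ P`, `P = ∑ E_ab ⊗ E_ba`, `r'(x) = x⁻¹ Q`, `Q = ∑ θ^a θ^b E_ab ⊗ E_a'b'` and
`a' = N + 1 - a`. -/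
def genBracket {A : Type*} [CommRing A] (S : ℕ → Fin N → Fin N → A)
    (m : ℕ) (i j : Fin N) (n : ℕ) (k l : Fin N) : A :=
  ∑ r ∈ Finset.range (min m n),
    (S r k j * S (m + n - r - 1) i l - S (m + n - r - 1) k j * S r i l
      + (-1) ^ (m + r) * ((θ.sgn₀ : ℤ) : A) *
        (((θ.sgn k : ℤ) : A) * ((θ.sgn j : ℤ) : A) * S r i k.rev * S (m + n - r - 1) j.rev l
          - ((θ.sgn i : ℤ) : A) * ((θ.sgn l : ℤ) : A) *
            S (m + n - r - 1) k i.rev * S r l.rev j))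

/-- The bracket of the free commutative algebra on the symbols `S_(m)^{ij}`, `m ≥ 1`. -/
def freeBracket (f g : MvPolynomial (ℕ × Fin N × Fin N) ℂ) : MvPolynomial (ℕ × Fin N × Fin N) ℂ :=
  polyBracket (fun x y =>
    θ.genBracket symS (x.1 + 1) x.2.1 x.2.2 (y.1 + 1) y.2.1 y.2.2) f g

/-- The relations `S(u) = τ(S(u)) = S^t(-u)`, i.e. `S_(m)^{ij} = (-1)^m θ^i θ^j S_(m)^{j'i'}`,
and the truncation `S_(m) = 0` for `m > p`. -/
def relations (p : ℕ) : Set (MvPolynomial (ℕ × Fin N × Fin N) ℂ) :=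
  {f | ∃ m i j, f = symS m i j
      - (-1) ^ m * ((θ.sgn i : ℤ) : MvPolynomial (ℕ × Fin N × Fin N) ℂ) *
        ((θ.sgn j : ℤ) : MvPolynomial (ℕ × Fin N × Fin N) ℂ) * symS m j.rev i.rev}
    ∪ {f | ∃ m i j, p < m ∧ f = symS m i j}

/-- The ideal generated by the relations. -/
def relIdeal (p : ℕ) : Ideal (MvPolynomial (ℕ × Fin N × Fin N) ℂ) :=
  Ideal.span (θ.relations p)

/-- The truncation at level `p` of the classical twisted Yangian `Y^τ(N)`, as a commutative
algebra. -/
abbrev TruncTwistedYangian (p : ℕ) : Type :=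
  MvPolynomial (ℕ × Fin N × Fin N) ℂ ⧸ θ.relIdeal p

theorem sgn_sq {A : Type*} [CommRing A] (a : ℤˣ) : ((a : ℤ) : A) * ((a : ℤ) : A) = 1 := by
  rcases Int.units_eq_one_or a with h | h <;> simp [h]

theorem sgn_rev {A : Type*} [CommRing A] (i : Fin N) :
    ((θ.sgn i.rev : ℤ) : A) = ((θ.sgn₀ : ℤ) : A) * ((θ.sgn i : ℤ) : A) := by
  rw [← θ.sgn_mul_rev i]
  rcases Int.units_eq_one_or (θ.sgn i) with h | h <;> simp [h]

section Stable

variable {A : Type*} [CommRing A] {S : ℕ → Fin N → Fin N → A}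

theorem genBracket_left
    (hS : ∀ m i j, S m i j = (-1) ^ m * ((θ.sgn i : ℤ) : A) * ((θ.sgn j : ℤ) : A)
      * S m j.rev i.rev) (m : ℕ) (i j : Fin N) (n : ℕ) (k l : Fin N) :
    θ.genBracket S m i j n k l
      - (-1) ^ m * ((θ.sgn i : ℤ) : A) * ((θ.sgn j : ℤ) : A)
        * θ.genBracket S m j.rev i.rev n k l = 0 := by
  unfold genBracket
  rw [Finset.mul_sum, ← Finset.sum_sub_distrib]
  refine Finset.sum_eq_zero fun r hr => ?_
  rw [hS r i k.rev, hS r l.rev j, hS r j.rev k.rev, hS r l.rev i.rev]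
  simp only [Fin.rev_rev, sgn_rev]
  have e0 := sgn_sq (A := A) θ.sgn₀
  have ei := sgn_sq (A := A) (θ.sgn i)
  have ej := sgn_sq (A := A) (θ.sgn j)
  have ek := sgn_sq (A := A) (θ.sgn k)
  have el := sgn_sq (A := A) (θ.sgn l)
  have em : ((-1 : A) ^ m) * (-1) ^ m = 1 := by rw [← mul_pow]; simp
  have er : ((-1 : A) ^ r) * (-1) ^ r = 1 := by rw [← mul_pow]; simp
  rw [pow_add]
  generalize ((θ.sgn₀ : ℤ) : A) = t0 at *
  generalize ((θ.sgn i : ℤ) : A) = ti at *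
  generalize ((θ.sgn j : ℤ) : A) = tj at *
  generalize ((θ.sgn k : ℤ) : A) = tk at *
  generalize ((θ.sgn l : ℤ) : A) = tl at *
  generalize ((-1 : A) ^ m) = sm at *
  generalize ((-1 : A) ^ r) = sr at *
  grind

theorem genBracket_right
    (hS : ∀ m i j, S m i j = (-1) ^ m * ((θ.sgn i : ℤ) : A) * ((θ.sgn j : ℤ) : A)
      * S m j.rev i.rev) (m : ℕ) (i j : Fin N) (n : ℕ) (k l : Fin N) :
    θ.genBracket S m i j n k l
      - (-1) ^ n * ((θ.sgn k : ℤ) : A) * ((θ.sgn l : ℤ) : A)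
        * θ.genBracket S m i j n l.rev k.rev = 0 := by
  unfold genBracket
  rw [Finset.mul_sum, ← Finset.sum_sub_distrib]
  refine Finset.sum_eq_zero fun r hr => ?_
  have hr' : r < min m n := Finset.mem_range.mp hr
  have hM : m + n = (m + n - r - 1) + r + 1 := by omega
  have hs : ((-1 : A) ^ m) * (-1) ^ n = -((-1) ^ (m + n - r - 1) * (-1) ^ r) := by
    rw [← pow_add]; conv_lhs => rw [hM]
    rw [pow_add, pow_add]; ring
  generalize m + n - r - 1 = M at *
  have h1 := hS r l.rev j
  have h2 := hS M l.rev j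
  have h3 := hS r i k.rev
  have h4 := hS M i k.rev
  have h5 := hS M j.rev k.rev
  have h6 := hS M l.rev i.rev
  simp only [Fin.rev_rev, sgn_rev] at *
  have e0 := sgn_sq (A := A) θ.sgn₀
  have ei := sgn_sq (A := A) (θ.sgn i)
  have ej := sgn_sq (A := A) (θ.sgn j)
  have ek := sgn_sq (A := A) (θ.sgn k)
  have el := sgn_sq (A := A) (θ.sgn l)
  have em : ((-1 : A) ^ m) * (-1) ^ m = 1 := by rw [← mul_pow]; simp
  have en : ((-1 : A) ^ n) * (-1) ^ n = 1 := by rw [← mul_pow]; simp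
  have er : ((-1 : A) ^ r) * (-1) ^ r = 1 := by rw [← mul_pow]; simp
  have eM : ((-1 : A) ^ M) * (-1) ^ M = 1 := by rw [← mul_pow]; simp
  rw [pow_add]
  clear hr hr' hM hS
  generalize ((θ.sgn₀ : ℤ) : A) = t0 at *
  generalize ((θ.sgn i : ℤ) : A) = ti at *
  generalize ((θ.sgn j : ℤ) : A) = tj at *
  generalize ((θ.sgn k : ℤ) : A) = tk at *
  generalize ((θ.sgn l : ℤ) : A) = tl at *
  generalize ((-1 : A) ^ m) = sm at *
  generalize ((-1 : A) ^ n) = sn at *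
  generalize ((-1 : A) ^ r) = sr at *
  generalize ((-1 : A) ^ M) = sM at *
  rw [h1, h2, h3, h4, h5, h6]
  clear h1 h2 h3 h4 h5 h6
  grind

theorem genBracket_trunc {p : ℕ} (hS : ∀ m i j, p < m → S m i j = 0)
    (m : ℕ) (i j : Fin N) (n : ℕ) (k l : Fin N) (h : p < m ∨ p < n) :
    θ.genBracket S m i j n k l = 0 := by
  unfold genBracket
  refine Finset.sum_eq_zero fun r hr => ?_
  have hr' : r < min m n := Finset.mem_range.mp hr
  have hM : p < m + n - r - 1 := by omega
  simp [hS _ _ _ hM]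

theorem map_genBracket {B : Type*} [CommRing B] (q : A →+* B) (m : ℕ) (i j : Fin N) (n : ℕ)
    (k l : Fin N) :
    q (θ.genBracket S m i j n k l) = θ.genBracket (fun a b c => q (S a b c)) m i j n k l := by
  simp [genBracket]

end Stable

theorem freeBracket_symS (m : ℕ) (i j : Fin N) (n : ℕ) (k l : Fin N) :
    θ.freeBracket (symS m i j) (symS n k l) = θ.genBracket symS m i j n k l := by
  have h0 : ∀ i j : Fin N, (symS 0 i j : MvPolynomial (ℕ × Fin N × Fin N) ℂ)
      = C (if i = j then 1 else 0) := by
    intro i j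
    unfold symS
    split_ifs with h <;> simp [h]
  unfold freeBracket
  cases m with
  | zero => rw [h0, polyBracket_C_left]; simp [genBracket]
  | succ m =>
    cases n with
    | zero => rw [h0, polyBracket_C_right]; simp [genBracket]
    | succ n => simp only [symS, polyBracket_X_X]

theorem relIdeal_stable (p : ℕ) :
    (∀ f ∈ θ.relIdeal p, ∀ g, θ.freeBracket f g ∈ θ.relIdeal p) ∧
      (∀ f, ∀ g ∈ θ.relIdeal p, θ.freeBracket f g ∈ θ.relIdeal p) := by
  have hq : ∀ f, f ∈ θ.relIdeal p ↔ Ideal.Quotient.mk (θ.relIdeal p) f = 0 :=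
    fun f => Ideal.Quotient.eq_zero_iff_mem.symm
  have h1 : ∀ m i j, Ideal.Quotient.mk (θ.relIdeal p) (symS m i j)
      = (-1) ^ m * ((θ.sgn i : ℤ) : θ.TruncTwistedYangian p)
        * ((θ.sgn j : ℤ) : θ.TruncTwistedYangian p)
        * Ideal.Quotient.mk (θ.relIdeal p) (symS m j.rev i.rev) := by
    intro m i j
    have := (hq _).1 (Ideal.subset_span (Or.inl ⟨m, i, j, rfl⟩))
    rw [map_sub, sub_eq_zero] at this
    simpa using this
  have h2 : ∀ m i j, p < m → Ideal.Quotient.mk (θ.relIdeal p) (symS m i j) = 0 :=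
    fun m i j h => (hq _).1 (Ideal.subset_span (Or.inr ⟨m, i, j, h, rfl⟩))
  have hsc : ∀ (m : ℕ) (a b : ℤˣ), ((-1) ^ m * ((a : ℤ) : MvPolynomial (ℕ × Fin N × Fin N) ℂ)
      * ((b : ℤ) : MvPolynomial (ℕ × Fin N × Fin N) ℂ))
        = C ((-1) ^ m * ((a : ℤ) : ℂ) * ((b : ℤ) : ℂ)) := by
    intro m a b; simp
  have hX : ∀ x : ℕ × Fin N × Fin N,
      (X x : MvPolynomial (ℕ × Fin N × Fin N) ℂ) = symS (x.1 + 1) x.2.1 x.2.2 := fun x => rfl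
  refine polyBracket_mem (c := fun x y =>
    θ.genBracket symS (x.1 + 1) x.2.1 x.2.2 (y.1 + 1) y.2.1 y.2.2) rfl ?_ ?_
  · rintro g (⟨m, i, j, rfl⟩ | ⟨m, i, j, hm, rfl⟩) x
    · rw [polyBracket_sub_left, hsc, polyBracket_mul_left, polyBracket_C_left, ← hsc, mul_zero,
        add_zero, hX]
      change θ.freeBracket _ _ - _ * θ.freeBracket _ _ ∈ _
      rw [freeBracket_symS, freeBracket_symS, hq, map_sub, map_mul, map_genBracket, map_genBracket]
      simpa using θ.genBracket_left h1 m i j _ _ _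
    · rw [hX]
      change θ.freeBracket _ _ ∈ _
      rw [freeBracket_symS, hq, map_genBracket]
      exact θ.genBracket_trunc h2 _ _ _ _ _ _ (Or.inl hm)
  · rintro g (⟨m, i, j, rfl⟩ | ⟨m, i, j, hm, rfl⟩) x
    · rw [polyBracket_sub_right, hsc, polyBracket_mul_right, polyBracket_C_right, ← hsc, mul_zero,
        add_zero, hX]
      change θ.freeBracket _ _ - _ * θ.freeBracket _ _ ∈ _
      rw [freeBracket_symS, freeBracket_symS, hq, map_sub, map_mul, map_genBracket, map_genBracket]
      simpa using θ.genBracket_right h1 _ _ _ m i j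
    · rw [hX]
      change θ.freeBracket _ _ ∈ _
      rw [freeBracket_symS, hq, map_genBracket]
      exact θ.genBracket_trunc h2 _ _ _ _ _ _ (Or.inr hm)

/-- The Poisson bracket of the truncated classical twisted Yangian: the bracket induced on the
quotient by the defining relations of the generators. -/
def truncBracket (p : ℕ) (a b : θ.TruncTwistedYangian p) : θ.TruncTwistedYangian p :=
  Quotient.map₂ θ.freeBracket (by
    intro f f' hf g g' hg
    have hf' : f - f' ∈ θ.relIdeal p := (Submodule.quotientRel_def _).1 hf
    have hg' : g - g' ∈ θ.relIdeal p := (Submodule.quotientRel_def _).1 hg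
    refine (Submodule.quotientRel_def _).2 ?_
    have h : θ.freeBracket f g - θ.freeBracket f' g'
        = θ.freeBracket (f - f') g + θ.freeBracket f' (g - g') := by
      unfold freeBracket
      rw [polyBracket_sub_left, polyBracket_sub_right]; ring
    rw [h]
    exact (θ.relIdeal p).add_mem ((θ.relIdeal_stable p).1 _ hf' _)
      ((θ.relIdeal_stable p).2 _ _ hg')) a b

theorem truncBracket_mk (p : ℕ) (f g : MvPolynomial (ℕ × Fin N × Fin N) ℂ) :
    θ.truncBracket p (Ideal.Quotient.mk _ f) (Ideal.Quotient.mk _ g)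
      = Ideal.Quotient.mk _ (θ.freeBracket f g) := rfl

end Signs

/-! ### Classical finite W-algebras as Dirac reductions -/

section DiracReduction

variable {ι : Type} [Fintype ι] [DecidableEq ι] {L : LieSubalgebra ℂ (Matrix ι ι ℂ)}

/-- For a matrix Lie algebra `L` and the elements `e = e₊` and `f = e₋` of an `sl(2)`-triple in
`L`: a basis of `L` formed by highest weight vectors (the generators `J_{j,j}`) and by vectors
in the image of `ad f` (a basis of the span of the `J_{j,m}`, `m < j`). -/
structure HighestWeightBasis (e f : L) where
  r : ℕ
  s : ℕ
  basis : Module.Basis (Fin r ⊕ Fin s) ℂ L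
  highest : ∀ i, ⁅e, basis (.inl i)⁆ = 0
  lower : ∀ j, ∃ y, basis (.inr j) = ⁅f, y⁆

namespace HighestWeightBasis

variable {e f : L} (b : HighestWeightBasis e f)

/-- The Lie-Poisson bracket of `S(L)`, the polynomial algebra in the elements of the basis:
`{b_x, b_y} = [b_x, b_y]`. -/
def liePoisson (F G : MvPolynomial (Fin b.r ⊕ Fin b.s) ℂ) :
    MvPolynomial (Fin b.r ⊕ Fin b.s) ℂ :=
  polyBracket (fun x y => ∑ z, C (b.basis.repr ⁅b.basis x, b.basis y⁆ z) * X z) F G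

/-- The value imposed on the `α`-th constrained generator, namely `tr (e b_α)`. It vanishes on all
the `J_{j,m}` with `m < j` but the `J_{1,-1}`. -/
def value (α : Fin b.s) : ℂ := ((e : Matrix ι ι ℂ) * (b.basis (.inr α) : Matrix ι ι ℂ)).trace

/-- The constraints `φ_α`. -/
def constraint (α : Fin b.s) : MvPolynomial (Fin b.r ⊕ Fin b.s) ℂ :=
  X (.inr α) - C (b.value α)

/-- The W-algebra: the polynomial algebra in the generators `W_j = J_{j,j}`. -/
abbrev WAlgebra : Type := MvPolynomial (Fin b.r) ℂ

/-- The map `F ↦ (F modulo the constraints)`. -/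
def onConstraints : MvPolynomial (Fin b.r ⊕ Fin b.s) ℂ →ₐ[ℂ] b.WAlgebra :=
  aeval (Sum.elim X fun α => C (b.value α))

/-- The matrix of constraints `C_{αβ} ∼ {φ_α, φ_β}`. -/
def constraintMatrix : Matrix (Fin b.s) (Fin b.s) b.WAlgebra :=
  Matrix.of fun α β => b.onConstraints (b.liePoisson (b.constraint α) (b.constraint β))

/-- The Dirac bracket
`{F, G}_* ∼ {F, G} - ∑ α β, {F, φ_α} C^{αβ} {φ_β, G}`, where `C^{αβ}` is the inverse of
`C_{αβ}`. -/
def diracBracket (F G : b.WAlgebra) : b.WAlgebra :=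
  b.onConstraints (b.liePoisson (rename .inl F) (rename .inl G))
    - ∑ α, ∑ β, b.onConstraints (b.liePoisson (rename .inl F) (b.constraint α))
        * b.constraintMatrix⁻¹ α β
        * b.onConstraints (b.liePoisson (b.constraint β) (rename .inl G))

end HighestWeightBasis

/-- The W-algebra of `L` with respect to the `sl(2)`-triple of `e` and `f` is (well defined and)
isomorphic, as a Poisson algebra, to the truncation at level `p` of the classical twisted
Yangian with signs `θ`. The W-algebra is presented by means of a basis of `L`; the basis exists,
the choice does not matter, and the constraints are second class. -/
def IsTruncatedTwistedYangian {N : ℕ} (θ : Signs N) (p : ℕ) (e f : L) : Prop :=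
  Nonempty (HighestWeightBasis e f) ∧
    ∀ b : HighestWeightBasis e f, IsUnit b.constraintMatrix.det ∧
      PoissonIsomorphic (θ.truncBracket p) b.diracBracket

end DiracReduction

/-! ### The folding of `gl(Np)` -/

/-- The element `e₊ = ∑ k (p - k) E_{k,k+1}` of the principal `sl(2)` of `sl(p)`. -/
def principalE (p : ℕ) : Matrix (Fin p) (Fin p) ℂ :=
  Matrix.of fun k l => if (k : ℕ) + 1 = l then ((k : ℂ) + 1) * ((p : ℂ) - (k + 1)) else 0

/-- The element `e₋ = ∑ E_{k+1,k}` of the principal `sl(2)` of `sl(p)`. -/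
def principalF (p : ℕ) : Matrix (Fin p) (Fin p) ℂ :=
  Matrix.of fun k l => if (l : ℕ) + 1 = k then 1 else 0

/-- The automorphism `τ` of `gl(Np) = gl(N) ⊗ gl(p)`,
`E^{ab} ⊗ E_{kl} ↦ (-1)^{k-l+1} θ^a θ^b E^{b'a'} ⊗ E_{l'k'}`. As `E_{kl} ↦ (-1)^{k-l} E_{l'k'}` is an
anti-automorphism that changes the signs of `e₊` and `e₋`, it multiplies by `(-1)^j` the spin `j`
component `M_{j,m}` (spanned by the `ad(e₋)^i (e₊^j)`) of `gl(p)`, so that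
`τ(J_{jm}^{ab}) = (-1)^{j+1} θ^a θ^b J_{jm}^{b'a'}`. -/
def Signs.tau {N : ℕ} (θ : Signs N) (p : ℕ) (M : Matrix (Fin N × Fin p) (Fin N × Fin p) ℂ) :
    Matrix (Fin N × Fin p) (Fin N × Fin p) ℂ :=
  Matrix.of fun x y => -((-1) ^ ((x.2 : ℕ) + y.2) * ((θ.sgn x.1 : ℤ) : ℂ) * ((θ.sgn y.1 : ℤ) : ℂ))
    * M (y.1.rev, y.2.rev) (x.1.rev, x.2.rev)

theorem Signs.tau_mul {N : ℕ} (θ : Signs N) (p : ℕ)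
    (M M' : Matrix (Fin N × Fin p) (Fin N × Fin p) ℂ) :
    θ.tau p (M * M') = -(θ.tau p M' * θ.tau p M) := by
  ext x y
  simp only [Signs.tau, Matrix.mul_apply, Matrix.of_apply, Matrix.neg_apply]
  rw [Finset.mul_sum, ← Finset.sum_neg_distrib]
  refine Fintype.sum_equiv ((Fin.revPerm).prodCongr (Fin.revPerm)) _ _ fun z => ?_
  obtain ⟨a, k⟩ := z
  simp only [Equiv.prodCongr_apply, Prod.map, Fin.revPerm_apply, Fin.rev_rev]
  have h1 := Signs.sgn_sq (A := ℂ) (θ.sgn a.rev)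
  have h2 : ((-1 : ℂ) ^ (k.rev : ℕ)) * (-1) ^ (k.rev : ℕ) = 1 := by rw [← mul_pow]; simp
  rw [pow_add, pow_add, pow_add]
  grind

/-- `gl(Np)^τ = Ker (id - τ)`. -/
def Signs.foldedGl {N : ℕ} (θ : Signs N) (p : ℕ) :
    LieSubalgebra ℂ (Matrix (Fin N × Fin p) (Fin N × Fin p) ℂ) where
  carrier := {M | θ.tau p M = M}
  add_mem' {M M'} h h' := by
    have : θ.tau p (M + M') = θ.tau p M + θ.tau p M' := by
      ext x y; simp [Signs.tau]; ring
    simp only [Set.mem_ofPred_eq] at *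
    rw [this, h, h']
  zero_mem' := by ext x y; simp [Signs.tau]
  smul_mem' z M h := by
    have : θ.tau p (z • M) = z • θ.tau p M := by
      ext x y; simp [Signs.tau]; ring
    simp only [Set.mem_ofPred_eq] at *
    rw [this, h]
  lie_mem' {M M'} h h' := by
    change θ.tau p M = M at h
    change θ.tau p M' = M' at h'
    change θ.tau p (M * M' - M' * M) = M * M' - M' * M
    have : θ.tau p (M * M' - M' * M) = θ.tau p (M * M') - θ.tau p (M' * M) := by
      ext x y; simp [Signs.tau]; ring
    rw [this, Signs.tau_mul, Signs.tau_mul, h, h']; abel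

/-- `e₊` of the principal `sl(2)` of `N.sl(p) ⊂ gl(Np)`; it is fixed by `τ`, and belongs to the
principal `sl(2)` of `[N.sl(p)]^τ`. -/
def Signs.foldedE {N : ℕ} (θ : Signs N) (p : ℕ) : θ.foldedGl p :=
  ⟨(1 : Matrix (Fin N) (Fin N) ℂ) ⊗ₖ principalE p, by
    change θ.tau p _ = _
    ext ⟨a, k⟩ ⟨b, l⟩
    have hk := k.isLt
    have hl := l.isLt
    simp only [Signs.tau, Matrix.of_apply, Matrix.kroneckerMap_apply, Matrix.one_apply,
      principalE, Fin.rev_inj, Fin.val_rev]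
    by_cases h : a = b
    · subst h
      by_cases h' : (k : ℕ) + 1 = l
      · have h1 := Signs.sgn_sq (A := ℂ) (θ.sgn a)
        have h2 : p - ((l : ℕ) + 1) + 1 = p - (k + 1) := by omega
        have h3 : ((p - ((l : ℕ) + 1) : ℕ) : ℂ) = p - (l + 1) := by
          rw [Nat.cast_sub (by omega)]; push_cast; ring
        have h4 : ((l : ℕ) : ℂ) = k + 1 := by rw [← h']; push_cast; ring
        have h5 : (-1 : ℂ) ^ ((k : ℕ) + l) = -1 := by
          rw [← h']; exact Odd.neg_one_pow ⟨k, by ring⟩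
        simp only [h', h2, h3, h4, h5, if_true]
        linear_combination (k + 1) * ((p : ℂ) - (k + 1)) * h1
      · have h2 : ¬ (p - ((l : ℕ) + 1) + 1 = p - (k + 1)) := by omega
        simp [h', h2]
    · have h'' : b ≠ a := fun h' => h h'.symm
      simp [h, h'']⟩

/-- `e₋` of the principal `sl(2)` of `N.sl(p) ⊂ gl(Np)`. -/
def Signs.foldedF {N : ℕ} (θ : Signs N) (p : ℕ) : θ.foldedGl p :=
  ⟨(1 : Matrix (Fin N) (Fin N) ℂ) ⊗ₖ principalF p, by
    change θ.tau p _ = _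
    ext ⟨a, k⟩ ⟨b, l⟩
    have hk := k.isLt
    have hl := l.isLt
    simp only [Signs.tau, Matrix.of_apply, Matrix.kroneckerMap_apply, Matrix.one_apply,
      principalF, Fin.rev_inj, Fin.val_rev]
    by_cases h : a = b
    · subst h
      by_cases h' : (l : ℕ) + 1 = k
      · have h1 := Signs.sgn_sq (A := ℂ) (θ.sgn a)
        have h2 : p - ((k : ℕ) + 1) + 1 = p - (l + 1) := by omega
        have h5 : (-1 : ℂ) ^ ((k : ℕ) + l) = -1 := by
          rw [← h']; exact Odd.neg_one_pow ⟨l, by ring⟩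
        simp only [h', h2, h5, if_true]
        linear_combination h1
      · have h2 : ¬ (p - ((k : ℕ) + 1) + 1 = p - (l + 1)) := by omega
        simp [h', h2]
    · have h'' : b ≠ a := fun h' => h h'.symm
      simp [h, h'']⟩

/-! ### Orthogonal and symplectic algebras

`n.sl(p)`, the direct sum of `n` copies of `sl(p)`, consists of block diagonal matrices of `gl(np)`,
and `gl(np)` is embedded into `sp(2np)` and `so(2np)` by `M ↦ diag (M, -Mᵀ)`. Here `so(2np)` is
taken with respect to the symmetric form `[[0, 1], [1, 0]]`. -/

/-- `diag (M, -Mᵀ)`. -/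
def doubling {l : Type} (M : Matrix l l ℂ) : Matrix (l ⊕ l) (l ⊕ l) ℂ :=
  Matrix.fromBlocks M 0 0 (-M.transpose)

theorem doubling_mem_sp {l : Type} [Fintype l] [DecidableEq l] (M : Matrix l l ℂ) :
    doubling M ∈ LieAlgebra.Symplectic.sp l ℂ := by
  rw [LieAlgebra.Symplectic.sp, mem_skewAdjointMatricesLieSubalgebra,
    mem_skewAdjointMatricesSubmodule]
  simp [Matrix.IsSkewAdjoint, Matrix.IsAdjointPair, doubling, Matrix.J, Matrix.fromBlocks_transpose,
    Matrix.fromBlocks_multiply, Matrix.fromBlocks_neg]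

theorem doubling_mem_so {l : Type} [Fintype l] [DecidableEq l] (M : Matrix l l ℂ) :
    doubling M ∈ LieAlgebra.Orthogonal.typeD l ℂ := by
  rw [LieAlgebra.Orthogonal.typeD, mem_skewAdjointMatricesLieSubalgebra,
    mem_skewAdjointMatricesSubmodule]
  simp [Matrix.IsSkewAdjoint, Matrix.IsAdjointPair, doubling, LieAlgebra.Orthogonal.JD,
    Matrix.fromBlocks_transpose, Matrix.fromBlocks_multiply, Matrix.fromBlocks_neg]

/-- `e₊` of the principal `sl(2)` of `n.sl(p)`, as an element of `gl(np)`. -/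
def blockE (n p : ℕ) : Matrix (Fin n × Fin p) (Fin n × Fin p) ℂ :=
  (1 : Matrix (Fin n) (Fin n) ℂ) ⊗ₖ principalE p

/-- `e₋` of the principal `sl(2)` of `n.sl(p)`, as an element of `gl(np)`. -/
def blockF (n p : ℕ) : Matrix (Fin n × Fin p) (Fin n × Fin p) ℂ :=
  (1 : Matrix (Fin n) (Fin n) ℂ) ⊗ₖ principalF p

/-- `e₊` of the principal `sl(2)` of `n.sl(p) ⊂ sp(2np)`. -/
def spE (n p : ℕ) : LieAlgebra.Symplectic.sp (Fin n × Fin p) ℂ :=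
  ⟨doubling (blockE n p), doubling_mem_sp _⟩

/-- `e₋` of the principal `sl(2)` of `n.sl(p) ⊂ sp(2np)`. -/
def spF (n p : ℕ) : LieAlgebra.Symplectic.sp (Fin n × Fin p) ℂ :=
  ⟨doubling (blockF n p), doubling_mem_sp _⟩

/-- `e₊` of the principal `sl(2)` of `n.sl(p) ⊂ so(2np)`. -/
def soE (n p : ℕ) : LieAlgebra.Orthogonal.typeD (Fin n × Fin p) ℂ :=
  ⟨doubling (blockE n p), doubling_mem_so _⟩

/-- `e₋` of the principal `sl(2)` of `n.sl(p) ⊂ so(2np)`. -/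
def soF (n p : ℕ) : LieAlgebra.Orthogonal.typeD (Fin n × Fin p) ℂ :=
  ⟨doubling (blockF n p), doubling_mem_so _⟩

/-- The matrix `∑ k, (-1)^k E_{k,p+1-k}` (with `k` counted from `0` in the sign), which is
symmetric when `p` is odd. -/
def antidiagForm (p : ℕ) : Matrix (Fin p) (Fin p) ℂ :=
  Matrix.of fun k l => if l = k.rev then (-1) ^ (k : ℕ) else 0

theorem antidiagForm_symm {p : ℕ} (hp : Odd p) : (antidiagForm p).transpose = antidiagForm p := by
  ext k l
  simp only [Matrix.transpose_apply, antidiagForm, Matrix.of_apply]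
  have hk := k.isLt
  have hl := l.isLt
  by_cases h : l = k.rev
  · have h' : k = l.rev := by rw [h, Fin.rev_rev]
    have hv : (l : ℕ) = p - (k + 1) := by rw [h, Fin.val_rev]
    rw [if_pos h', if_pos h]
    obtain ⟨q, rfl⟩ := hp
    rw [neg_one_pow_eq_pow_mod_two, neg_one_pow_eq_pow_mod_two (n := (k : ℕ))]
    congr 1
    omega
  · have h' : ¬ k = l.rev := fun h' => h (by rw [h', Fin.rev_rev])
    rw [if_neg h', if_neg h]

/-- For `p` odd, `so((2n+1)p)` with respect to the symmetric form which is the orthogonal sum of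
`[[0, 1], [1, 0]]` on `ℂ^(2np)` and of `antidiagForm p` on `ℂ^p`; it contains `n.sl(p)`, embedded
into the `so(2np)` of the first summand, and the algebra `so(p)` of the second one. -/
def soOdd (n p : ℕ) :
    LieSubalgebra ℂ (Matrix (((Fin n × Fin p) ⊕ (Fin n × Fin p)) ⊕ Fin p)
      (((Fin n × Fin p) ⊕ (Fin n × Fin p)) ⊕ Fin p) ℂ) :=
  skewAdjointMatricesLieSubalgebra
    (Matrix.fromBlocks (LieAlgebra.Orthogonal.JD (Fin n × Fin p) ℂ) 0 0 (antidiagForm p))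

theorem principalE_skew (p : ℕ) :
    (principalE p).transpose * antidiagForm p = -(antidiagForm p * principalE p) := by
  ext k l
  have hk := k.isLt
  have hl := l.isLt
  simp only [Matrix.mul_apply, Matrix.transpose_apply, Matrix.neg_apply]
  rw [Finset.sum_eq_single l.rev, Finset.sum_eq_single k.rev]
  · simp only [principalE, antidiagForm, Matrix.of_apply, Fin.rev_rev, if_true, Fin.val_rev]
    by_cases h : p - ((l : ℕ) + 1) + 1 = k
    · have h' : p - ((k : ℕ) + 1) + 1 = l := by omega
      have h1 : ((p - ((l : ℕ) + 1) : ℕ) : ℂ) = p - (l + 1) := by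
        rw [Nat.cast_sub (by omega)]; push_cast; ring
      have h2 : ((p - ((k : ℕ) + 1) : ℕ) : ℂ) = p - (k + 1) := by
        rw [Nat.cast_sub (by omega)]; push_cast; ring
      have h3 : (p : ℂ) = k + l := by
        have : ((k : ℕ) : ℂ) + ((l : ℕ) : ℂ) = ((k + l : ℕ) : ℂ) := by push_cast; rfl
        rw [this]; congr 1; omega
      have h4 : (-1 : ℂ) ^ (k : ℕ) = -(-1) ^ (p - ((l : ℕ) + 1)) := by
        rw [← h]; ring
      rw [if_pos h, if_pos h', h1, h2, h4, h3]
      ring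
    · have h' : ¬ (p - ((k : ℕ) + 1) + 1 = l) := by omega
      rw [if_neg h, if_neg h']; ring
  · intro z _ hz
    simp [antidiagForm, hz]
  · simp
  · intro z _ hz
    have : l ≠ z.rev := fun h => hz (by rw [h, Fin.rev_rev])
    simp [antidiagForm, this]
  · simp

theorem principalF_skew (p : ℕ) :
    (principalF p).transpose * antidiagForm p = -(antidiagForm p * principalF p) := by
  ext k l
  have hk := k.isLt
  have hl := l.isLt
  simp only [Matrix.mul_apply, Matrix.transpose_apply, Matrix.neg_apply]
  rw [Finset.sum_eq_single l.rev, Finset.sum_eq_single k.rev]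
  · simp only [principalF, antidiagForm, Matrix.of_apply, Fin.rev_rev, if_true, Fin.val_rev]
    by_cases h : (k : ℕ) + 1 = p - ((l : ℕ) + 1)
    · have h' : (l : ℕ) + 1 = p - ((k : ℕ) + 1) := by omega
      rw [if_pos h, if_pos h', ← h]; ring
    · have h' : ¬ ((l : ℕ) + 1 = p - ((k : ℕ) + 1)) := by omega
      rw [if_neg h, if_neg h']; ring
  · intro z _ hz
    simp [antidiagForm, hz]
  · simp
  · intro z _ hz
    have : l ≠ z.rev := fun h => hz (by rw [h, Fin.rev_rev])
    simp [antidiagForm, this]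
  · simp

theorem mem_soOdd {n p : ℕ} (M : Matrix (Fin n × Fin p) (Fin n × Fin p) ℂ)
    (M' : Matrix (Fin p) (Fin p) ℂ)
    (h : M'.transpose * antidiagForm p = -(antidiagForm p * M')) :
    Matrix.fromBlocks (doubling M) 0 0 M' ∈ soOdd n p := by
  rw [soOdd, mem_skewAdjointMatricesLieSubalgebra, mem_skewAdjointMatricesSubmodule]
  simp [Matrix.IsSkewAdjoint, Matrix.IsAdjointPair, doubling, LieAlgebra.Orthogonal.JD,
    Matrix.fromBlocks_transpose, Matrix.fromBlocks_multiply, Matrix.fromBlocks_neg, h]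

/-- `e₊` of the principal `sl(2)` of `n.sl(p) ⊕ so(p) ⊂ so((2n+1)p)`. -/
def soOddE (n p : ℕ) : soOdd n p :=
  ⟨Matrix.fromBlocks (doubling (blockE n p)) 0 0 (principalE p), mem_soOdd _ _ (principalE_skew p)⟩

/-- `e₋` of the principal `sl(2)` of `n.sl(p) ⊕ so(p) ⊂ so((2n+1)p)`. -/
def soOddF (n p : ℕ) : soOdd n p :=
  ⟨Matrix.fromBlocks (doubling (blockF n p)) 0 0 (principalF p), mem_soOdd _ _ (principalF_skew p)⟩

end FoldedW
end

/-! The trace form identifies the constraint surface with the slice `e₊ + ker (ad e₋)` in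
`gl(Np)^τ`. Its points are the τ-fixed block companion matrices `M = e₊ + ∑ A_m ⊗ e₋^m`, and the
generator attached to a basis element `x` is the function `tr (M x)`. A positive hermitian form for
which `e₊` and `e₋` are mutually adjoint shows that `im (ad e₋)` meets `ker (ad e₊)` only in `0`,
and likewise with `e₊` and `e₋` exchanged (`eq_zero_of_lie`). This gives the bases. Combined with
the grading by block diagonals (`gradeComp_eq_zero_of_lie`), it also shows that the matrix of
constraints is invertible at every point of the slice, so that its determinant is a unit by the
Nullstellensatz.

Generators. Let `X(u)` be the block column with first block `1` such that `(u - M) X(u)` is zero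
except for its last block `T(u)`. Up to a constant, `T(u)` is a monic matrix polynomial of degree
`p`. The block `A_m` enters its coefficient of index `m + 1` with a non-zero scalar factor, and the
rest of that coefficient depends on earlier blocks only. Hence `M ↦ T` is bijective over every
commutative algebra, and `M` is fixed by τ exactly when `T` has the symmetry of the twisted Yangian.
The two algebras therefore have the same points, which is the isomorphism of algebras
(`exists_algEquiv`).

Bracket. The gradient of `T_{ij}(u)` is `-X(u) E_{ji} Y(u)`, where the row `Y(u)` is the folded
counterpart of `X`. Its commutator with `M` is supported in the last block row and the first block
column, hence on or below the block diagonal, and for such gradients the Dirac bracket is simply `tr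
(M [ξ, ζ])` (`eval_diracBracket`). Since `(u - v) Y(u) X(v) = T(u) - T(v)`, this trace is the `r(u -
v)` term. Projecting the gradients to `gl(Np)^τ` adds their images under τ, which are gradients at
`-v` and produce `r'(u + v)`, together with a factor `1/2` that is absorbed by `u ↦ u/2`. The Jacobi
identity is checked on entries of the generating matrix at generic parameters, where it follows from
partial fractions (`jacobi_sklyanin`), and is carried over to the Yangian by the isomorphism.

Orthogonal and symplectic cases. A signed permutation matrix conjugates `gl(Np)^τ` into the algebra
of a form whose two off-diagonal blocks carry the signs `(-1)^(p+1)` and `θ₀`. Equal signs give `so`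
and opposite signs give `sp`. For odd `N` the middle index contributes one more block, with an
antidiagonal form. -/

open MvPolynomial
open scoped Kronecker

noncomputable section

namespace FoldedW

attribute [local instance 100] LieRing.ofAssociativeRing


/-! ### Biderivations -/

section Biderivation

variable {A B : Type*} [CommRing A] [Algebra ℂ A] [CommRing B] [Algebra ℂ B]

/-- A `ℂ`-bilinear map that is a derivation in each argument. -/
structure IsBiderivation (br : A → A → A) : Prop where
  add_left : ∀ a b c, br (a + b) c = br a c + br b c
  add_right : ∀ a b c, br a (b + c) = br a b + br a c
  smul_left : ∀ (z : ℂ) (a b : A), br (z • a) b = z • br a b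
  smul_right : ∀ (z : ℂ) (a b : A), br a (z • b) = z • br a b
  mul_left : ∀ a b c, br (a * b) c = a * br b c + br a c * b
  mul_right : ∀ a b c, br a (b * c) = b * br a c + br a b * c

namespace IsBiderivation

variable {br : A → A → A} {br' : B → B → B}

theorem swap (h : IsBiderivation br) : IsBiderivation fun a b => br b a :=
  ⟨fun a b c => h.add_right c a b, fun a b c => h.add_left b c a,
    fun z a b => h.smul_right z b a, fun z a b => h.smul_left z b a,
    fun a b c => h.mul_right c a b, fun a b c => h.mul_left b c a⟩

theorem neg (h : IsBiderivation br) : IsBiderivation fun a b => -br a b := by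
  constructor <;> intros <;>
    simp [h.add_left, h.add_right, h.smul_left, h.smul_right, h.mul_left, h.mul_right] <;> ring

theorem one_left (h : IsBiderivation br) (b : A) : br 1 b = 0 := by
  have := h.mul_left 1 1 b
  simpa using this

theorem algebraMap_left (h : IsBiderivation br) (z : ℂ) (b : A) : br (algebraMap ℂ A z) b = 0 := by
  rw [Algebra.algebraMap_eq_smul_one, h.smul_left, h.one_left, smul_zero]

theorem algebraMap_right (h : IsBiderivation br) (z : ℂ) (b : A) : br b (algebraMap ℂ A z) = 0 :=
  h.swap.algebraMap_left z b

theorem neg_left (h : IsBiderivation br) (a b : A) : br (-a) b = -br a b := by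
  have := h.smul_left (-1) a b
  simpa using this

theorem sub_left (h : IsBiderivation br) (a b c : A) : br (a - b) c = br a c - br b c := by
  rw [sub_eq_add_neg, h.add_left, h.neg_left, sub_eq_add_neg]

theorem sub_right (h : IsBiderivation br) (a b c : A) : br a (b - c) = br a b - br a c :=
  h.swap.sub_left b c a

theorem sum_left (h : IsBiderivation br) {ι : Type*} (s : Finset ι) (f : ι → A) (b : A) :
    br (∑ i ∈ s, f i) b = ∑ i ∈ s, br (f i) b :=
  map_sum (AddMonoidHom.mk' (fun a => br a b) fun a c => h.add_left a c b) f s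

theorem sum_right (h : IsBiderivation br) {ι : Type*} (s : Finset ι) (f : ι → A) (b : A) :
    br b (∑ i ∈ s, f i) = ∑ i ∈ s, br b (f i) :=
  h.swap.sum_left s f b

/-- An algebra morphism that respects two biderivations on generators respects them. -/
theorem map_eq_of_adjoin (h : IsBiderivation br) (h' : IsBiderivation br') (Φ : A →ₐ[ℂ] B)
    {G₁ G₂ : Set A} (hG₁ : Algebra.adjoin ℂ G₁ = ⊤) (hG₂ : Algebra.adjoin ℂ G₂ = ⊤)
    (hG : ∀ a ∈ G₁, ∀ b ∈ G₂, Φ (br a b) = br' (Φ a) (Φ b)) (a b : A) :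
    Φ (br a b) = br' (Φ a) (Φ b) := by
  have key : ∀ a ∈ G₁, ∀ b, Φ (br a b) = br' (Φ a) (Φ b) := by
    intro a ha b
    have hb : b ∈ Algebra.adjoin ℂ G₂ := hG₂ ▸ Algebra.mem_top
    induction hb using Algebra.adjoin_induction with
    | mem x hx => exact hG a ha x hx
    | algebraMap r => rw [h.algebraMap_right, AlgHom.commutes, h'.algebraMap_right, map_zero]
    | add x y _ _ hx hy => rw [h.add_right, map_add, map_add, h'.add_right, hx, hy]
    | mul x y _ _ hx hy =>
      rw [h.mul_right, map_add, map_mul, map_mul, map_mul, h'.mul_right, hx, hy]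
  have ha : a ∈ Algebra.adjoin ℂ G₁ := hG₁ ▸ Algebra.mem_top
  induction ha using Algebra.adjoin_induction with
  | mem x hx => exact key x hx b
  | algebraMap r => rw [h.algebraMap_left, AlgHom.commutes, h'.algebraMap_left, map_zero]
  | add x y _ _ hx hy => rw [h.add_left, map_add, map_add, h'.add_left, hx, hy]
  | mul x y _ _ hx hy =>
    rw [h.mul_left, map_add, map_mul, map_mul, map_mul, h'.mul_left, hx, hy]

/-- With `b` and `c` fixed, the Jacobi sum is a derivation in `a`: the cross terms produced by the
Leibniz rule cancel by skew-symmetry. -/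
theorem jacobi_mem (h : IsBiderivation br) (hs : ∀ a b, br a b = -br b a) {G : Set A}
    (hG : Algebra.adjoin ℂ G = ⊤) (b c : A)
    (hJ : ∀ a ∈ G, br a (br b c) + br b (br c a) + br c (br a b) = 0) (a : A) :
    br a (br b c) + br b (br c a) + br c (br a b) = 0 := by
  have ha : a ∈ Algebra.adjoin ℂ G := hG ▸ Algebra.mem_top
  induction ha using Algebra.adjoin_induction with
  | mem x hx => exact hJ x hx
  | algebraMap r =>
    have h0 : ∀ d, br d 0 = 0 := fun d => by
      have := h.smul_right 0 d 0
      simpa using this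
    simp [h.algebraMap_left, h.algebraMap_right, h0]
  | add x y _ _ hx hy =>
    simp only [h.add_left, h.add_right]
    linear_combination hx + hy
  | mul x y _ _ hx hy =>
    simp only [h.mul_left, h.mul_right, h.add_right]
    rw [hs c x, hs b y] at *
    linear_combination x * hy + y * hx + br c y * hs x b

/-- The Jacobi identity of a skew biderivation may be checked on generators. -/
theorem jacobi_of_adjoin (h : IsBiderivation br) (hs : ∀ a b, br a b = -br b a)
    {G₁ G₂ G₃ : Set A} (hG₁ : Algebra.adjoin ℂ G₁ = ⊤) (hG₂ : Algebra.adjoin ℂ G₂ = ⊤)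
    (hG₃ : Algebra.adjoin ℂ G₃ = ⊤)
    (hJ : ∀ a ∈ G₁, ∀ b ∈ G₂, ∀ c ∈ G₃, br a (br b c) + br b (br c a) + br c (br a b) = 0)
    (a b c : A) : br a (br b c) + br b (br c a) + br c (br a b) = 0 := by
  -- The Jacobi sum is cyclic, so each argument can be rotated to the front in turn. Three
  -- generating sets are allowed so that the parameters of the generators can later be drawn from
  -- disjoint ranges.
  refine h.jacobi_mem hs hG₁ b c (fun a ha => ?_) a
  have h1 : br b (br c a) + br c (br a b) + br a (br b c) = 0 := by
    refine h.jacobi_mem hs hG₂ c a (fun b hb => ?_) b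
    have h2 : br c (br a b) + br a (br b c) + br b (br c a) = 0 := by
      refine h.jacobi_mem hs hG₃ a b (fun c hc => ?_) c
      linear_combination hJ a ha b hb c hc
    linear_combination h2
  linear_combination h1

theorem isPoissonBracket (h : IsBiderivation br) (hs : ∀ a b, br a b = -br b a)
    (hJ : ∀ a b c, br a (br b c) + br b (br c a) + br c (br a b) = 0) : IsPoissonBracket br :=
  ⟨h.add_left, h.smul_left, hs, h.mul_left, hJ⟩

end IsBiderivation

/-- A Poisson bracket transported along an isomorphism is a Poisson bracket. -/
theorem IsPoissonBracket.of_algEquiv {br : A → A → A} {br' : B → B → B}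
    (h : IsPoissonBracket br') (Φ : A ≃ₐ[ℂ] B) (hΦ : ∀ a b, Φ (br a b) = br' (Φ a) (Φ b)) :
    IsPoissonBracket br where
  add_left a b c := Φ.injective (by simp [hΦ, h.add_left])
  smul_left z a b := Φ.injective (by simp [hΦ, h.smul_left])
  skew a b := Φ.injective (by rw [hΦ, h.skew]; simp [hΦ])
  leibniz a b c := Φ.injective (by simp [hΦ, h.leibniz])
  jacobi a b c := Φ.injective (by simp [hΦ, h.jacobi])

end Biderivation

section PolyBracketSum

variable {σ : Type*} (c : σ → σ → MvPolynomial σ ℂ)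

theorem polyBracket_isBiderivation : IsBiderivation (polyBracket c) where
  add_left := polyBracket_add_left c
  add_right := polyBracket_add_right c
  smul_left z f g := by
    rw [MvPolynomial.smul_eq_C_mul, polyBracket_mul_left, polyBracket_C_left,
      MvPolynomial.smul_eq_C_mul]; ring
  smul_right z f g := by
    rw [MvPolynomial.smul_eq_C_mul, polyBracket_mul_right, polyBracket_C_right,
      MvPolynomial.smul_eq_C_mul]; ring
  mul_left f g k := by rw [polyBracket_mul_left]; ring
  mul_right f g k := by rw [polyBracket_mul_right]; ring

end PolyBracketSum

/-! ### Generating functions -/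

/-- A linear functional on the quotient by `W` turns the sum into an ordinary polynomial with
infinitely many roots, and such functionals separate points. No finiteness of `V` is needed. -/
theorem coeff_mem_of_infinite {V : Type*} [AddCommGroup V] [Module ℂ V] (W : Submodule ℂ V)
    (s : ℕ → V) (n : ℕ) {U : Set ℂ} (hU : U.Infinite)
    (h : ∀ u ∈ U, ∑ m ∈ Finset.range n, u ^ m • s m ∈ W) {m : ℕ} (hm : m < n) : s m ∈ W := by
  rw [← Submodule.Quotient.mk_eq_zero, ← Module.forall_dual_apply_eq_zero_iff ℂ]
  intro φ
  let P : Polynomial ℂ := ∑ m ∈ Finset.range n, Polynomial.monomial m (φ (W.mkQ (s m)))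
  have hP : P = 0 := by
    refine Polynomial.eq_zero_of_infinite_isRoot P (hU.mono fun u hu => ?_)
    have h1 : φ (W.mkQ (∑ m ∈ Finset.range n, u ^ m • s m)) = 0 := by
      rw [Submodule.mkQ_apply, (Submodule.Quotient.mk_eq_zero W).2 (h u hu), map_zero]
    rw [Set.mem_ofPred_eq, Polynomial.IsRoot.def]
    simp only [P, Polynomial.eval_finsetSum, Polynomial.eval_monomial]
    simpa [mul_comm] using h1
  have h2 : P.coeff m = φ (W.mkQ (s m)) := by
    simp [P, Polynomial.finsetSum_coeff, Polynomial.coeff_monomial, hm]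
  rw [hP] at h2
  simpa using h2.symm

section GenSeries

variable {A : Type*} [CommRing A]

/-- `u^p S(u)`, for a series `S(u)` that is truncated at level `p`. -/
def genSeries {N : ℕ} (S : ℕ → Fin N → Fin N → A) (p : ℕ) (u : A) (i j : Fin N) : A :=
  ∑ m ∈ Finset.range (p + 1), u ^ (p - m) * S m i j

/-- Both sides are the sum of `u ^ (p + 1 - m) * g m` over `m ≤ p + 1`: one boundary condition
removes its last term, the other its first. -/
theorem sum_shift (g : ℕ → A) (p : ℕ) (u : A) (h0 : g 0 = 0) (hp : g (p + 1) = 0) :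
    u * ∑ m ∈ Finset.range (p + 1), u ^ (p - m) * g m
      = ∑ m ∈ Finset.range (p + 1), u ^ (p - m) * g (m + 1) := by
  have h1 := Finset.sum_range_succ (fun m => u ^ (p + 1 - m) * g m) (p + 1)
  have h2 := Finset.sum_range_succ' (fun m => u ^ (p + 1 - m) * g m) (p + 1)
  rw [hp, mul_zero, add_zero] at h1
  rw [h0, mul_zero, add_zero, h1] at h2
  simp only [Nat.add_sub_add_right] at h2
  rw [← h2, Finset.mul_sum]
  refine Finset.sum_congr rfl fun m hm => ?_
  rw [Nat.sub_add_comm (Nat.lt_succ_iff.1 (Finset.mem_range.1 hm)), pow_succ]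
  ring

/-- Multiplication of a double generating function by `u - εv`. -/
theorem sum_sum_shift (g : ℕ → ℕ → A) (p : ℕ) (u v ε : A) (h0 : ∀ n, g 0 n = 0)
    (h0' : ∀ m, g m 0 = 0) (hp : ∀ n, g (p + 1) n = 0) (hp' : ∀ m, g m (p + 1) = 0) :
    (u - ε * v) * ∑ m ∈ Finset.range (p + 1), ∑ n ∈ Finset.range (p + 1),
        u ^ (p - m) * v ^ (p - n) * g m n
      = ∑ m ∈ Finset.range (p + 1), ∑ n ∈ Finset.range (p + 1),
        u ^ (p - m) * v ^ (p - n) * (g (m + 1) n - ε * g m (n + 1)) := by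
  have h1 := sum_shift (fun m => ∑ n ∈ Finset.range (p + 1), v ^ (p - n) * g m n) p u
    (by simp [h0]) (by simp [hp])
  have h2 : v * ∑ m ∈ Finset.range (p + 1), ∑ n ∈ Finset.range (p + 1),
        u ^ (p - m) * v ^ (p - n) * g m n
      = ∑ m ∈ Finset.range (p + 1), ∑ n ∈ Finset.range (p + 1),
        u ^ (p - m) * v ^ (p - n) * g m (n + 1) := by
    rw [Finset.mul_sum]
    refine Finset.sum_congr rfl fun m _ => ?_
    have := sum_shift (g m) p v (h0' m) (hp' m)
    simp only [mul_assoc, ← Finset.mul_sum] at this ⊢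
    rw [← this]; ring
  simp only [Finset.mul_sum, ← mul_assoc] at h1
  simp only [mul_sub, Finset.sum_sub_distrib, sub_mul]
  rw [mul_assoc, h2]
  congr 1
  · rw [← h1]; simp only [Finset.mul_sum, mul_assoc]
  · simp only [Finset.mul_sum]
    refine Finset.sum_congr rfl fun m _ => Finset.sum_congr rfl fun n _ => ?_
    ring

end GenSeries

namespace Signs

variable {N : ℕ} (θ : Signs N)

/-! ### The defining bracket as an identity between generating functions -/

section Sklyanin

variable {A : Type*} [CommRing A]

/-- The part of `genBracket` that comes from `r₁₂(u - v)`. -/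
def genBracketUntwisted (S : ℕ → Fin N → Fin N → A)
    (m : ℕ) (i j : Fin N) (n : ℕ) (k l : Fin N) : A :=
  ∑ r ∈ Finset.range (min m n),
    (S r k j * S (m + n - r - 1) i l - S (m + n - r - 1) k j * S r i l)

/-- The part of `genBracket` that comes from `r'₁₂(u + v)`. -/
def genBracketTwisted (S : ℕ → Fin N → Fin N → A)
    (m : ℕ) (i j : Fin N) (n : ℕ) (k l : Fin N) : A :=
  ∑ r ∈ Finset.range (min m n),
    (-1) ^ (m + r) *
        (((θ.sgn k : ℤ) : A) * ((θ.sgn j : ℤ) : A) * S r i k.rev * S (m + n - r - 1) j.rev l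
          - ((θ.sgn i : ℤ) : A) * ((θ.sgn l : ℤ) : A) *
            S (m + n - r - 1) k i.rev * S r l.rev j)

theorem genBracket_eq (S : ℕ → Fin N → Fin N → A) (m : ℕ) (i j : Fin N) (n : ℕ) (k l : Fin N) :
    θ.genBracket S m i j n k l = genBracketUntwisted S m i j n k l
      + ((θ.sgn₀ : ℤ) : A) * θ.genBracketTwisted S m i j n k l := by
  unfold genBracket genBracketUntwisted genBracketTwisted
  rw [Finset.mul_sum, ← Finset.sum_add_distrib]
  exact Finset.sum_congr rfl fun r _ => by ring

/-- Coefficient form of multiplication by `u - v`. The two sums have the same summands and ranges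
that differ by at most one, so a single term survives; for `m = n` both sides vanish. -/
theorem genBracketUntwisted_succ (S : ℕ → Fin N → Fin N → A) (m : ℕ) (i j : Fin N) (n : ℕ)
    (k l : Fin N) :
    genBracketUntwisted S (m + 1) i j n k l - genBracketUntwisted S m i j (n + 1) k l
      = S m k j * S n i l - S n k j * S m i l := by
  unfold genBracketUntwisted
  have e1 : ∀ r, m + 1 + n - r - 1 = m + n - r := fun r => by omega
  have e2 : ∀ r, m + (n + 1) - r - 1 = m + n - r := fun r => by omega
  simp only [e1, e2]
  rcases lt_trichotomy m n with h | h | h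
  · rw [min_eq_left (by omega), min_eq_left (by omega), Finset.sum_range_succ,
      show m + n - m = n by omega]
    ring
  · subst h
    rw [min_eq_right (by omega), min_eq_left (by omega)]
    ring
  · rw [min_eq_right (by omega), min_eq_right (by omega), Finset.sum_range_succ,
      show m + n - n = m by omega]
    ring

/-- Coefficient form of multiplication by `u + v`: the sign `(-1) ^ (m + r)` changes with `m`, which
turns the sum of the two brackets into a telescoping difference. For `m < n` the surviving term is
already the right one. For `m > n` it has the indices in the opposite roles and the symmetry `hS`
brings it to the stated form; for `m = n` the symmetry makes the right-hand side vanish. -/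
theorem genBracketTwisted_succ {S : ℕ → Fin N → Fin N → A}
    (hS : ∀ m i j, S m i j = (-1) ^ m * ((θ.sgn i : ℤ) : A) * ((θ.sgn j : ℤ) : A)
      * S m j.rev i.rev) (m : ℕ) (i j : Fin N) (n : ℕ) (k l : Fin N) :
    θ.genBracketTwisted S (m + 1) i j n k l + θ.genBracketTwisted S m i j (n + 1) k l
      = -(((θ.sgn k : ℤ) : A) * ((θ.sgn j : ℤ) : A) * S m i k.rev * S n j.rev l
          - ((θ.sgn i : ℤ) : A) * ((θ.sgn l : ℤ) : A) * S n k i.rev * S m l.rev j) := by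
  unfold genBracketTwisted
  have e1 : ∀ r, m + 1 + n - r - 1 = m + n - r := fun r => by omega
  have e2 : ∀ r, m + (n + 1) - r - 1 = m + n - r := fun r => by omega
  have e3 : ∀ r, (-1 : A) ^ (m + 1 + r) = -(-1) ^ (m + r) := fun r => by
    rw [show m + 1 + r = (m + r) + 1 by ring, pow_succ]; ring
  simp only [e1, e2, e3, neg_mul, Finset.sum_neg_distrib]
  have sq : ∀ m : ℕ, (-1 : A) ^ m * (-1) ^ m = 1 := fun m => by rw [← mul_pow]; simp
  rcases lt_trichotomy m n with h | h | h
  · rw [min_eq_left (by omega), min_eq_left (by omega), Finset.sum_range_succ,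
      show m + n - m = n by omega, pow_add, sq]
    ring
  all_goals
    have h1 := hS m i k.rev
    have h2 := hS m l.rev j
    have h3 := hS n j.rev l
    have h4 := hS n k i.rev
    simp only [Fin.rev_rev, sgn_rev] at h1 h2 h3 h4
    have e0 := sgn_sq (A := A) θ.sgn₀
    have ei := sgn_sq (A := A) (θ.sgn i)
    have ej := sgn_sq (A := A) (θ.sgn j)
    have ek := sgn_sq (A := A) (θ.sgn k)
    have el := sgn_sq (A := A) (θ.sgn l)
    have em := sq m
    have en := sq n
  · subst h
    rw [min_eq_right (by omega), min_eq_left (by omega)]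
    clear hS e1 e2 e3 sq
    generalize ((θ.sgn₀ : ℤ) : A) = t0 at *
    generalize ((θ.sgn i : ℤ) : A) = ti at *
    generalize ((θ.sgn j : ℤ) : A) = tj at *
    generalize ((θ.sgn k : ℤ) : A) = tk at *
    generalize ((θ.sgn l : ℤ) : A) = tl at *
    rw [h1, h3]
    generalize ((-1 : A) ^ m) = sm at *
    clear h1 h2 h3 h4
    grind
  · rw [min_eq_right (by omega), min_eq_right (by omega), Finset.sum_range_succ,
      show m + n - n = m by omega, pow_add]
    have h5 := hS n i k.rev
    have h6 := hS m j.rev l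
    simp only [Fin.rev_rev, sgn_rev] at h5 h6
    clear hS e1 e2 e3 sq
    generalize ((θ.sgn₀ : ℤ) : A) = t0 at *
    generalize ((θ.sgn i : ℤ) : A) = ti at *
    generalize ((θ.sgn j : ℤ) : A) = tj at *
    generalize ((θ.sgn k : ℤ) : A) = tk at *
    generalize ((θ.sgn l : ℤ) : A) = tl at *
    rw [h5, h6, h1, h3]
    generalize ((-1 : A) ^ m) = sm at *
    generalize ((-1 : A) ^ n) = sn at *
    clear h1 h2 h3 h4 h5 h6
    grind

variable [Algebra ℂ A]

/-- The right-hand side of the defining relation of the bracket of the classical twisted Yangian,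
for a matrix `T(u)` that depends on a parameter: the entry `(ij, kl)` of
`[r₁₂(u-v), T₁(u) T₂(v)] + T₂(v) r'₁₂(u+v) T₁(u) - T₁(u) r'₁₂(u+v) T₂(v)`. -/
def sklyanin (T : ℂ → Fin N → Fin N → A) (u : ℂ) (i j : Fin N) (v : ℂ) (k l : Fin N) : A :=
  algebraMap ℂ A (u - v)⁻¹ * (T u k j * T v i l - T v k j * T u i l)
    - algebraMap ℂ A (u + v)⁻¹ * (((θ.sgn₀ : ℤ) : A) *
      (((θ.sgn k : ℤ) : A) * ((θ.sgn j : ℤ) : A) * T u i k.rev * T v j.rev l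
        - ((θ.sgn i : ℤ) : A) * ((θ.sgn l : ℤ) : A) * T v k i.rev * T u l.rev j))

theorem sklyanin_map {B : Type*} [CommRing B] [Algebra ℂ B] (Φ : A →ₐ[ℂ] B)
    (T : ℂ → Fin N → Fin N → A) (u : ℂ) (i j : Fin N) (v : ℂ) (k l : Fin N) :
    Φ (θ.sklyanin T u i j v k l) = θ.sklyanin (fun u i j => Φ (T u i j)) u i j v k l := by
  simp [sklyanin]

/-- Multiplying the untwisted part by `u - v` and the twisted part by `u + v` collapses the double
sums into products of two series. It remains to divide, which is why `u` and `v` may be neither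
equal nor opposite. -/
theorem bracket_genSeries {br : A → A → A} (hbr : IsBiderivation br) {p : ℕ}
    {S : ℕ → Fin N → Fin N → A}
    (hS : ∀ m i j, S m i j = (-1) ^ m * ((θ.sgn i : ℤ) : A) * ((θ.sgn j : ℤ) : A)
      * S m j.rev i.rev) (hp : ∀ m i j, p < m → S m i j = 0)
    (hbS : ∀ m i j n k l, br (S m i j) (S n k l) = θ.genBracket S m i j n k l)
    {u v : ℂ} (huv : u - v ≠ 0) (huv' : u + v ≠ 0) (i j k l : Fin N) :
    br (genSeries S p (algebraMap ℂ A u) i j) (genSeries S p (algebraMap ℂ A v) k l)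
      = θ.sklyanin (fun u => genSeries S p (algebraMap ℂ A u)) u i j v k l := by
  have hsm : ∀ (z : ℂ) (n : ℕ) (a : A), algebraMap ℂ A z ^ n * a = z ^ n • a := by
    intro z n a; rw [← map_pow, Algebra.smul_def]
  have h1 : br (genSeries S p (algebraMap ℂ A u) i j) (genSeries S p (algebraMap ℂ A v) k l)
      = ∑ m ∈ Finset.range (p + 1), ∑ n ∈ Finset.range (p + 1),
          algebraMap ℂ A u ^ (p - m) * algebraMap ℂ A v ^ (p - n)
            * θ.genBracket S m i j n k l := by
    unfold genSeries
    rw [hbr.sum_left]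
    refine Finset.sum_congr rfl fun m _ => ?_
    rw [hbr.sum_right]
    refine Finset.sum_congr rfl fun n _ => ?_
    rw [hsm, hsm, hbr.smul_left, hbr.smul_right, hbS, mul_assoc, hsm, hsm]
  -- The index of the second factor passes `p` as soon as `m` or `n` does. This supplies the
  -- boundary conditions at `p + 1` in the shift of indices.
  have hM : ∀ m n r, r < min m n → (p < m ∨ p < n) → p < m + n - r - 1 := by
    intro m n r hr h
    omega
  have h2 := sum_sum_shift (fun m n => genBracketUntwisted S m i j n k l) p
    (algebraMap ℂ A u) (algebraMap ℂ A v) 1 (by simp [genBracketUntwisted])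
    (by simp [genBracketUntwisted])
    (fun n => Finset.sum_eq_zero fun r hr => by
      simp [hp _ _ _ (hM _ _ _ (Finset.mem_range.1 hr) (Or.inl p.lt_succ_self))])
    (fun n => Finset.sum_eq_zero fun r hr => by
      simp [hp _ _ _ (hM _ _ _ (Finset.mem_range.1 hr) (Or.inr p.lt_succ_self))])
  have h3 := sum_sum_shift (fun m n => θ.genBracketTwisted S m i j n k l) p
    (algebraMap ℂ A u) (algebraMap ℂ A v) (-1) (by simp [genBracketTwisted])
    (by simp [genBracketTwisted])
    (fun n => Finset.sum_eq_zero fun r hr => by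
      simp [hp _ _ _ (hM _ _ _ (Finset.mem_range.1 hr) (Or.inl p.lt_succ_self))])
    (fun n => Finset.sum_eq_zero fun r hr => by
      simp [hp _ _ _ (hM _ _ _ (Finset.mem_range.1 hr) (Or.inr p.lt_succ_self))])
  simp only [one_mul, genBracketUntwisted_succ] at h2
  simp only [neg_mul, sub_neg_eq_add, one_mul, genBracketTwisted_succ θ hS] at h3
  have prod : ∀ a b c d : Fin N, ∑ m ∈ Finset.range (p + 1), ∑ n ∈ Finset.range (p + 1),
        algebraMap ℂ A u ^ (p - m) * algebraMap ℂ A v ^ (p - n) * (S m a b * S n c d)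
      = genSeries S p (algebraMap ℂ A u) a b * genSeries S p (algebraMap ℂ A v) c d := by
    intro a b c d
    unfold genSeries
    rw [Finset.sum_mul_sum]
    exact Finset.sum_congr rfl fun m _ => Finset.sum_congr rfl fun n _ => by ring
  have r2 : ∀ m n, algebraMap ℂ A u ^ (p - m) * algebraMap ℂ A v ^ (p - n)
        * (S m k j * S n i l - S n k j * S m i l)
      = algebraMap ℂ A u ^ (p - m) * algebraMap ℂ A v ^ (p - n) * (S m k j * S n i l)
        - algebraMap ℂ A u ^ (p - m) * algebraMap ℂ A v ^ (p - n) * (S m i l * S n k j) :=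
    fun m n => by ring
  have r3 : ∀ m n, algebraMap ℂ A u ^ (p - m) * algebraMap ℂ A v ^ (p - n)
        * -(((θ.sgn k : ℤ) : A) * ((θ.sgn j : ℤ) : A) * S m i k.rev * S n j.rev l
          - ((θ.sgn i : ℤ) : A) * ((θ.sgn l : ℤ) : A) * S n k i.rev * S m l.rev j)
      = ((θ.sgn i : ℤ) : A) * ((θ.sgn l : ℤ) : A) * (algebraMap ℂ A u ^ (p - m)
          * algebraMap ℂ A v ^ (p - n) * (S m l.rev j * S n k i.rev))
        - ((θ.sgn k : ℤ) : A) * ((θ.sgn j : ℤ) : A) * (algebraMap ℂ A u ^ (p - m)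
          * algebraMap ℂ A v ^ (p - n) * (S m i k.rev * S n j.rev l)) :=
    fun m n => by ring
  simp only [r2, Finset.sum_sub_distrib, prod] at h2
  simp only [r3, Finset.sum_sub_distrib, ← Finset.mul_sum, prod] at h3
  have i2 : algebraMap ℂ A (u - v)⁻¹ * (algebraMap ℂ A u - algebraMap ℂ A v) = 1 := by
    rw [← map_sub, ← map_mul, inv_mul_cancel₀ huv, map_one]
  have i3 : algebraMap ℂ A (u + v)⁻¹ * (algebraMap ℂ A u + algebraMap ℂ A v) = 1 := by
    rw [← map_add, ← map_mul, inv_mul_cancel₀ huv', map_one]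
  have h4 : ∑ m ∈ Finset.range (p + 1), ∑ n ∈ Finset.range (p + 1),
        algebraMap ℂ A u ^ (p - m) * algebraMap ℂ A v ^ (p - n) * θ.genBracket S m i j n k l
      = ∑ m ∈ Finset.range (p + 1), ∑ n ∈ Finset.range (p + 1),
          algebraMap ℂ A u ^ (p - m) * algebraMap ℂ A v ^ (p - n)
            * genBracketUntwisted S m i j n k l
        + ((θ.sgn₀ : ℤ) : A) * ∑ m ∈ Finset.range (p + 1), ∑ n ∈ Finset.range (p + 1),
          algebraMap ℂ A u ^ (p - m) * algebraMap ℂ A v ^ (p - n)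
            * θ.genBracketTwisted S m i j n k l := by
    rw [Finset.mul_sum, ← Finset.sum_add_distrib]
    refine Finset.sum_congr rfl fun m _ => ?_
    rw [Finset.mul_sum, ← Finset.sum_add_distrib]
    exact Finset.sum_congr rfl fun n _ => by rw [genBracket_eq]; ring
  rw [h1, h4]
  unfold sklyanin
  generalize (∑ m ∈ Finset.range (p + 1), ∑ n ∈ Finset.range (p + 1),
          algebraMap ℂ A u ^ (p - m) * algebraMap ℂ A v ^ (p - n)
            * genBracketUntwisted S m i j n k l) = s2 at *
  generalize (∑ m ∈ Finset.range (p + 1), ∑ n ∈ Finset.range (p + 1),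
          algebraMap ℂ A u ^ (p - m) * algebraMap ℂ A v ^ (p - n)
            * θ.genBracketTwisted S m i j n k l) = s3 at *
  linear_combination (-s2) * i2 + algebraMap ℂ A (u - v)⁻¹ * h2
    - ((θ.sgn₀ : ℤ) : A) * s3 * i3 + algebraMap ℂ A (u + v)⁻¹ * ((θ.sgn₀ : ℤ) : A) * h3

/-- The entries of `T(u)`, for `u` in a set of parameters. -/
def entrySet (T : ℂ → Fin N → Fin N → A) (U : Set ℂ) : Set A :=
  {a | ∃ u ∈ U, ∃ i j, a = T u i j}

end Sklyanin

/-! ### The generators of the truncated twisted Yangian -/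

/-- The generators `S_(m)^{ij}` of the truncated twisted Yangian. -/
def yangianS (p m : ℕ) (i j : Fin N) : θ.TruncTwistedYangian p :=
  Ideal.Quotient.mk (θ.relIdeal p) (symS m i j)

theorem yangianS_zero (p : ℕ) (i j : Fin N) : θ.yangianS p 0 i j = if i = j then 1 else 0 := by
  simp only [yangianS, symS]
  split_ifs <;> simp

theorem yangianS_symm (p m : ℕ) (i j : Fin N) :
    θ.yangianS p m i j = (-1) ^ m * ((θ.sgn i : ℤ) : θ.TruncTwistedYangian p)
        * ((θ.sgn j : ℤ) : θ.TruncTwistedYangian p) * θ.yangianS p m j.rev i.rev := by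
  have hmem : symS m i j - (-1) ^ m * ((θ.sgn i : ℤ) : MvPolynomial (ℕ × Fin N × Fin N) ℂ) *
      ((θ.sgn j : ℤ) : MvPolynomial (ℕ × Fin N × Fin N) ℂ) * symS m j.rev i.rev
        ∈ θ.relIdeal p := Ideal.subset_span (Or.inl ⟨m, i, j, rfl⟩)
  have := Ideal.Quotient.eq_zero_iff_mem.2 hmem
  rw [map_sub, sub_eq_zero] at this
  simpa [yangianS] using this

theorem yangianS_trunc (p m : ℕ) (i j : Fin N) (h : p < m) : θ.yangianS p m i j = 0 :=
  Ideal.Quotient.eq_zero_iff_mem.2 (Ideal.subset_span (Or.inr ⟨m, i, j, h, rfl⟩))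

theorem truncBracket_yangianS (p m : ℕ) (i j : Fin N) (n : ℕ) (k l : Fin N) :
    θ.truncBracket p (θ.yangianS p m i j) (θ.yangianS p n k l)
      = θ.genBracket (θ.yangianS p) m i j n k l := by
  unfold yangianS
  rw [truncBracket_mk, freeBracket_symS, map_genBracket]

theorem truncBracket_isBiderivation (p : ℕ) : IsBiderivation (θ.truncBracket p) := by
  have h := polyBracket_isBiderivation (fun x y : ℕ × Fin N × Fin N =>
    θ.genBracket symS (x.1 + 1) x.2.1 x.2.2 (y.1 + 1) y.2.1 y.2.2)
  have hsm : ∀ (z : ℂ) (f : MvPolynomial (ℕ × Fin N × Fin N) ℂ),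
      z • Ideal.Quotient.mk (θ.relIdeal p) f = Ideal.Quotient.mk (θ.relIdeal p) (z • f) :=
    fun _ _ => rfl
  constructor
  all_goals
    intro a b c
    try obtain ⟨a, rfl⟩ := Ideal.Quotient.mk_surjective a
    obtain ⟨b, rfl⟩ := Ideal.Quotient.mk_surjective b
    obtain ⟨c, rfl⟩ := Ideal.Quotient.mk_surjective c
  · rw [← map_add]; simp only [truncBracket_mk]; rw [← map_add]
    exact congrArg _ (h.add_left a b c)
  · rw [← map_add]; simp only [truncBracket_mk]; rw [← map_add]
    exact congrArg _ (h.add_right a b c)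
  · rw [hsm]; simp only [truncBracket_mk]; rw [hsm]
    exact congrArg _ (h.smul_left a b c)
  · rw [hsm]; simp only [truncBracket_mk]; rw [hsm]
    exact congrArg _ (h.smul_right a b c)
  · rw [← map_mul]; simp only [truncBracket_mk]; rw [← map_mul, ← map_mul, ← map_add]
    exact congrArg _ (h.mul_left a b c)
  · rw [← map_mul]; simp only [truncBracket_mk]; rw [← map_mul, ← map_mul, ← map_add]
    exact congrArg _ (h.mul_right a b c)

/-- `u^p S(u)` at the number `u`. -/
def yangianSeries (p : ℕ) (u : ℂ) (i j : Fin N) : θ.TruncTwistedYangian p :=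
  genSeries (θ.yangianS p) p (algebraMap ℂ _ u) i j

theorem truncBracket_yangianSeries (p : ℕ) {u v : ℂ} (huv : u - v ≠ 0) (huv' : u + v ≠ 0)
    (i j k l : Fin N) :
    θ.truncBracket p (θ.yangianSeries p u i j) (θ.yangianSeries p v k l)
      = θ.sklyanin (θ.yangianSeries p) u i j v k l :=
  θ.bracket_genSeries (θ.truncBracket_isBiderivation p) (θ.yangianS_symm p) (θ.yangianS_trunc p)
    (θ.truncBracket_yangianS p) huv huv' i j k l

/-- The coefficients of a polynomial lie in the span of its values at infinitely many points. The
free choice of `U` allows different arguments of a bracket to be evaluated at parameters that are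
never equal or opposite. -/
theorem adjoin_yangianSeries (p : ℕ) {U : Set ℂ} (hU : U.Infinite) :
    Algebra.adjoin ℂ (entrySet (θ.yangianSeries p) U) = ⊤ := by
  set G := Algebra.adjoin ℂ (entrySet (θ.yangianSeries p) U) with hG
  have hS : ∀ m i j, θ.yangianS p m i j ∈ G := by
    intro m i j
    by_cases hm : p < m
    · rw [θ.yangianS_trunc p m i j hm]; exact G.zero_mem
    -- The index is reversed because `S_(m)` is the coefficient of `u ^ (p - m)`.
    · have := coeff_mem_of_infinite (Subalgebra.toSubmodule G)
        (fun m => θ.yangianS p (p - m) i j) (p + 1) hU (fun u hu => ?_)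
        (show p - m < p + 1 by omega)
      · simpa [Nat.sub_sub_self (not_lt.1 hm)] using this
      · have h1 : θ.yangianSeries p u i j ∈ G := Algebra.subset_adjoin ⟨u, hu, i, j, rfl⟩
        rw [yangianSeries, genSeries, ← Finset.sum_range_reflect] at h1
        rw [Subalgebra.mem_toSubmodule]
        convert h1 using 1
        refine Finset.sum_congr rfl fun m hm => ?_
        have hm' := Finset.mem_range.1 hm
        rw [Algebra.smul_def, map_pow, show p + 1 - 1 - m = p - m by omega,
          Nat.sub_sub_self (by omega)]
  refine eq_top_iff.2 fun a _ => ?_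
  obtain ⟨f, rfl⟩ := Ideal.Quotient.mk_surjective a
  induction f using MvPolynomial.induction_on with
  | C z => exact G.algebraMap_mem z
  | add f g hf hg => rw [map_add]; exact G.add_mem (hf trivial) (hg trivial)
  | mul_X f x hf => rw [map_mul]; exact G.mul_mem (hf trivial) (hS (x.1 + 1) x.2.1 x.2.2)

end Signs

/-! ### The Jacobi identity at generic parameters -/

namespace Signs

variable {N : ℕ} (θ : Signs N) {A : Type*} [CommRing A] [Algebra ℂ A]

/-- The partial fraction identity behind the classical Yang–Baxter equation for `r(x) = P/x`. -/
theorem inv_partial_fraction {x y z : ℂ} (h : x + y + z = 0) (hx : x ≠ 0) (hy : y ≠ 0)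
    (hz : z ≠ 0) : algebraMap ℂ A x⁻¹ * algebraMap ℂ A y⁻¹ + algebraMap ℂ A y⁻¹ * algebraMap ℂ A z⁻¹
      + algebraMap ℂ A z⁻¹ * algebraMap ℂ A x⁻¹ = 0 := by
  rw [← map_mul, ← map_mul, ← map_mul, ← map_add, ← map_add]
  have : x⁻¹ * y⁻¹ + y⁻¹ * z⁻¹ + z⁻¹ * x⁻¹ = 0 := by
    field_simp
    linear_combination h
  rw [this, map_zero]

/-- By the Leibniz rule every term is cubic in `T`, with a product of two inverses of sums or
differences of parameters as coefficient. Four partial fraction identities make these cancel: the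
one for `(u, v, w)`, and those obtained by changing the sign of exactly one parameter. -/
theorem jacobi_sklyanin {br : A → A → A} (h : IsBiderivation br)
    {T : ℂ → Fin N → Fin N → A}
    (hT : ∀ u v : ℂ, u - v ≠ 0 → u + v ≠ 0 → ∀ i j k l,
      br (T u i j) (T v k l) = θ.sklyanin T u i j v k l)
    {u v w : ℂ} (h1 : u - v ≠ 0) (h2 : u + v ≠ 0) (h3 : v - w ≠ 0) (h4 : v + w ≠ 0)
    (h5 : w - u ≠ 0) (h6 : w + u ≠ 0) (i j k l m n : Fin N) :
    br (T u i j) (br (T v k l) (T w m n)) + br (T v k l) (br (T w m n) (T u i j))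
      + br (T w m n) (br (T u i j) (T v k l)) = 0 := by
  have hint : ∀ (a : A) (z : ℤ), br a (z : A) = 0 := fun a z => by
    have := h.algebraMap_right z a
    simpa using this
  have h1' : v - u ≠ 0 := fun h => h1 (by linear_combination -h)
  have h2' : v + u ≠ 0 := fun h => h2 (by linear_combination h)
  have h3' : w - v ≠ 0 := fun h => h3 (by linear_combination -h)
  have h4' : w + v ≠ 0 := fun h => h4 (by linear_combination h)
  have h5' : u - w ≠ 0 := fun h => h5 (by linear_combination -h)
  have h6' : u + w ≠ 0 := fun h => h6 (by linear_combination h)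
  have e1 : (v - u)⁻¹ = -(u - v)⁻¹ := by rw [← inv_neg, neg_sub]
  have e2 : (w - v)⁻¹ = -(v - w)⁻¹ := by rw [← inv_neg, neg_sub]
  have e3 : (u - w)⁻¹ = -(w - u)⁻¹ := by rw [← inv_neg, neg_sub]
  have p1 := inv_partial_fraction (A := A) (x := u - v) (y := v - w) (z := w - u) (by ring) h1 h3 h5
  have p2 := inv_partial_fraction (A := A) (x := u + v) (y := - (v + w)) (z := w - u) (by ring) h2
    (neg_ne_zero.2 h4) h5
  have p3 := inv_partial_fraction (A := A) (x := -(u + v)) (y := v - w) (z := w + u) (by ring)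
    (neg_ne_zero.2 h2) h3 h6
  have p4 := inv_partial_fraction (A := A) (x := u - v) (y := v + w) (z := -(w + u)) (by ring)
    h1 h4 (neg_ne_zero.2 h6)
  -- The inner brackets are expanded in cyclic order. The outer ones then involve both orders of
  -- each pair of parameters, so the reversed differences are normalised afterwards by `e1`, `e2`,
  -- `e3`.
  rw [hT v w h3 h4, hT w u h5 h6, hT u v h1 h2]
  unfold sklyanin
  simp only [h.sub_right, h.mul_right, h.algebraMap_right, hint, zero_mul, mul_zero, add_zero,
    hT u v h1 h2, hT v u h1' h2', hT v w h3 h4, hT w v h3' h4', hT w u h5 h6, hT u w h5' h6']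
  unfold sklyanin
  rw [add_comm v u, add_comm w v, add_comm u w, e1, e2, e3]
  simp only [inv_neg, map_neg] at p2 p3 p4 ⊢
  simp only [Fin.rev_rev, sgn_rev]
  have q0 := sgn_sq (A := A) θ.sgn₀
  have qi := sgn_sq (A := A) (θ.sgn i)
  have qj := sgn_sq (A := A) (θ.sgn j)
  have qk := sgn_sq (A := A) (θ.sgn k)
  have ql := sgn_sq (A := A) (θ.sgn l)
  have qm := sgn_sq (A := A) (θ.sgn m)
  have qn := sgn_sq (A := A) (θ.sgn n)
  clear hT hint h
  generalize ((θ.sgn₀ : ℤ) : A) = t0 at *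
  generalize ((θ.sgn i : ℤ) : A) = ti at *
  generalize ((θ.sgn j : ℤ) : A) = tj at *
  generalize ((θ.sgn k : ℤ) : A) = tk at *
  generalize ((θ.sgn l : ℤ) : A) = tl at *
  generalize ((θ.sgn m : ℤ) : A) = tm at *
  generalize ((θ.sgn n : ℤ) : A) = tn at *
  generalize algebraMap ℂ A (u - v)⁻¹ = a at *
  generalize algebraMap ℂ A (v - w)⁻¹ = b at *
  generalize algebraMap ℂ A (w - u)⁻¹ = c at *
  generalize algebraMap ℂ A (u + v)⁻¹ = a' at *
  generalize algebraMap ℂ A (v + w)⁻¹ = b' at *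
  generalize algebraMap ℂ A (w + u)⁻¹ = c' at *
  clear h1 h2 h3 h4 h5 h6 h1' h2' h3' h4' h5' h6' e1 e2 e3
  grind

end Signs

/-! ### The polynomial attached to a matrix in companion form -/

section ColumnRecursion

variable {R : Type*} [Ring R] [Algebra ℂ R] (κ : ℕ → ℕ → ℂ) (A : ℕ → R)

/-- The coefficient of `u^(k-j)` in the polynomial `X_k(u)` determined by `X_0 = 1` and
`X_(k+1)(u) = u X_k(u) - ∑ t ≤ k, κ k t A_t X_(k-t)(u)`. -/
def colCoeff : ℕ → ℕ → R
  | 0, j => if j = 0 then 1 else 0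
  | k + 1, j => colCoeff k j
      - ∑ t : Fin (k + 1), if (t : ℕ) + 1 ≤ j then κ k t • (A t * colCoeff (k - t) (j - 1 - t)) else 0
  termination_by k => k

theorem colCoeff_zero_left (j : ℕ) : colCoeff κ A 0 j = if j = 0 then 1 else 0 := by
  rw [colCoeff]

theorem colCoeff_succ (k j : ℕ) : colCoeff κ A (k + 1) j = colCoeff κ A k j
      - ∑ t ∈ Finset.range (k + 1),
        if t + 1 ≤ j then κ k t • (A t * colCoeff κ A (k - t) (j - 1 - t)) else 0 := by
  rw [colCoeff, Finset.sum_range]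

theorem colCoeff_zero_right (k : ℕ) : colCoeff κ A k 0 = 1 := by
  induction k with
  | zero => simp [colCoeff_zero_left]
  | succ k ih => simp [colCoeff_succ, ih]

theorem colCoeff_eq_zero {k j : ℕ} (h : k < j) : colCoeff κ A k j = 0 := by
  induction k using Nat.strong_induction_on generalizing j with
  | _ k ih =>
    cases k with
    | zero => rw [colCoeff_zero_left, if_neg (by omega)]
    | succ k =>
      rw [colCoeff_succ, ih k (by omega) (by omega), Finset.sum_eq_zero, sub_zero]
      intro t ht
      have := Finset.mem_range.1 ht
      rw [if_pos (by omega), ih (k - t) (by omega) (by omega), mul_zero, smul_zero]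

theorem map_colCoeff {R' : Type*} [Ring R'] [Algebra ℂ R'] (f : R →ₐ[ℂ] R') (k j : ℕ) :
    f (colCoeff κ A k j) = colCoeff κ (fun t => f (A t)) k j := by
  induction k using Nat.strong_induction_on generalizing j with
  | _ k ih =>
    cases k with
    | zero => rw [colCoeff_zero_left, colCoeff_zero_left]; split_ifs <;> simp
    | succ k =>
      rw [colCoeff_succ, colCoeff_succ, map_sub, map_sum, ih k (by omega)]
      congr 1
      refine Finset.sum_congr rfl fun t _ => ?_
      split_ifs
      · rw [map_smul, map_mul, ih (k - t) (by omega)]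
      · exact map_zero f

variable {A} in
-- A factor `A_t` lowers the degree in `u` by `t + 1`, so it cannot contribute to a coefficient of
-- index at most `t`.
theorem colCoeff_congr {A' : ℕ → R} {j : ℕ} (h : ∀ t < j, A t = A' t) (k : ℕ) :
    colCoeff κ A k j = colCoeff κ A' k j := by
  induction k using Nat.strong_induction_on generalizing j with
  | _ k ih =>
    cases k with
    | zero => rw [colCoeff_zero_left, colCoeff_zero_left]
    | succ k =>
      rw [colCoeff_succ, colCoeff_succ, ih k (by omega) h]
      congr 1
      refine Finset.sum_congr rfl fun t _ => ?_
      split_ifs with ht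
      · rw [h t (by omega), ih (k - t) (by omega) fun s hs => h s (by omega)]
      · rfl

variable {A} in
/-- The coefficient with index `j + 1` depends on `A_j` in an affine way. -/
theorem colCoeff_sub {A' : ℕ → R} {j : ℕ} (h : ∀ t < j, A t = A' t) (k : ℕ) :
    colCoeff κ A k (j + 1) - colCoeff κ A' k (j + 1)
      = -(∑ i ∈ Finset.range k, if j ≤ i then κ i j else 0) • (A j - A' j) := by
  induction k with
  | zero => simp [colCoeff_zero_left]
  | succ k ih =>
    rw [colCoeff_succ, colCoeff_succ, Finset.sum_range_succ (fun i => if j ≤ i then κ i j else 0),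
      sub_sub_sub_comm, ih, ← Finset.sum_sub_distrib, neg_add, add_smul, sub_eq_add_neg]
    congr 1
    rw [neg_smul, neg_inj]
    -- Only the summand `t = j` feels the change of `A_j`: for `t < j` both `A_t` and the
    -- coefficient of index `j - t` agree. At `t = j` the accompanying coefficient has index `0` and
    -- equals `1`.
    have h1 : ∀ t ∈ Finset.range (k + 1), t ≠ j →
        ((if t + 1 ≤ j + 1 then κ k t • (A t * colCoeff κ A (k - t) (j + 1 - 1 - t)) else 0)
          - if t + 1 ≤ j + 1 then κ k t • (A' t * colCoeff κ A' (k - t) (j + 1 - 1 - t)) else 0)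
          = 0 := by
      intro t _ htj
      split_ifs with ht
      · rw [h t (by omega), colCoeff_congr κ (fun s hs => h s (by omega)) (k - t), sub_self]
      · rw [sub_self]
    by_cases hj : j ≤ k
    · rw [Finset.sum_eq_single j h1 fun hj' => absurd (Finset.mem_range.2 (by omega)) hj',
        if_pos le_rfl, if_pos le_rfl, if_pos hj, Nat.add_sub_cancel, Nat.sub_self,
        colCoeff_zero_right, colCoeff_zero_right, mul_one, mul_one, smul_sub]
    · rw [if_neg hj, zero_smul]
      refine Finset.sum_eq_zero fun t ht => h1 t ht ?_
      have := Finset.mem_range.1 ht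
      omega

/-- The passage from the blocks to the coefficients is triangular. Once the earlier blocks are
known, the coefficient of index `j + 1` is affine in `A_j`, with a slope that `hκ` keeps away from
zero. -/
theorem colCoeff_injective {p : ℕ}
    (hκ : ∀ j < p, (∑ i ∈ Finset.range p, if j ≤ i then κ i j else 0) ≠ 0) {A' : ℕ → R}
    (h : ∀ j < p, colCoeff κ A p (j + 1) = colCoeff κ A' p (j + 1)) {j : ℕ} (hj : j < p) :
    A j = A' j := by
  induction j using Nat.strong_induction_on with
  | _ j ih =>
    have h1 := colCoeff_sub κ (fun t ht => ih t ht (by omega)) p (j := j)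
    rw [h j hj, sub_self, eq_comm, smul_eq_zero_iff_right (neg_ne_zero.2 (hκ j hj)), sub_eq_zero]
      at h1
    exact h1

theorem colCoeff_surjective {p : ℕ}
    (hκ : ∀ j < p, (∑ i ∈ Finset.range p, if j ≤ i then κ i j else 0) ≠ 0) (S : ℕ → R) :
    ∃ A : ℕ → R, ∀ j < p, colCoeff κ A p (j + 1) = S j := by
  suffices h : ∀ n ≤ p, ∃ A : ℕ → R, ∀ j < n, colCoeff κ A p (j + 1) = S j from h p le_rfl
  intro n
  induction n with
  | zero => exact fun _ => ⟨0, fun j hj => absurd hj (by omega)⟩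
  | succ n ih =>
    intro hn
    obtain ⟨A, hA⟩ := ih (by omega)
    set q := ∑ i ∈ Finset.range p, if n ≤ i then κ i n else 0 with hq
    -- The slope in `A_n` of the coefficient of index `n + 1` is `-q`, so this correction moves that
    -- coefficient from its present value to `S n`.
    let A' := Function.update A n (A n - q⁻¹ • (S n - colCoeff κ A p (n + 1)))
    have h0 : ∀ t < n, A' t = A t := fun t ht => Function.update_of_ne (by omega) _ _
    refine ⟨A', fun j hj => ?_⟩
    rcases Nat.lt_succ_iff_lt_or_eq.1 hj with hj | rfl
    · rw [colCoeff_congr κ (fun t ht => h0 t (by omega)) p, hA j hj]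
    · have h1 := colCoeff_sub κ h0 p
      rw [← hq, show A' j = A j - q⁻¹ • (S j - colCoeff κ A p (j + 1)) from
        Function.update_self _ _ _, sub_sub_cancel_left, neg_smul_neg, smul_smul,
        mul_inv_cancel₀ (hκ j (by omega)), one_smul] at h1
      exact sub_left_injective h1

/-- The polynomial `X_k(u)`. -/
def colSeries (u : ℂ) (k : ℕ) : R := ∑ j ∈ Finset.range (k + 1), u ^ (k - j) • colCoeff κ A k j

theorem colSeries_zero (u : ℂ) : colSeries κ A u 0 = 1 := by
  simp [colSeries, colCoeff_zero_left]

theorem colSeries_succ (u : ℂ) (k : ℕ) :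
    colSeries κ A u (k + 1) = u • colSeries κ A u k
      - ∑ t ∈ Finset.range (k + 1), κ k t • (A t * colSeries κ A u (k - t)) := by
  unfold colSeries
  simp only [colCoeff_succ, smul_sub, Finset.sum_sub_distrib]
  congr 1
  · rw [Finset.sum_range_succ, colCoeff_eq_zero κ A k.lt_succ_self, smul_zero, add_zero,
      Finset.smul_sum]
    refine Finset.sum_congr rfl fun j hj => ?_
    have := Finset.mem_range.1 hj
    rw [smul_smul, ← pow_succ', show k + 1 - j = k - j + 1 by omega]
  · simp only [Finset.smul_sum]
    rw [Finset.sum_comm]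
    refine Finset.sum_congr rfl fun t ht => ?_
    have ht' := Finset.mem_range.1 ht
    rw [Finset.mul_sum, Finset.smul_sum]
    -- The terms with `j ≤ t` vanish, and the remaining ones are those of `X_(k-t)(u)` with the
    -- index shifted by `t + 1`.
    have : k + 1 + 1 = (t + 1) + (k - t + 1) := by omega
    rw [this, Finset.sum_range_add, Finset.sum_eq_zero, zero_add]
    · refine Finset.sum_congr rfl fun j _ => ?_
      rw [if_pos (by omega), show t + 1 + j - 1 - t = j by omega,
        show k + 1 - (t + 1 + j) = k - t - j by omega, mul_smul_comm, smul_comm]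
    · intro j hj
      have := Finset.mem_range.1 hj
      rw [if_neg (by omega), smul_zero]

end ColumnRecursion

/-! ### The weights of the principal `sl(2)` -/

/-- The coefficient of `E_{k+1,k+2}` in `e₊` (with `k` counted from `0`). -/
def stepWeight (p k : ℕ) : ℝ := ((k : ℝ) + 1) * ((p : ℝ) - (k + 1))

theorem stepWeight_pos {p k : ℕ} (h : k + 1 < p) : 0 < stepWeight p k := by
  have : ((k : ℝ) + 1) < p := by exact_mod_cast h
  exact mul_pos (by positivity) (by linarith)

/-- These products serve twice: they rescale the blocks of `X(u)` so that its recursion becomes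
monic, and they define the hermitian form for which `e₊` and `e₋` are adjoint to each other. For
both uses it matters that they are positive reals for `k < p`. -/
def weight (p k : ℕ) : ℝ := ∏ j ∈ Finset.range k, stepWeight p j

theorem weight_pos {p k : ℕ} (h : k < p) : 0 < weight p k :=
  Finset.prod_pos fun j hj => stepWeight_pos (by have := Finset.mem_range.1 hj; omega)

theorem weight_succ (p k : ℕ) : weight p (k + 1) = weight p k * stepWeight p k :=
  Finset.prod_range_succ _ _

/-- The ratios of weights that occur in the recursion for `X_k(u)`. -/
def weightRatio (p k t : ℕ) : ℂ := ((weight p k / weight p (k - t) : ℝ) : ℂ)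

/-- All terms are non-negative reals and the one with `i = j` is positive, so there is no
cancellation. This is the non-zero slope in the triangular system for the blocks. -/
theorem sum_weightRatio_ne_zero {p j : ℕ} (hj : j < p) :
    (∑ i ∈ Finset.range p, if j ≤ i then weightRatio p i j else 0) ≠ 0 := by
  have h1 : (∑ i ∈ Finset.range p, if j ≤ i then weightRatio p i j else 0)
      = ((∑ i ∈ Finset.range p, if j ≤ i then weight p i / weight p (i - j) else 0 : ℝ) : ℂ) := by
    rw [Complex.ofReal_sum]
    exact Finset.sum_congr rfl fun i _ => by split_ifs <;> simp [weightRatio]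
  rw [h1, Complex.ofReal_ne_zero]
  refine ne_of_gt (Finset.sum_pos' (fun i hi => ?_) ⟨j, Finset.mem_range.2 hj, ?_⟩)
  · have := Finset.mem_range.1 hi
    split_ifs
    · exact (div_pos (weight_pos this) (weight_pos (by omega))).le
    · exact le_rfl
  · rw [if_pos le_rfl]
    exact div_pos (weight_pos hj) (weight_pos (by omega))

/-! ### Matrices in companion form -/

section Companion

variable {N p : ℕ} {B : Type*} [CommRing B] [Algebra ℂ B]

/-- `1 ⊗ e₊`, with entries in `B`. -/
def matE (N p : ℕ) (B : Type*) [CommRing B] [Algebra ℂ B] :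
    Matrix (Fin N × Fin p) (Fin N × Fin p) B :=
  ((1 : Matrix (Fin N) (Fin N) ℂ) ⊗ₖ principalE p).map (algebraMap ℂ B)

/-- `1 ⊗ e₋`, with entries in `B`. -/
def matF (N p : ℕ) (B : Type*) [CommRing B] [Algebra ℂ B] :
    Matrix (Fin N × Fin p) (Fin N × Fin p) B :=
  ((1 : Matrix (Fin N) (Fin N) ℂ) ⊗ₖ principalF p).map (algebraMap ℂ B)

theorem principalE_apply (k l : Fin p) :
    principalE p k l = if (k : ℕ) + 1 = l then ((stepWeight p k : ℝ) : ℂ) else 0 := by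
  simp [principalE, stepWeight]

theorem matE_apply (x y : Fin N × Fin p) :
    matE N p B x y = if x.1 = y.1 ∧ (x.2 : ℕ) + 1 = y.2
      then algebraMap ℂ B (stepWeight p x.2 : ℝ) else 0 := by
  simp only [matE, Matrix.map_apply, Matrix.kroneckerMap_apply, Matrix.one_apply, principalE_apply]
  by_cases h : x.1 = y.1 <;> by_cases h' : (x.2 : ℕ) + 1 = y.2 <;> simp [h, h']

theorem matF_apply (x y : Fin N × Fin p) :
    matF N p B x y = if x.1 = y.1 ∧ (y.2 : ℕ) + 1 = x.2 then 1 else 0 := by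
  simp only [matF, Matrix.map_apply, Matrix.kroneckerMap_apply, Matrix.one_apply, principalF,
    Matrix.of_apply]
  by_cases h : x.1 = y.1 <;> by_cases h' : (y.2 : ℕ) + 1 = x.2 <;> simp [h, h']

theorem matF_mul_zero (K : Matrix (Fin N × Fin p) (Fin N × Fin p) B) (x y : Fin N × Fin p)
    (hx : (x.2 : ℕ) = 0) : (matF N p B * K) x y = 0 := by
  rw [Matrix.mul_apply]
  refine Finset.sum_eq_zero fun z _ => ?_
  rw [matF_apply, if_neg (by omega), zero_mul]

theorem matF_mul_succ (K : Matrix (Fin N × Fin p) (Fin N × Fin p) B) (a : Fin N) (k k' : Fin p)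
    (y : Fin N × Fin p) (hk : (k : ℕ) + 1 = k') : (matF N p B * K) (a, k') y = K (a, k) y := by
  rw [Matrix.mul_apply, Finset.sum_eq_single (a, k)]
  · simp [matF_apply, hk]
  · rintro ⟨b, l⟩ _ hz
    rw [matF_apply, if_neg, zero_mul]
    rintro ⟨h1, h2⟩
    refine hz (Prod.ext h1.symm (Fin.ext ?_))
    change (l : ℕ) + 1 = k' at h2
    change (l : ℕ) = k
    omega
  · simp

theorem mul_matF_last (K : Matrix (Fin N × Fin p) (Fin N × Fin p) B) (x y : Fin N × Fin p)
    (hy : (y.2 : ℕ) + 1 = p) : (K * matF N p B) x y = 0 := by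
  rw [Matrix.mul_apply]
  refine Finset.sum_eq_zero fun z _ => ?_
  have := z.2.isLt
  rw [matF_apply, if_neg (by omega), mul_zero]

theorem mul_matF_succ (K : Matrix (Fin N × Fin p) (Fin N × Fin p) B) (x : Fin N × Fin p)
    (b : Fin N) (l l' : Fin p) (hl : (l : ℕ) + 1 = l') :
    (K * matF N p B) x (b, l) = K x (b, l') := by
  rw [Matrix.mul_apply, Finset.sum_eq_single (b, l')]
  · simp [matF_apply, hl]
  · rintro ⟨a, k⟩ _ hz
    rw [matF_apply, if_neg, mul_zero]
    rintro ⟨h1, h2⟩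
    refine hz (Prod.ext h1 (Fin.ext ?_))
    change (l : ℕ) + 1 = k at h2
    change (k : ℕ) = l'
    omega
  · simp

/-- `∑ m, A_m ⊗ f^m`. -/
def toeplitz (p : ℕ) (A : ℕ → Matrix (Fin N) (Fin N) B) :
    Matrix (Fin N × Fin p) (Fin N × Fin p) B :=
  Matrix.of fun x y => if (y.2 : ℕ) ≤ x.2 then A ((x.2 : ℕ) - y.2) x.1 y.1 else 0

theorem matF_mul_toeplitz (A : ℕ → Matrix (Fin N) (Fin N) B) :
    matF N p B * toeplitz p A = toeplitz p A * matF N p B := by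
  ext ⟨a, k⟩ ⟨b, l⟩
  have hk := k.isLt
  have hl := l.isLt
  by_cases h0 : (k : ℕ) = 0
  · rw [matF_mul_zero _ _ _ h0]
    by_cases h1 : (l : ℕ) + 1 = p
    · rw [mul_matF_last _ _ _ h1]
    · rw [mul_matF_succ _ _ b l ⟨l + 1, by omega⟩ rfl]
      simp only [toeplitz, Matrix.of_apply]
      rw [if_neg (by omega)]
  · rw [matF_mul_succ _ a ⟨k - 1, by omega⟩ k _ (by simp; omega)]
    by_cases h1 : (l : ℕ) + 1 = p
    · rw [mul_matF_last _ _ _ h1]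
      simp only [toeplitz, Matrix.of_apply]
      rw [if_neg (by omega)]
    · rw [mul_matF_succ _ _ b l ⟨l + 1, by omega⟩ rfl]
      simp only [toeplitz, Matrix.of_apply]
      by_cases h2 : (l : ℕ) + 1 ≤ k
      · rw [if_pos (by omega), if_pos h2, show (k : ℕ) - 1 - l = k - (l + 1) by omega]
      · rw [if_neg (by omega), if_neg h2]

/-- The first block column of a matrix. -/
def blockCol (K : Matrix (Fin N × Fin p) (Fin N × Fin p) B) (m : ℕ) : Matrix (Fin N) (Fin N) B :=
  Matrix.of fun a b => if h : m < p then K (a, ⟨m, h⟩) (b, ⟨0, by omega⟩) else 0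

/-- Commutation with the block shift carries each column of blocks to the next one along the
diagonals, so the first block column determines everything. The induction is on the column. -/
theorem eq_toeplitz_of_commute {K : Matrix (Fin N × Fin p) (Fin N × Fin p) B}
    (h : matF N p B * K = K * matF N p B) : K = toeplitz p (blockCol K) := by
  have key : ∀ (n : ℕ) (a b : Fin N) (k l : Fin p), (l : ℕ) = n →
      K (a, k) (b, l) = toeplitz p (blockCol K) (a, k) (b, l) := by
    intro n
    induction n with
    | zero =>
      intro a b k l hl
      simp only [toeplitz, blockCol, Matrix.of_apply, hl, zero_le, if_true, Nat.sub_zero, k.isLt,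
        dif_pos]
      congr
      exact Fin.ext hl
    | succ n ih =>
      intro a b k l hl
      have hk := k.isLt
      have hl' := l.isLt
      have h1 := mul_matF_succ K (a, k) b ⟨n, by omega⟩ l hl.symm
      rw [← h1, ← h]
      by_cases h0 : (k : ℕ) = 0
      · rw [matF_mul_zero _ _ _ h0]
        simp only [toeplitz, Matrix.of_apply]
        rw [if_neg (by omega)]
      · rw [matF_mul_succ _ a ⟨k - 1, by omega⟩ k _ (by simp; omega), ih _ _ _ _ rfl]
        simp only [toeplitz, Matrix.of_apply]
        by_cases h2 : (l : ℕ) ≤ k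
        · rw [if_pos (by omega), if_pos h2, show (k : ℕ) - 1 - n = k - l by omega]
        · rw [if_neg (by omega), if_neg h2]
  ext ⟨a, k⟩ ⟨b, l⟩
  exact key _ a b k l rfl

/-- `e₊ + ∑ m, A_m ⊗ f^m`. -/
def companion (p : ℕ) (A : ℕ → Matrix (Fin N) (Fin N) B) :
    Matrix (Fin N × Fin p) (Fin N × Fin p) B :=
  matE N p B + toeplitz p A

/-- The first block column of `c (u - M)⁻¹ T(u)`-type solutions: the polynomial matrix `X(u)` with
`(u - M) X(u) = (0, …, 0, T(u))` and first block `1`. -/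
def colMatrix (p : ℕ) (A : ℕ → Matrix (Fin N) (Fin N) B) (u : ℂ) :
    Matrix (Fin N × Fin p) (Fin N) B :=
  Matrix.of fun x j => (((weight p x.2)⁻¹ : ℝ) : ℂ) • colSeries (weightRatio p) A u x.2 x.1 j

/-- The matrix `T(u)`, proportional to the inverse of the upper right block of `(u - M)⁻¹`. -/
def charMatrix (p : ℕ) (A : ℕ → Matrix (Fin N) (Fin N) B) (u : ℂ) : Matrix (Fin N) (Fin N) B :=
  (((weight p (p - 1))⁻¹ : ℝ) : ℂ) • colSeries (weightRatio p) A u p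

/-- The block column `(0, …, 0, T)`. -/
def lastCol (p : ℕ) (T : Matrix (Fin N) (Fin N) B) : Matrix (Fin N × Fin p) (Fin N) B :=
  Matrix.of fun x j => if (x.2 : ℕ) + 1 = p then T x.1 j else 0

/-- The block row `(T, 0, …, 0)`. -/
def firstRow (p : ℕ) (T : Matrix (Fin N) (Fin N) B) : Matrix (Fin N) (Fin N × Fin p) B :=
  Matrix.of fun i y => if (y.2 : ℕ) = 0 then T i y.1 else 0

theorem matE_mul_succ {m : Type*} (K : Matrix (Fin N × Fin p) m B) (a : Fin N) (k k' : Fin p)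
    (j : m) (hk : (k : ℕ) + 1 = k') :
    (matE N p B * K) (a, k) j = algebraMap ℂ B (stepWeight p k : ℝ) * K (a, k') j := by
  rw [Matrix.mul_apply, Finset.sum_eq_single (a, k')]
  · simp [matE_apply, hk]
  · rintro ⟨b, l⟩ _ hz
    rw [matE_apply, if_neg, zero_mul]
    rintro ⟨h1, h2⟩
    refine hz (Prod.ext h1.symm (Fin.ext ?_))
    change (k : ℕ) + 1 = l at h2
    change (l : ℕ) = k'
    omega
  · simp

theorem matE_mul_last {m : Type*} (K : Matrix (Fin N × Fin p) m B) (x : Fin N × Fin p)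
    (j : m) (hk : (x.2 : ℕ) + 1 = p) : (matE N p B * K) x j = 0 := by
  rw [Matrix.mul_apply]
  refine Finset.sum_eq_zero fun z _ => ?_
  have := z.2.isLt
  rw [matE_apply, if_neg (by omega), zero_mul]

theorem toeplitz_mul_colMatrix (A : ℕ → Matrix (Fin N) (Fin N) B) (u : ℂ) (a : Fin N) (k : Fin p)
    (j : Fin N) : (toeplitz p A * colMatrix p A u) (a, k) j
      = ((((weight p k)⁻¹ : ℝ) : ℂ) • ∑ t ∈ Finset.range ((k : ℕ) + 1),
        weightRatio p k t • (A t * colSeries (weightRatio p) A u (k - t))) a j := by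
  have hk := k.isLt
  have hw : ((weight p k : ℝ) : ℂ) ≠ 0 := Complex.ofReal_ne_zero.2 (weight_pos hk).ne'
  rw [Matrix.mul_apply, Fintype.sum_prod_type, Finset.sum_comm, Matrix.smul_apply,
    Matrix.sum_apply, Finset.smul_sum]
  have h1 : ∀ l : Fin p, ∑ b, toeplitz p A (a, k) (b, l) * colMatrix p A u (b, l) j
      = if (l : ℕ) ≤ k then ((((weight p l)⁻¹ : ℝ) : ℂ)
        • (A (k - l) * colSeries (weightRatio p) A u l)) a j else 0 := by
    intro l
    split_ifs with h
    · simp only [toeplitz, colMatrix, Matrix.of_apply, h, if_true, Matrix.smul_apply,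
        Matrix.mul_apply, Finset.smul_sum, mul_smul_comm]
    · refine Finset.sum_eq_zero fun b _ => ?_
      simp only [toeplitz, Matrix.of_apply]
      rw [if_neg h, zero_mul]
  simp only [h1]
  rw [Finset.sum_fin_eq_sum_range, ← Finset.sum_subset (Finset.range_mono (show (k : ℕ) + 1 ≤ p by omega))]
  · rw [← Finset.sum_range_reflect]
    refine Finset.sum_congr rfl fun t ht => ?_
    have ht' := Finset.mem_range.1 ht
    rw [dif_pos (by omega), if_pos (by simp)]
    simp only [Matrix.smul_apply, smul_smul]
    rw [show (k : ℕ) - (k + 1 - 1 - t) = t by omega, show (k : ℕ) + 1 - 1 - t = k - t by omega]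
    congr 1
    simp only [weightRatio, Complex.ofReal_div, Complex.ofReal_inv]
    field_simp
  · intro l _ hl
    split_ifs with h1 h2
    · exact absurd (Finset.mem_range.2 (Nat.lt_succ_of_le h2)) hl
    · rfl
    · rfl

/-- Block row `k` is the recursion for `X_(k+1)(u)` divided by `weight p k`; the entry of `e₊`
supplies the ratio to the next weight. In the last block row `e₊` has no entry, and what is left
over is `T(u)`. -/
theorem companion_mul_colMatrix (A : ℕ → Matrix (Fin N) (Fin N) B) (u : ℂ) :
    companion p A * colMatrix p A u = u • colMatrix p A u - lastCol p (charMatrix p A u) := by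
  ext ⟨a, k⟩ j
  have hk := k.isLt
  have hw : ((weight p k : ℝ) : ℂ) ≠ 0 := Complex.ofReal_ne_zero.2 (weight_pos hk).ne'
  have h1 := congrFun (congrFun (colSeries_succ (weightRatio p) A u k) a) j
  rw [companion, Matrix.add_mul, Matrix.add_apply, toeplitz_mul_colMatrix]
  rw [Matrix.sub_apply, Matrix.smul_apply] at h1
  rw [Matrix.smul_apply, Matrix.sub_apply, Matrix.smul_apply]
  simp only [lastCol, Matrix.of_apply]
  by_cases h : (k : ℕ) + 1 = p
  · rw [matE_mul_last _ _ _ h, if_pos h, charMatrix, Matrix.smul_apply]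
    have h2 : p - 1 = k := by omega
    have h3 : colSeries (weightRatio p) A u p = colSeries (weightRatio p) A u (k + 1) := by rw [h]
    rw [h2, h3, h1, colMatrix, Matrix.of_apply, smul_sub, smul_comm u]
    abel
  · rw [matE_mul_succ _ a k ⟨k + 1, by omega⟩ j rfl, if_neg h]
    simp only [colMatrix, Matrix.of_apply]
    have hs : ((stepWeight p k : ℝ) : ℂ) ≠ 0 :=
      Complex.ofReal_ne_zero.2 (stepWeight_pos (by omega)).ne'
    rw [h1, ← Algebra.smul_def, smul_smul, weight_succ]
    have : ((stepWeight p k : ℝ) : ℂ) * (((weight p k * stepWeight p k)⁻¹ : ℝ) : ℂ)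
        = (((weight p k)⁻¹ : ℝ) : ℂ) := by
      push_cast
      field_simp
    rw [this, smul_sub, smul_comm u]
    abel

theorem firstRow_mul_colMatrix (hp : 0 < p) (A : ℕ → Matrix (Fin N) (Fin N) B)
    (T : Matrix (Fin N) (Fin N) B) (u : ℂ) : firstRow p T * colMatrix p A u = T := by
  ext i j
  rw [Matrix.mul_apply, Fintype.sum_prod_type, Finset.sum_comm,
    Finset.sum_eq_single (⟨0, hp⟩ : Fin p)]
  · simp [firstRow, colMatrix, colSeries_zero, weight, Matrix.one_apply]
  · intro l _ hl
    refine Finset.sum_eq_zero fun b _ => ?_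
    simp only [firstRow, Matrix.of_apply]
    rw [if_neg (fun h => hl (Fin.ext h)), zero_mul]
  · simp

end Companion

/-! ### Folding of companion matrices and of their column solutions -/

namespace Signs

variable {N p : ℕ} (θ : Signs N) {B : Type*} [CommRing B] [Algebra ℂ B]

/-- `M' = τ(M)`, for matrices with entries in a commutative algebra. -/
def IsFoldOf (M' M : Matrix (Fin N × Fin p) (Fin N × Fin p) B) : Prop :=
  ∀ x y, M' x y = -((-1) ^ ((x.2 : ℕ) + y.2) * ((θ.sgn x.1 : ℤ) : B) * ((θ.sgn y.1 : ℤ) : B))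
    * M (y.1.rev, y.2.rev) (x.1.rev, x.2.rev)

/-- Invariance under `τ`. -/
def IsFolded (M : Matrix (Fin N × Fin p) (Fin N × Fin p) B) : Prop :=
  θ.IsFoldOf M M

/-- The row analogue `Y(u)` of `X(u)`, obtained by folding. -/
def rowMatrix (p : ℕ) (A : ℕ → Matrix (Fin N) (Fin N) B) (u : ℂ) :
    Matrix (Fin N) (Fin N × Fin p) B :=
  Matrix.of fun i y => (-1) ^ (p + 1 + y.2) * ((θ.sgn i : ℤ) : B) * ((θ.sgn y.1 : ℤ) : B)
    * colMatrix p A (-u) (y.1.rev, y.2.rev) i.rev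

/-- The image of `T(u)` under the folding. -/
def foldedChar (p : ℕ) (A : ℕ → Matrix (Fin N) (Fin N) B) (u : ℂ) : Matrix (Fin N) (Fin N) B :=
  Matrix.of fun i j => (-1) ^ p * ((θ.sgn i : ℤ) : B) * ((θ.sgn j : ℤ) : B)
    * charMatrix p A (-u) j.rev i.rev

/-- The folding reverses products, so it turns the column identity for `A` at `-u` into a row
identity at `u` for the folded matrix. Last and first blocks are exchanged. -/
theorem rowMatrix_mul_companion {A A' : ℕ → Matrix (Fin N) (Fin N) B}
    (hA : θ.IsFoldOf (companion p A') (companion p A)) (u : ℂ) :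
    θ.rowMatrix p A u * companion p A'
      = u • θ.rowMatrix p A u - firstRow p (θ.foldedChar p A u) := by
  ext i ⟨b, l⟩
  have h1 := congrFun (congrFun (companion_mul_colMatrix (p := p) A (-u)) (b.rev, l.rev)) i.rev
  have h2 : (θ.rowMatrix p A u * companion p A') i (b, l)
      = (-1) ^ (p + l) * ((θ.sgn i : ℤ) : B) * ((θ.sgn b : ℤ) : B)
        * (companion p A * colMatrix p A (-u)) (b.rev, l.rev) i.rev := by
    rw [Matrix.mul_apply, Matrix.mul_apply, Finset.mul_sum]
    refine Fintype.sum_equiv ((Fin.revPerm).prodCongr (Fin.revPerm)) _ _ fun x => ?_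
    obtain ⟨a, k⟩ := x
    rw [hA (a, k) (b, l)]
    simp only [rowMatrix, Matrix.of_apply, Equiv.prodCongr_apply, Prod.map, Fin.revPerm_apply]
    have ha := sgn_sq (A := B) (θ.sgn a)
    have hk : ((-1 : B) ^ (k : ℕ)) * (-1) ^ (k : ℕ) = 1 := by rw [← mul_pow]; simp
    simp only [pow_add, pow_one]
    generalize companion p A (b.rev, l.rev) (a.rev, k.rev) = q
    generalize colMatrix p A (-u) (a.rev, k.rev) i.rev = q'
    generalize ((θ.sgn a : ℤ) : B) = ta at *
    generalize ((-1 : B) ^ (k : ℕ)) = sk at *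
    clear h1 hA
    linear_combination (-1 : B) ^ p * ((θ.sgn i : ℤ) : B) * ((θ.sgn b : ℤ) : B) * (-1) ^ (l : ℕ) * q * q' * sk * sk * ha + (-1 : B) ^ p * ((θ.sgn i : ℤ) : B) * ((θ.sgn b : ℤ) : B) * (-1) ^ (l : ℕ) * q * q' * hk
  rw [h2, h1]
  have hl := l.isLt
  simp only [Matrix.sub_apply, Matrix.smul_apply, lastCol, firstRow, Matrix.of_apply, rowMatrix,
    foldedChar, neg_smul, Matrix.neg_apply, Fin.val_rev]
  by_cases h : (l : ℕ) = 0
  · rw [if_pos h, if_pos (by omega), h, Algebra.smul_def, Algebra.smul_def]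
    simp only [pow_add, pow_one, pow_zero]
    ring
  · rw [if_neg h, if_neg (by omega), Algebra.smul_def, Algebra.smul_def]
    simp only [pow_add, pow_one]
    ring

theorem rowMatrix_mul_lastCol (hp : 0 < p) (A : ℕ → Matrix (Fin N) (Fin N) B) (u : ℂ)
    (T : Matrix (Fin N) (Fin N) B) : θ.rowMatrix p A u * lastCol p T = T := by
  ext i j
  rw [Matrix.mul_apply, Fintype.sum_prod_type, Finset.sum_comm,
    Finset.sum_eq_single (⟨p - 1, by omega⟩ : Fin p)]
  · have h1 : (⟨p - 1, by omega⟩ : Fin p).rev = ⟨0, hp⟩ := by ext; simp [Fin.val_rev]; omega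
    have h2 : (-1 : B) ^ (p + 1 + (p - 1)) = 1 := Even.neg_one_pow ⟨p, by omega⟩
    simp only [rowMatrix, lastCol, colMatrix, Matrix.of_apply, h1, h2, colSeries_zero, weight,
      Finset.range_zero, Finset.prod_empty, inv_one, Complex.ofReal_one, one_smul, one_mul,
      Matrix.one_apply, Fin.rev_inj, show p - 1 + 1 = p by omega, if_true]
    rw [Finset.sum_eq_single i]
    · rw [if_pos rfl, mul_one, sgn_sq, one_mul]
    · intro b _ hb
      rw [if_neg hb]; ring
    · simp
  · intro l _ hl
    refine Finset.sum_eq_zero fun b _ => ?_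
    simp only [lastCol, Matrix.of_apply]
    rw [if_neg (fun h => hl (Fin.ext (by simp; omega))), mul_zero]
  · simp

/-- Evaluate `Y(u) M' X'(u)` in two ways. The row identity leaves the folded `T(u)` and the column
identity leaves the `T(u)` of `M'`, because the relevant extreme blocks of `X'` and `Y` are `1`. -/
theorem foldedChar_eq (hp : 0 < p) {A A' : ℕ → Matrix (Fin N) (Fin N) B}
    (hA : θ.IsFoldOf (companion p A') (companion p A)) (u : ℂ) :
    θ.foldedChar p A u = charMatrix p A' u := by
  have h1 := congrArg (· * colMatrix p A' u) (θ.rowMatrix_mul_companion hA u)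
  simp only [Matrix.mul_assoc, companion_mul_colMatrix, Matrix.mul_sub, Matrix.sub_mul,
    rowMatrix_mul_lastCol θ hp, firstRow_mul_colMatrix hp, Matrix.mul_smul, Matrix.smul_mul] at h1
  exact (sub_right_injective h1).symm

theorem rowMatrix_mul_companion' (hp : 0 < p) {A : ℕ → Matrix (Fin N) (Fin N) B}
    (hA : θ.IsFolded (companion p A)) (u : ℂ) :
    θ.rowMatrix p A u * companion p A
      = u • θ.rowMatrix p A u - firstRow p (charMatrix p A u) := by
  rw [rowMatrix_mul_companion θ hA, foldedChar_eq θ hp hA]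

/-- The same double evaluation, now of `Y(u) M X(v)` with different parameters. These divided
differences are the source of the denominators in the `r`-matrices. -/
theorem rowMatrix_mul_colMatrix (hp : 0 < p) {A : ℕ → Matrix (Fin N) (Fin N) B}
    (hA : θ.IsFolded (companion p A)) (u v : ℂ) :
    (u - v) • (θ.rowMatrix p A u * colMatrix p A v) = charMatrix p A u - charMatrix p A v := by
  have h1 := congrArg (· * colMatrix p A v) (θ.rowMatrix_mul_companion' hp hA u)
  simp only [Matrix.mul_assoc, companion_mul_colMatrix, Matrix.mul_sub, Matrix.sub_mul,
    rowMatrix_mul_lastCol θ hp, firstRow_mul_colMatrix hp, Matrix.mul_smul, Matrix.smul_mul] at h1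
  rw [sub_smul, ← sub_eq_zero]
  rw [← sub_eq_zero] at h1
  rw [← neg_eq_zero, ← h1]
  abel

end Signs

/-! ### The principal `sl(2)` in `gl(Np)` -/

section PrincipalTriple

variable {N p : ℕ}

/-- The adjoint with respect to the hermitian form with weights `weight p k`; it exchanges `e₊`
and `e₋`. -/
def weightedAdjoint (a : Matrix (Fin N × Fin p) (Fin N × Fin p) ℂ) :
    Matrix (Fin N × Fin p) (Fin N × Fin p) ℂ :=
  Matrix.of fun x y => star (a y x) * ((weight p y.2 / weight p x.2 : ℝ) : ℂ)

theorem weightedAdjoint_mul (a b : Matrix (Fin N × Fin p) (Fin N × Fin p) ℂ) :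
    weightedAdjoint (a * b) = weightedAdjoint b * weightedAdjoint a := by
  ext x y
  simp only [weightedAdjoint, Matrix.mul_apply, Matrix.of_apply, star_sum, Finset.sum_mul,
    star_mul']
  refine Finset.sum_congr rfl fun z _ => ?_
  have hz := (weight_pos z.2.isLt).ne'
  have hx := (weight_pos x.2.isLt).ne'
  have h : (weight p y.2 / weight p x.2 : ℝ)
      = weight p z.2 / weight p x.2 * (weight p y.2 / weight p z.2) := by field_simp
  rw [h]
  push_cast
  ring

theorem weightedAdjoint_matF : weightedAdjoint (matF N p ℂ) = matE N p ℂ := by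
  ext x y
  have hx := (weight_pos x.2.isLt).ne'
  rw [weightedAdjoint, Matrix.of_apply, matF_apply, matE_apply]
  by_cases h : x.1 = y.1 ∧ (x.2 : ℕ) + 1 = y.2
  · rw [if_pos ⟨h.1.symm, h.2⟩, if_pos h, ← h.2, weight_succ]
    simp [hx]
  · rw [if_neg (fun h' => h ⟨h'.1.symm, h'.2⟩), if_neg h]
    simp

theorem weightedAdjoint_matE : weightedAdjoint (matE N p ℂ) = matF N p ℂ := by
  ext x y
  have hy := y.2.isLt
  have hx := x.2.isLt
  rw [weightedAdjoint, Matrix.of_apply, matF_apply, matE_apply]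
  by_cases h : x.1 = y.1 ∧ (y.2 : ℕ) + 1 = x.2
  · have hw := (weight_pos hy).ne'
    have hs := (stepWeight_pos (p := p) (k := y.2) (by omega)).ne'
    rw [if_pos ⟨h.1.symm, h.2⟩, if_pos h, ← h.2, weight_succ]
    rw [Algebra.algebraMap_self_apply, RCLike.star_def, Complex.conj_ofReal,
      ← Complex.ofReal_mul, ← Complex.ofReal_one]
    congr 1
    field_simp
  · rw [if_neg (fun h' => h ⟨h'.1.symm, h'.2⟩), if_neg h]
    simp

/-- The trace is a sum of squared moduli of the entries of `a` with positive weights. -/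
theorem eq_zero_of_trace_weightedAdjoint {a : Matrix (Fin N × Fin p) (Fin N × Fin p) ℂ}
    (h : (a * weightedAdjoint a).trace = 0) : a = 0 := by
  have h1 : (a * weightedAdjoint a).trace
      = ((∑ x, ∑ y, Complex.normSq (a x y) * (weight p x.2 / weight p y.2) : ℝ) : ℂ) := by
    simp only [Matrix.trace, Matrix.diag_apply, Matrix.mul_apply, weightedAdjoint, Matrix.of_apply,
      Complex.ofReal_sum]
    refine Finset.sum_congr rfl fun x _ => Finset.sum_congr rfl fun y _ => ?_
    rw [Complex.ofReal_mul, ← Complex.mul_conj, RCLike.star_def, mul_assoc]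
  rw [h1, Complex.ofReal_eq_zero] at h
  have hpos : ∀ x y : Fin N × Fin p, 0 < weight p x.2 / weight p y.2 := fun x y =>
    div_pos (weight_pos x.2.isLt) (weight_pos y.2.isLt)
  have hnn : ∀ x y, 0 ≤ Complex.normSq (a x y) * (weight p x.2 / weight p y.2) := fun x y =>
    mul_nonneg (Complex.normSq_nonneg _) (hpos x y).le
  rw [Finset.sum_eq_zero_iff_of_nonneg fun x _ => Finset.sum_nonneg fun y _ => hnn x y] at h
  ext x y
  have h2 := h x (Finset.mem_univ x)
  rw [Finset.sum_eq_zero_iff_of_nonneg fun y _ => hnn x y] at h2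
  have h3 := h2 y (Finset.mem_univ y)
  rw [mul_eq_zero, or_iff_left (hpos x y).ne', Complex.normSq_eq_zero] at h3
  exact h3

/-- The adjoint of `a` commutes with the adjoint `f` of `e`, hence is orthogonal under the trace to
`[f, y] = a`. Positivity then forces `a = 0`. -/
theorem eq_zero_of_lie {a y e f : Matrix (Fin N × Fin p) (Fin N × Fin p) ℂ}
    (hef : weightedAdjoint e = f) (ha : a = f * y - y * f) (hea : e * a = a * e) : a = 0 := by
  refine eq_zero_of_trace_weightedAdjoint ?_
  have h1 : f * weightedAdjoint a = weightedAdjoint a * f := by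
    rw [← hef, ← weightedAdjoint_mul, ← weightedAdjoint_mul, hea]
  generalize weightedAdjoint a = w at *
  rw [ha]
  rw [Matrix.sub_mul, Matrix.trace_sub, Matrix.mul_assoc, Matrix.trace_mul_comm f, Matrix.mul_assoc,
    Matrix.mul_assoc, h1, sub_self]

/-- `im (ad e₋) ∩ ker (ad e₊) = 0`. -/
theorem eq_zero_of_lie_matF {a y : Matrix (Fin N × Fin p) (Fin N × Fin p) ℂ}
    (ha : a = matF N p ℂ * y - y * matF N p ℂ) (hea : matE N p ℂ * a = a * matE N p ℂ) : a = 0 :=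
  eq_zero_of_lie weightedAdjoint_matE ha hea

/-- `im (ad e₊) ∩ ker (ad e₋) = 0`. -/
theorem eq_zero_of_lie_matE {a y : Matrix (Fin N × Fin p) (Fin N × Fin p) ℂ}
    (ha : a = matE N p ℂ * y - y * matE N p ℂ) (hea : matF N p ℂ * a = a * matF N p ℂ) : a = 0 :=
  eq_zero_of_lie weightedAdjoint_matF ha hea

/-! ### The grading of `gl(Np)` -/

/-- The component of degree `d`: block entries `(k, k + d)`. -/
def gradeComp (d : ℤ) (a : Matrix (Fin N × Fin p) (Fin N × Fin p) ℂ) :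
    Matrix (Fin N × Fin p) (Fin N × Fin p) ℂ :=
  Matrix.of fun x y => if ((y.2 : ℕ) : ℤ) - (x.2 : ℕ) = d then a x y else 0

theorem gradeComp_sub (d : ℤ) (a b : Matrix (Fin N × Fin p) (Fin N × Fin p) ℂ) :
    gradeComp d (a - b) = gradeComp d a - gradeComp d b := by
  ext x y
  simp only [gradeComp, Matrix.of_apply, Matrix.sub_apply]
  split_ifs <;> simp

theorem gradeComp_add (d : ℤ) (a b : Matrix (Fin N × Fin p) (Fin N × Fin p) ℂ) :
    gradeComp d (a + b) = gradeComp d a + gradeComp d b := by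
  ext x y
  simp only [gradeComp, Matrix.of_apply, Matrix.add_apply]
  split_ifs <;> simp

theorem gradeComp_mul_left {s : ℤ} {h : Matrix (Fin N × Fin p) (Fin N × Fin p) ℂ}
    (hs : ∀ x y, ((y.2 : ℕ) : ℤ) - (x.2 : ℕ) ≠ s → h x y = 0) (d : ℤ)
    (a : Matrix (Fin N × Fin p) (Fin N × Fin p) ℂ) :
    gradeComp (d + s) (h * a) = h * gradeComp d a := by
  ext x y
  simp only [gradeComp, Matrix.of_apply, Matrix.mul_apply]
  by_cases h1 : ((y.2 : ℕ) : ℤ) - (x.2 : ℕ) = d + s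
  all_goals
    simp only [h1, if_true, if_false]
    rw [eq_comm]
    first | refine Finset.sum_congr rfl fun z _ => ?_ | refine Finset.sum_eq_zero fun z _ => ?_
    by_cases hz : ((z.2 : ℕ) : ℤ) - (x.2 : ℕ) = s
    · split_ifs <;> first | rfl | omega | simp
    · simp [hs x z hz]

theorem gradeComp_mul_right {s : ℤ} {h : Matrix (Fin N × Fin p) (Fin N × Fin p) ℂ}
    (hs : ∀ x y, ((y.2 : ℕ) : ℤ) - (x.2 : ℕ) ≠ s → h x y = 0) (d : ℤ)
    (a : Matrix (Fin N × Fin p) (Fin N × Fin p) ℂ) :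
    gradeComp (d + s) (a * h) = gradeComp d a * h := by
  ext x y
  simp only [gradeComp, Matrix.of_apply, Matrix.mul_apply]
  by_cases h1 : ((y.2 : ℕ) : ℤ) - (x.2 : ℕ) = d + s
  all_goals
    simp only [h1, if_true, if_false]
    rw [eq_comm]
    first | refine Finset.sum_congr rfl fun z _ => ?_ | refine Finset.sum_eq_zero fun z _ => ?_
    by_cases hz : ((y.2 : ℕ) : ℤ) - (z.2 : ℕ) = s
    · split_ifs <;> first | rfl | omega | simp
    · simp [hs z y hz]

theorem gradeComp_eq_zero_of_le (d : ℤ) (hd : (p : ℤ) ≤ d)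
    (a : Matrix (Fin N × Fin p) (Fin N × Fin p) ℂ) : gradeComp d a = 0 := by
  ext x y
  have := y.2.isLt
  rw [gradeComp, Matrix.of_apply, if_neg (by omega), Matrix.zero_apply]

theorem matE_grade (x y : Fin N × Fin p) (h : ((y.2 : ℕ) : ℤ) - (x.2 : ℕ) ≠ 1) :
    matE N p ℂ x y = 0 := by
  rw [matE_apply, if_neg (by omega)]

theorem matF_grade (x y : Fin N × Fin p) (h : ((y.2 : ℕ) : ℤ) - (x.2 : ℕ) ≠ -1) :
    matF N p ℂ x y = 0 := by
  rw [matF_apply, if_neg (by omega)]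

/-- The components of top degree of `[a, e₊ + K]`, for `K` of degree at most `0`. -/
theorem gradeComp_lie_of_top {a K : Matrix (Fin N × Fin p) (Fin N × Fin p) ℂ}
    (hK : ∀ x y : Fin N × Fin p, (x.2 : ℕ) < y.2 → K x y = 0) {d : ℤ}
    (ha : ∀ d' > d, gradeComp d' a = 0) :
    gradeComp (d + 1) (a * (matE N p ℂ + K) - (matE N p ℂ + K) * a)
      = gradeComp d a * matE N p ℂ - matE N p ℂ * gradeComp d a := by
  have ha' : ∀ x y : Fin N × Fin p, d < ((y.2 : ℕ) : ℤ) - (x.2 : ℕ) → a x y = 0 := by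
    intro x y h
    have := congrFun (congrFun (ha _ h) x) y
    simpa [gradeComp] using this
  have h1 : gradeComp (d + 1) (a * K) = 0 := by
    ext x y
    simp only [gradeComp, Matrix.of_apply, Matrix.mul_apply, Matrix.zero_apply]
    split_ifs with h
    · refine Finset.sum_eq_zero fun z _ => ?_
      by_cases hz : (z.2 : ℕ) < y.2
      · rw [hK z y hz, mul_zero]
      · rw [ha' x z (by omega), zero_mul]
    · rfl
  have h2 : gradeComp (d + 1) (K * a) = 0 := by
    ext x y
    simp only [gradeComp, Matrix.of_apply, Matrix.mul_apply, Matrix.zero_apply]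
    split_ifs with h
    · refine Finset.sum_eq_zero fun z _ => ?_
      by_cases hz : (x.2 : ℕ) < z.2
      · rw [hK x z hz, zero_mul]
      · rw [ha' z y (by omega), mul_zero]
    · rfl
  rw [gradeComp_sub, Matrix.mul_add, Matrix.add_mul, gradeComp_add, gradeComp_add, h1, h2,
    gradeComp_mul_left matE_grade, gradeComp_mul_right matE_grade, add_zero, add_zero]

/-- Let `a ∈ im (ad e₋)`, and let `K` have degree at most `0`. If the components of degree greater
than `d₀` of `[a, e₊ + K]` commute with `e₋`, then `a` has degree less than `d₀`. -/
theorem gradeComp_eq_zero_of_lie {a y K : Matrix (Fin N × Fin p) (Fin N × Fin p) ℂ}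
    (hK : ∀ x y : Fin N × Fin p, (x.2 : ℕ) < y.2 → K x y = 0)
    (ha : a = matF N p ℂ * y - y * matF N p ℂ) {d₀ : ℤ}
    (h : ∀ d ≥ d₀, Commute (matF N p ℂ)
      (gradeComp (d + 1) (a * (matE N p ℂ + K) - (matE N p ℂ + K) * a)))
    {d : ℤ} (hd : d₀ ≤ d) : gradeComp d a = 0 := by
  -- Descending induction on the degree, starting at degrees `≥ p`, where every component vanishes.
  suffices H : ∀ (n : ℕ) (d : ℤ), d₀ ≤ d → (p : ℤ) ≤ d + n → gradeComp d a = 0 from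
    H (p - d).toNat d hd (by omega)
  intro n
  induction n with
  | zero => exact fun d _ hd' => gradeComp_eq_zero_of_le d (by simpa using hd') a
  | succ n ih =>
    intro d hd hdn
    have htop : ∀ d' > d, gradeComp d' a = 0 := fun d' hd' =>
      ih d' (by omega) (by push_cast at hdn; omega)
    have h1 := h d hd
    rw [gradeComp_lie_of_top hK htop] at h1
    -- The top component of the commutator is `[a_d, e₊]`. It lies in `im (ad e₊)` and commutes with
    -- `e₋`, so it is zero; then `a_d` lies in `im (ad e₋) ∩ ker (ad e₊)`.
    have h2 : matE N p ℂ * gradeComp d a - gradeComp d a * matE N p ℂ = 0 := by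
      refine eq_zero_of_lie_matE rfl ?_
      have h3 := h1.eq
      rw [← neg_sub (gradeComp d a * _), Matrix.mul_neg, Matrix.neg_mul, h3]
    refine eq_zero_of_lie_matF (y := gradeComp (d + 1) y) ?_ (sub_eq_zero.1 h2)
    conv_lhs => rw [ha, show d = (d + 1) + -1 by ring]
    rw [gradeComp_sub, gradeComp_mul_left matF_grade, gradeComp_mul_right matF_grade]

end PrincipalTriple

/-! ### The trace form of `gl(Np)^τ` -/

namespace Signs

variable {N p : ℕ} (θ : Signs N)

theorem mem_foldedGl {M : Matrix (Fin N × Fin p) (Fin N × Fin p) ℂ} :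
    M ∈ θ.foldedGl p ↔ θ.IsFolded M := by
  change θ.tau p M = M ↔ _
  rw [← Matrix.ext_iff]
  exact forall₂_congr fun x y => eq_comm

theorem tau_tau (M : Matrix (Fin N × Fin p) (Fin N × Fin p) ℂ) : θ.tau p (θ.tau p M) = M := by
  ext ⟨a, k⟩ ⟨b, l⟩
  simp only [tau, Matrix.of_apply, Fin.rev_rev, sgn_rev, Fin.val_rev]
  have h0 := sgn_sq (A := ℂ) θ.sgn₀
  have ha := sgn_sq (A := ℂ) (θ.sgn a)
  have hb := sgn_sq (A := ℂ) (θ.sgn b)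
  have hs : (-1 : ℂ) ^ ((k : ℕ) + l) * (-1) ^ (p - ((l : ℕ) + 1) + (p - (k + 1))) = 1 := by
    have hk := k.isLt
    have hl := l.isLt
    rw [← pow_add]
    exact Even.neg_one_pow ⟨p - 1, by omega⟩
  generalize ((θ.sgn₀ : ℤ) : ℂ) = t0 at *
  generalize ((θ.sgn a : ℤ) : ℂ) = ta at *
  generalize ((θ.sgn b : ℤ) : ℂ) = tb at *
  generalize (-1 : ℂ) ^ ((k : ℕ) + l) = s at *
  generalize (-1 : ℂ) ^ (p - ((l : ℕ) + 1) + (p - (k + 1))) = s' at *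
  linear_combination M (a, k) (b, l) * (s * s' * t0 * t0 * ta * ta * hb + s * s' * t0 * t0 * ha
    + s * s' * h0 + hs)

theorem trace_tau (M : Matrix (Fin N × Fin p) (Fin N × Fin p) ℂ) :
    (θ.tau p M).trace = -M.trace := by
  simp only [Matrix.trace, Matrix.diag_apply, ← Finset.sum_neg_distrib]
  refine Fintype.sum_equiv ((Fin.revPerm).prodCongr (Fin.revPerm)) _ _ fun x => ?_
  have h1 := sgn_sq (A := ℂ) (θ.sgn x.1)
  have h2 : (-1 : ℂ) ^ ((x.2 : ℕ) + x.2) = 1 := Even.neg_one_pow ⟨_, rfl⟩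
  simp only [tau, Matrix.of_apply, h2, one_mul, h1, neg_mul]
  rfl

theorem tau_add (M M' : Matrix (Fin N × Fin p) (Fin N × Fin p) ℂ) :
    θ.tau p (M + M') = θ.tau p M + θ.tau p M' := by
  ext x y
  simp [tau]
  ring

theorem trace_tau_mul_tau (M M' : Matrix (Fin N × Fin p) (Fin N × Fin p) ℂ) :
    (θ.tau p M * θ.tau p M').trace = (M * M').trace := by
  rw [← neg_neg (M * M').trace, ← trace_tau, tau_mul, Matrix.trace_neg, neg_neg,
    Matrix.trace_mul_comm]

theorem tau_eq {M : Matrix (Fin N × Fin p) (Fin N × Fin p) ℂ} (h : M ∈ θ.foldedGl p) :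
    θ.tau p M = M := h

theorem add_tau_mem (M : Matrix (Fin N × Fin p) (Fin N × Fin p) ℂ) :
    M + θ.tau p M ∈ θ.foldedGl p := by
  change θ.tau p _ = _
  rw [tau_add, tau_tau, add_comm]

/-- The trace pairing with an element of `gl(Np)^τ`. -/
theorem trace_mul_add_tau {c : Matrix (Fin N × Fin p) (Fin N × Fin p) ℂ} (hc : c ∈ θ.foldedGl p)
    (M : Matrix (Fin N × Fin p) (Fin N × Fin p) ℂ) :
    (c * (M + θ.tau p M)).trace = 2 * (c * M).trace := by
  have h := θ.trace_tau_mul_tau c M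
  rw [θ.tau_eq hc] at h
  rw [Matrix.mul_add, Matrix.trace_add, h, two_mul]

/-- For every matrix `M`, the τ-fixed matrix `M + τ(M)` has pairing `2 tr (c M)` with `c`, so the
non-degeneracy of the trace on all of `gl(Np)` is inherited. -/
theorem eq_zero_of_trace {c : Matrix (Fin N × Fin p) (Fin N × Fin p) ℂ} (hc : c ∈ θ.foldedGl p)
    (h : ∀ x ∈ θ.foldedGl p, (c * x).trace = 0) : c = 0 := by
  refine Matrix.ext_iff_trace_mul_right.2 fun M => ?_
  have h1 := h _ (θ.add_tau_mem M)
  rw [θ.trace_mul_add_tau hc] at h1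
  simpa using h1

/-- The trace form. -/
def traceForm (p : ℕ) : LinearMap.BilinForm ℂ (θ.foldedGl p) :=
  LinearMap.mk₂ ℂ (fun x y => ((x : Matrix (Fin N × Fin p) (Fin N × Fin p) ℂ)
      * (y : Matrix (Fin N × Fin p) (Fin N × Fin p) ℂ)).trace)
    (fun x y z => by simp [add_mul]) (fun c x y => by simp)
    (fun x y z => by simp [mul_add]) (fun c x y => by simp)

theorem traceForm_nondegenerate (p : ℕ) : (θ.traceForm p).Nondegenerate := by
  constructor
  · intro x hx
    exact Subtype.ext (θ.eq_zero_of_trace x.2 fun y hy => hx ⟨y, hy⟩)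
  · intro x hx
    exact Subtype.ext (θ.eq_zero_of_trace x.2 fun y hy => by
      rw [Matrix.trace_mul_comm]; exact hx ⟨y, hy⟩)

end Signs

/-! ### Highest weight bases of `gl(Np)^τ` -/

/-- Both `ker E`, `im F` and `ker F`, `im E` are disjoint, so each pair has total dimension at most
`dim V`. By rank–nullity the four dimensions add up to `2 dim V`, so both bounds are attained. -/
theorem isCompl_ker_range {V : Type*} [AddCommGroup V] [Module ℂ V] [FiniteDimensional ℂ V]
    (E F : V →ₗ[ℂ] V) (hEF : ∀ y, E (F y) = 0 → F y = 0) (hFE : ∀ y, F (E y) = 0 → E y = 0) :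
    IsCompl (LinearMap.ker E) (LinearMap.range F) := by
  have h1 : Disjoint (LinearMap.ker E) (LinearMap.range F) := by
    rw [Submodule.disjoint_def]
    rintro _ hx ⟨y, rfl⟩
    exact hEF y hx
  have h2 : Disjoint (LinearMap.ker F) (LinearMap.range E) := by
    rw [Submodule.disjoint_def]
    rintro _ hx ⟨y, rfl⟩
    exact hFE y hx
  refine ⟨h1, codisjoint_iff.2 (Submodule.eq_top_of_finrank_eq ?_)⟩
  have e1 := Submodule.finrank_sup_add_finrank_inf_eq (LinearMap.ker E) (LinearMap.range F)
  have e2 := Submodule.finrank_sup_add_finrank_inf_eq (LinearMap.ker F) (LinearMap.range E)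
  have e3 := LinearMap.finrank_range_add_finrank_ker E
  have e4 := LinearMap.finrank_range_add_finrank_ker F
  have e5 := Submodule.finrank_le (LinearMap.ker F ⊔ LinearMap.range E)
  have e6 := Submodule.finrank_le (LinearMap.ker E ⊔ LinearMap.range F)
  rw [h1.eq_bot, finrank_bot] at e1
  rw [h2.eq_bot, finrank_bot] at e2
  omega

theorem nonempty_highestWeightBasis {ι : Type} [Fintype ι] [DecidableEq ι]
    {L : LieSubalgebra ℂ (Matrix ι ι ℂ)} {e f : L} (hef : ∀ y : L, ⁅e, ⁅f, y⁆⁆ = 0 → ⁅f, y⁆ = 0)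
    (hfe : ∀ y : L, ⁅f, ⁅e, y⁆⁆ = 0 → ⁅e, y⁆ = 0) : Nonempty (HighestWeightBasis e f) := by
  have hc := isCompl_ker_range (LieAlgebra.ad ℂ L e : L →ₗ[ℂ] L) (LieAlgebra.ad ℂ L f : L →ₗ[ℂ] L)
    hef hfe
  let b₁ := Module.finBasis ℂ (LinearMap.ker (LieAlgebra.ad ℂ L e : L →ₗ[ℂ] L))
  let b₂ := Module.finBasis ℂ (LinearMap.range (LieAlgebra.ad ℂ L f : L →ₗ[ℂ] L))
  refine ⟨⟨_, _, (b₁.prod b₂).map (Submodule.prodEquivOfIsCompl _ _ hc), fun i => ?_, fun j => ?_⟩⟩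
  · have h : ⁅e, (b₁ i : L)⁆ = 0 := (b₁ i).2
    rw [Module.Basis.map_apply, Module.Basis.prod_apply]
    simpa using h
  · obtain ⟨y, hy⟩ := (b₂ j).2
    refine ⟨y, ?_⟩
    rw [Module.Basis.map_apply, Module.Basis.prod_apply]
    simpa using hy.symm

namespace Signs

variable {N p : ℕ} (θ : Signs N)

theorem coe_foldedE : (θ.foldedE p : Matrix (Fin N × Fin p) (Fin N × Fin p) ℂ) = matE N p ℂ := by
  ext x y
  simp [foldedE, matE]

theorem coe_foldedF : (θ.foldedF p : Matrix (Fin N × Fin p) (Fin N × Fin p) ℂ) = matF N p ℂ := by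
  ext x y
  simp [foldedF, matF]

theorem coe_lie (x y : θ.foldedGl p) :
    ((⁅x, y⁆ : θ.foldedGl p) : Matrix (Fin N × Fin p) (Fin N × Fin p) ℂ)
      = (x : Matrix (Fin N × Fin p) (Fin N × Fin p) ℂ)
          * (y : Matrix (Fin N × Fin p) (Fin N × Fin p) ℂ)
        - (y : Matrix (Fin N × Fin p) (Fin N × Fin p) ℂ)
          * (x : Matrix (Fin N × Fin p) (Fin N × Fin p) ℂ) := rfl

theorem lie_foldedF_eq_zero (y : θ.foldedGl p) (h : ⁅θ.foldedE p, ⁅θ.foldedF p, y⁆⁆ = 0) :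
    ⁅θ.foldedF p, y⁆ = 0 := by
  refine Subtype.ext (eq_zero_of_lie_matF (y := y) ?_ ?_)
  · rw [coe_lie, coe_foldedF]
  · have := congrArg Subtype.val h
    rw [coe_lie, coe_foldedE] at this
    exact sub_eq_zero.1 this

theorem lie_foldedE_eq_zero (y : θ.foldedGl p) (h : ⁅θ.foldedF p, ⁅θ.foldedE p, y⁆⁆ = 0) :
    ⁅θ.foldedE p, y⁆ = 0 := by
  refine Subtype.ext (eq_zero_of_lie_matE (y := y) ?_ ?_)
  · rw [coe_lie, coe_foldedE]
  · have := congrArg Subtype.val h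
    rw [coe_lie, coe_foldedF] at this
    exact sub_eq_zero.1 this

theorem nonempty_highestWeightBasis (p : ℕ) :
    Nonempty (HighestWeightBasis (θ.foldedE p) (θ.foldedF p)) :=
  FoldedW.nonempty_highestWeightBasis θ.lie_foldedF_eq_zero θ.lie_foldedE_eq_zero

section IsFolded

variable {B : Type*} [CommRing B] [Algebra ℂ B]

omit [Algebra ℂ B] in
variable {θ} in
theorem IsFolded.add {M M' : Matrix (Fin N × Fin p) (Fin N × Fin p) B} (h : θ.IsFolded M)
    (h' : θ.IsFolded M') : θ.IsFolded (M + M') := by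
  intro x y
  rw [Matrix.add_apply, Matrix.add_apply, h x y, h' x y]
  ring

omit [Algebra ℂ B] in
variable {θ} in
theorem IsFolded.smul {M : Matrix (Fin N × Fin p) (Fin N × Fin p) B} (h : θ.IsFolded M)
    (z : B) : θ.IsFolded (z • M) := by
  intro x y
  rw [Matrix.smul_apply, Matrix.smul_apply, h x y, smul_eq_mul, smul_eq_mul]
  ring

omit [Algebra ℂ B] in
variable {θ} in
theorem IsFolded.sub {M M' : Matrix (Fin N × Fin p) (Fin N × Fin p) B} (h : θ.IsFolded M)
    (h' : θ.IsFolded M') : θ.IsFolded (M - M') := by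
  rw [sub_eq_add_neg, ← neg_one_smul B M']
  exact h.add (h'.smul _)

omit [Algebra ℂ B] in
variable {θ} in
theorem IsFolded.sum {ι : Type*} (s : Finset ι) {M : ι → Matrix (Fin N × Fin p) (Fin N × Fin p) B}
    (h : ∀ i, θ.IsFolded (M i)) : θ.IsFolded (∑ i ∈ s, M i) := by
  classical
  induction s using Finset.induction_on with
  | empty => intro x y; simp
  | insert i s hi ih => rw [Finset.sum_insert hi]; exact (h i).add ih

theorem isFolded_map {M : Matrix (Fin N × Fin p) (Fin N × Fin p) ℂ} (h : M ∈ θ.foldedGl p) :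
    θ.IsFolded (M.map (algebraMap ℂ B)) := by
  intro x y
  rw [Matrix.map_apply, θ.mem_foldedGl.1 h x y]
  simp

theorem isFolded_matE : θ.IsFolded (matE N p B) :=
  θ.isFolded_map (θ.foldedE p).2

end IsFolded

end Signs

/-! ### Dual bases for the trace form -/

namespace HighestWeightBasis

variable {N p : ℕ} {θ : Signs N} (b : HighestWeightBasis (θ.foldedE p) (θ.foldedF p))

/-- The matrix of an element of the basis. -/
def mat (z : Fin b.r ⊕ Fin b.s) : Matrix (Fin N × Fin p) (Fin N × Fin p) ℂ := b.basis z

theorem mat_mem (z : Fin b.r ⊕ Fin b.s) : b.mat z ∈ θ.foldedGl p := (b.basis z).2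

/-- The lower vectors are only required to lie in `im (ad e₋)`; this shows that they span it. The
highest weight part of `[e₋, y]` is again in `im (ad e₋)`, and it commutes with `e₊`, so it
vanishes. -/
theorem exists_eq_sum_lower (y : θ.foldedGl p) : ∃ c : Fin b.s → ℂ,
    ⁅θ.foldedF p, y⁆ = ∑ α, c α • b.basis (.inr α) := by
  choose g hg using b.lower
  obtain ⟨c, hc⟩ : ∃ c, c = b.basis.repr ⁅θ.foldedF p, y⁆ := ⟨_, rfl⟩
  have h1 : ∑ i, c (.inl i) • b.basis (.inl i) + ∑ α, c (.inr α) • b.basis (.inr α)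
      = ⁅θ.foldedF p, y⁆ := by
    rw [← Fintype.sum_sum_type fun z => c z • b.basis z, hc, b.basis.sum_repr]
  have h2 : ∑ i, c (.inl i) • b.basis (.inl i)
      = ⁅θ.foldedF p, y - ∑ α, c (.inr α) • g α⁆ := by
    rw [lie_sub, lie_sum, ← h1, eq_sub_iff_add_eq]
    simp only [lie_smul, ← hg]
  have h3 : ⁅θ.foldedE p, ∑ i, c (.inl i) • b.basis (.inl i)⁆ = 0 := by
    rw [lie_sum]
    exact Finset.sum_eq_zero fun i _ => by rw [lie_smul, b.highest, smul_zero]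
  have h4 : ∑ i, c (.inl i) • b.basis (.inl i) = 0 := by
    rw [h2] at h3 ⊢
    exact θ.lie_foldedF_eq_zero _ h3
  exact ⟨fun α => c (.inr α), by rw [← h1, h4, zero_add]⟩

theorem exists_mat_lower (α : Fin b.s) : ∃ y,
    b.mat (.inr α) = matF N p ℂ * y - y * matF N p ℂ := by
  obtain ⟨y, hy⟩ := b.lower α
  refine ⟨y, ?_⟩
  rw [mat, hy, Signs.coe_lie, Signs.coe_foldedF]

/-- The dual basis with respect to the trace form. -/
def dual (z : Fin b.r ⊕ Fin b.s) : Matrix (Fin N × Fin p) (Fin N × Fin p) ℂ :=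
  ((θ.traceForm p).dualBasis (θ.traceForm_nondegenerate p) b.basis z : θ.foldedGl p)

theorem dual_mem (z : Fin b.r ⊕ Fin b.s) : b.dual z ∈ θ.foldedGl p :=
  ((θ.traceForm p).dualBasis (θ.traceForm_nondegenerate p) b.basis z).2

theorem trace_dual_mul_mat (z z' : Fin b.r ⊕ Fin b.s) :
    (b.dual z * b.mat z').trace = if z' = z then 1 else 0 :=
  LinearMap.BilinForm.apply_dualBasis_left (θ.traceForm_nondegenerate p) b.basis z z'

/-- An element of `gl(Np)^τ` that is orthogonal to the lower part of the basis commutes with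
`e₋`. -/
theorem commute_matF_of_trace {c : Matrix (Fin N × Fin p) (Fin N × Fin p) ℂ}
    (hc : c ∈ θ.foldedGl p) (h : ∀ α, (c * b.mat (.inr α)).trace = 0) :
    matF N p ℂ * c = c * matF N p ℂ := by
  rw [← sub_eq_zero]
  refine θ.eq_zero_of_trace (c := matF N p ℂ * c - c * matF N p ℂ) ?_ fun y hy => ?_
  · have := (⁅θ.foldedF p, (⟨c, hc⟩ : θ.foldedGl p)⁆ : θ.foldedGl p).2
    rwa [Signs.coe_lie, Signs.coe_foldedF] at this
  · obtain ⟨g, hg⟩ := b.exists_eq_sum_lower ⟨y, hy⟩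
    have h1 := congrArg (fun q : θ.foldedGl p =>
      (c * (q : Matrix (Fin N × Fin p) (Fin N × Fin p) ℂ)).trace) hg
    have h2 : (c * ((∑ α, g α • b.basis (.inr α) : θ.foldedGl p)
        : Matrix (Fin N × Fin p) (Fin N × Fin p) ℂ)).trace = 0 := by
      rw [AddSubmonoidClass.coe_finsetSum, Finset.mul_sum, Matrix.trace_sum]
      refine Finset.sum_eq_zero fun α _ => ?_
      have := h α
      rw [mat] at this
      simp [this]
    simp only [h2] at h1
    rw [Signs.coe_lie, Signs.coe_foldedF, Matrix.mul_sub, Matrix.trace_sub] at h1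
    rw [Matrix.sub_mul, Matrix.trace_sub, Matrix.mul_assoc, Matrix.trace_mul_comm (matF N p ℂ),
      Matrix.mul_assoc, Matrix.mul_assoc]
    linear_combination -h1

theorem trace_mul_mat_lower {c : Matrix (Fin N × Fin p) (Fin N × Fin p) ℂ}
    (hc : matF N p ℂ * c = c * matF N p ℂ) (α : Fin b.s) : (c * b.mat (.inr α)).trace = 0 := by
  obtain ⟨y, hy⟩ := b.exists_mat_lower α
  rw [hy, Matrix.mul_sub, Matrix.trace_sub, ← Matrix.mul_assoc, ← hc, Matrix.mul_assoc,
    Matrix.trace_mul_comm, Matrix.mul_assoc, sub_self]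

theorem matF_mul_dual (i : Fin b.r) :
    matF N p ℂ * b.dual (.inl i) = b.dual (.inl i) * matF N p ℂ :=
  b.commute_matF_of_trace (b.dual_mem _) fun α => by simp [trace_dual_mul_mat]

theorem eq_zero_of_trace_mat {c : Matrix (Fin N × Fin p) (Fin N × Fin p) ℂ}
    (hc : c ∈ θ.foldedGl p) (h : ∀ z, (c * b.mat z).trace = 0) : c = 0 := by
  refine θ.eq_zero_of_trace hc fun x hx => ?_
  have h1 : (⟨x, hx⟩ : θ.foldedGl p) = ∑ z, b.basis.repr ⟨x, hx⟩ z • b.basis z :=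
    (b.basis.sum_repr _).symm
  have h2 := congrArg Subtype.val h1
  rw [AddSubmonoidClass.coe_finsetSum] at h2
  change x = _ at h2
  rw [h2, Finset.mul_sum, Matrix.trace_sum]
  refine Finset.sum_eq_zero fun z _ => ?_
  have := h z
  rw [mat] at this
  simp [this]

/-! ### Points of the Slodowy slice over a commutative algebra -/

section SlicePoint

variable {B : Type*} [CommRing B] [Algebra ℂ B]

/-- The point of the Slodowy slice `e₊ + ker (ad e₋)` with coordinates `w` (with values in a
commutative algebra). -/
def slicePoint (w : Fin b.r → B) : Matrix (Fin N × Fin p) (Fin N × Fin p) B :=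
  matE N p B + ∑ i, (w i - algebraMap ℂ B (matE N p ℂ * b.mat (.inl i)).trace)
    • (b.dual (.inl i)).map (algebraMap ℂ B)

theorem map_slicePoint {B' : Type*} [CommRing B'] [Algebra ℂ B'] (φ : B →ₐ[ℂ] B')
    (w : Fin b.r → B) : (b.slicePoint w).map φ = b.slicePoint fun i => φ (w i) := by
  ext x y
  simp [slicePoint, Matrix.sum_apply, matE]

theorem isFolded_slicePoint (w : Fin b.r → B) : θ.IsFolded (b.slicePoint w) :=
  θ.isFolded_matE.add (Signs.IsFolded.sum _ fun _ => (θ.isFolded_map (b.dual_mem _)).smul _)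

theorem matF_mul_slicePoint_sub (w : Fin b.r → B) :
    matF N p B * (b.slicePoint w - matE N p B) = (b.slicePoint w - matE N p B) * matF N p B := by
  rw [slicePoint, add_sub_cancel_left, Finset.mul_sum, Finset.sum_mul]
  refine Finset.sum_congr rfl fun i _ => ?_
  have h : ∀ c : Matrix (Fin N × Fin p) (Fin N × Fin p) ℂ,
      matF N p B * c.map (algebraMap ℂ B) = (matF N p ℂ * c).map (algebraMap ℂ B) := fun c => by
    rw [Matrix.map_mul]; rfl
  have h' : ∀ c : Matrix (Fin N × Fin p) (Fin N × Fin p) ℂ,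
      c.map (algebraMap ℂ B) * matF N p B = (c * matF N p ℂ).map (algebraMap ℂ B) := fun c => by
    rw [Matrix.map_mul]; rfl
  rw [Matrix.mul_smul, Matrix.smul_mul, h, h', matF_mul_dual]

/-- The matrices `A_m` of a point of the slice. -/
def sliceCoeff (w : Fin b.r → B) : ℕ → Matrix (Fin N) (Fin N) B :=
  blockCol (b.slicePoint w - matE N p B)

theorem slicePoint_eq_companion (w : Fin b.r → B) :
    b.slicePoint w = companion p (b.sliceCoeff w) := by
  rw [companion, sliceCoeff, ← eq_toeplitz_of_commute (b.matF_mul_slicePoint_sub w),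
    add_sub_cancel]

theorem map_sliceCoeff {B' : Type*} [CommRing B'] [Algebra ℂ B'] (φ : B →ₐ[ℂ] B')
    (w : Fin b.r → B) (m : ℕ) :
    (b.sliceCoeff w m).map φ = b.sliceCoeff (fun i => φ (w i)) m := by
  rw [sliceCoeff, sliceCoeff, ← map_slicePoint]
  ext i j
  simp only [blockCol, Matrix.map_apply, Matrix.of_apply]
  split_ifs <;> simp [matE]

/-- The numbers `tr (e₊ W_i)` are subtracted in `slicePoint` precisely so that the coordinates are
the values of the generators. -/
theorem trace_slicePoint_mul_inl (w : Fin b.r → B) (j : Fin b.r) :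
    (b.slicePoint w * (b.mat (.inl j)).map (algebraMap ℂ B)).trace = w j := by
  have h : ∀ c d : Matrix (Fin N × Fin p) (Fin N × Fin p) ℂ,
      (c.map (algebraMap ℂ B) * d.map (algebraMap ℂ B)).trace
        = algebraMap ℂ B (c * d).trace := fun c d => by
    rw [← Matrix.map_mul, Matrix.trace, Matrix.trace, map_sum]
    rfl
  rw [slicePoint, Matrix.add_mul, Matrix.trace_add, Finset.sum_mul, Matrix.trace_sum]
  simp only [Matrix.smul_mul, Matrix.trace_smul, h, trace_dual_mul_mat, Sum.inl.injEq, smul_eq_mul]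
  rw [Finset.sum_eq_single j (fun i _ hi => by rw [if_neg (Ne.symm hi), map_zero, mul_zero])
    (by simp), if_pos rfl, map_one, mul_one]
  have h2 : (matE N p B * (b.mat (.inl j)).map (algebraMap ℂ B)).trace
      = algebraMap ℂ B (matE N p ℂ * b.mat (.inl j)).trace := by
    rw [← h]
    rfl
  rw [h2]
  ring

/-- The difference of the point and `e₊` commutes with `e₋`, so it is orthogonal to `im (ad e₋)` and
only `e₊` contributes. Thus the points of the slice satisfy the constraints. -/
theorem trace_slicePoint_mul_inr (w : Fin b.r → ℂ) (α : Fin b.s) :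
    (b.slicePoint w * b.mat (.inr α)).trace = b.value α := by
  have h := b.trace_mul_mat_lower (b.matF_mul_slicePoint_sub w) α
  rw [Matrix.sub_mul, Matrix.trace_sub, sub_eq_zero] at h
  rw [h, value, Signs.coe_foldedE]
  rfl

/-- A matrix of the form `∑ m, A_m ⊗ f^m` that is invariant under the folding is determined by its
pairing with the highest weight vectors. -/
theorem eq_zero_of_trace_inl {K : Matrix (Fin N × Fin p) (Fin N × Fin p) B} (hK : θ.IsFolded K)
    (hf : matF N p B * K = K * matF N p B)
    (h : ∀ i, (K * (b.mat (.inl i)).map (algebraMap ℂ B)).trace = 0) : K = 0 := by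
  -- Linear functionals separate the points of `B`, and each of them reduces the claim to matrices
  -- with complex entries, where the dual basis argument applies.
  suffices H : ∀ φ : Module.Dual ℂ B, K.map φ = 0 by
    ext x y
    rw [Matrix.zero_apply, ← Module.forall_dual_apply_eq_zero_iff ℂ]
    exact fun φ => congrFun (congrFun (H φ) x) y
  intro φ
  have hl : ∀ (z : ℂ) (a : B), φ (algebraMap ℂ B z * a) = z * φ a := fun z a => by
    rw [← Algebra.smul_def, map_smul, smul_eq_mul]
  have hr : ∀ (z : ℂ) (a : B), φ (a * algebraMap ℂ B z) = φ a * z := fun z a => by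
    rw [mul_comm, hl, mul_comm]
  have hfK : matF N p ℂ * K.map φ = K.map φ * matF N p ℂ := by
    ext x y
    have := congrArg φ (congrFun (congrFun hf x) y)
    have hF : ∀ x y, matF N p B x y = algebraMap ℂ B (matF N p ℂ x y) := fun _ _ => rfl
    simpa [Matrix.mul_apply, map_sum, hF, hl, hr] using this
  refine b.eq_zero_of_trace_mat (θ.mem_foldedGl.2 fun x y => ?_) fun z => ?_
  · rw [Matrix.map_apply, hK x y]
    have : -((-1) ^ ((x.2 : ℕ) + y.2) * ((θ.sgn x.1 : ℤ) : B) * ((θ.sgn y.1 : ℤ) : B))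
        = algebraMap ℂ B (-((-1) ^ ((x.2 : ℕ) + y.2) * ((θ.sgn x.1 : ℤ) : ℂ)
          * ((θ.sgn y.1 : ℤ) : ℂ))) := by simp
    rw [this, hl, Matrix.map_apply]
  · rcases z with i | α
    · have := congrArg φ (h i)
      simpa [Matrix.trace, Matrix.mul_apply, map_sum, hr] using this
    · exact b.trace_mul_mat_lower hfK α

end SlicePoint

end HighestWeightBasis

/-! ### Evaluation of the Dirac bracket -/

section Rename

variable {σ τ : Type*} [Fintype σ]

theorem IsBiderivation.rename_left {br : MvPolynomial (σ ⊕ τ) ℂ → MvPolynomial (σ ⊕ τ) ℂ →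
    MvPolynomial (σ ⊕ τ) ℂ} (h : IsBiderivation br) (F : MvPolynomial σ ℂ)
    (g : MvPolynomial (σ ⊕ τ) ℂ) :
    br (rename .inl F) g = ∑ i, rename .inl (pderiv i F) * br (X (.inl i)) g := by
  classical
  induction F using MvPolynomial.induction_on with
  | C z =>
    have := h.algebraMap_left z g
    rw [MvPolynomial.algebraMap_eq] at this
    simp [this]
  | add p q hp hq => simp only [map_add, h.add_left, hp, hq, add_mul, Finset.sum_add_distrib]
  | mul_X p x hp =>
    have hi : ∀ i, rename (Sum.inl : σ → σ ⊕ τ) (pderiv i (p * X x))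
        = (if i = x then rename .inl p else 0) + X (.inl x) * rename .inl (pderiv i p) := by
      intro i
      rw [Derivation.leibniz, map_add, smul_eq_mul, smul_eq_mul, map_mul, map_mul, rename_X,
        pderiv_X]
      by_cases hix : i = x
      · subst hix
        rw [if_pos rfl, Pi.single_eq_same, map_one, mul_one]
      · rw [if_neg hix, Pi.single_eq_of_ne' hix, map_zero, mul_zero]
    rw [map_mul, h.mul_left, hp, rename_X]
    have h1 : ∑ i, (if i = x then rename Sum.inl p else 0) * br (X (Sum.inl i)) g
        = rename Sum.inl p * br (X (Sum.inl x)) g := by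
      rw [Finset.sum_eq_single x, if_pos rfl]
      · intro i _ hix
        rw [if_neg hix, zero_mul]
      · exact fun hx => absurd (Finset.mem_univ x) hx
    have h2 : ∀ i, rename (Sum.inl : σ → σ ⊕ τ) (pderiv i (p * X x)) * br (X (Sum.inl i)) g
        = (if i = x then rename Sum.inl p else 0) * br (X (Sum.inl i)) g
          + rename Sum.inl (pderiv i p) * br (X (Sum.inl i)) g * X (Sum.inl x) := fun i => by
      rw [hi]; ring
    have h3 : ∑ i, rename (Sum.inl : σ → σ ⊕ τ) (pderiv i p) * br (X (Sum.inl i)) g * X (Sum.inl x)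
        = (∑ i, rename (Sum.inl : σ → σ ⊕ τ) (pderiv i p) * br (X (Sum.inl i)) g)
          * X (Sum.inl x) := (Finset.sum_mul _ _ _).symm
    rw [Finset.sum_congr rfl fun i _ => h2 i, Finset.sum_add_distrib, h1, h3]

theorem IsBiderivation.rename_right {br : MvPolynomial (σ ⊕ τ) ℂ → MvPolynomial (σ ⊕ τ) ℂ →
    MvPolynomial (σ ⊕ τ) ℂ} (h : IsBiderivation br) (F : MvPolynomial σ ℂ)
    (g : MvPolynomial (σ ⊕ τ) ℂ) :
    br g (rename .inl F) = ∑ i, rename .inl (pderiv i F) * br g (X (.inl i)) :=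
  h.swap.rename_left F g

end Rename

/-- By the Nullstellensatz a non-unit lies in the vanishing ideal of some point. -/
theorem isUnit_of_eval_ne_zero {σ : Type*} [Finite σ] {f : MvPolynomial σ ℂ}
    (h : ∀ w, eval w f ≠ 0) : IsUnit f := by
  by_contra hf
  obtain ⟨I, hI, hfI⟩ := exists_max_ideal_of_mem_nonunits hf
  obtain ⟨x, rfl⟩ := MvPolynomial.isMaximal_iff_eq_vanishingIdeal_singleton.1 hI
  rw [MvPolynomial.mem_vanishingIdeal_singleton_iff, MvPolynomial.aeval_eq_eval] at hfI
  exact h x hfI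

/-- The bilinear form `tr (M [x, y])`. -/
def kirillovForm {ι : Type*} [Fintype ι] (M : Matrix ι ι ℂ) :
    LinearMap.BilinForm ℂ (Matrix ι ι ℂ) :=
  LinearMap.mk₂ ℂ (fun x y => (M * (x * y - y * x)).trace)
    (fun x y z => by simp only [add_mul, mul_add, mul_sub, Matrix.trace_sub, Matrix.trace_add]; ring)
    (fun c x y => by
      simp only [Matrix.smul_mul, Matrix.mul_smul, ← smul_sub, Matrix.trace_smul])
    (fun x y z => by simp only [add_mul, mul_add, mul_sub, Matrix.trace_sub, Matrix.trace_add]; ring)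
    (fun c x y => by
      simp only [Matrix.smul_mul, Matrix.mul_smul, ← smul_sub, Matrix.trace_smul])

theorem kirillovForm_apply {ι : Type*} [Fintype ι] (M x y : Matrix ι ι ℂ) :
    kirillovForm M x y = (M * (x * y - y * x)).trace := rfl

theorem kirillovForm_eq_left {ι : Type*} [Fintype ι] (M x y : Matrix ι ι ℂ) :
    kirillovForm M x y = -((x * M - M * x) * y).trace := by
  have h1 : (M * (y * x)).trace = (x * M * y).trace := by
    rw [← Matrix.mul_assoc, Matrix.trace_mul_comm, Matrix.mul_assoc]
  rw [kirillovForm_apply, Matrix.mul_sub, Matrix.sub_mul, Matrix.trace_sub, Matrix.trace_sub, h1,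
    ← Matrix.mul_assoc, neg_sub]

theorem kirillovForm_eq_right {ι : Type*} [Fintype ι] (M x y : Matrix ι ι ℂ) :
    kirillovForm M x y = (x * (y * M - M * y)).trace := by
  rw [kirillovForm_apply, Matrix.mul_sub, Matrix.mul_sub, Matrix.trace_sub, Matrix.trace_sub,
    Matrix.trace_mul_comm M, Matrix.trace_mul_comm M, Matrix.mul_assoc, Matrix.mul_assoc,
    Matrix.trace_mul_comm y, Matrix.mul_assoc]

namespace HighestWeightBasis

/-! ### The Dirac bracket as a skew biderivation -/

section General

variable {ι : Type} [Fintype ι] [DecidableEq ι] {L : LieSubalgebra ℂ (Matrix ι ι ℂ)} {e f : L}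
  (b : HighestWeightBasis e f)

theorem liePoisson_isBiderivation : IsBiderivation b.liePoisson :=
  polyBracket_isBiderivation _

theorem liePoisson_skew (F G : MvPolynomial (Fin b.r ⊕ Fin b.s) ℂ) :
    b.liePoisson F G = -b.liePoisson G F := by
  refine b.liePoisson_isBiderivation.map_eq_of_adjoin b.liePoisson_isBiderivation.swap.neg
    (AlgHom.id ℂ _) (MvPolynomial.adjoin_range_X) (MvPolynomial.adjoin_range_X) ?_ F G
  rintro _ ⟨x, rfl⟩ _ ⟨y, rfl⟩
  simp only [liePoisson, AlgHom.coe_id, id, polyBracket_X_X]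
  rw [← Finset.sum_neg_distrib]
  refine Finset.sum_congr rfl fun z _ => ?_
  have h : b.basis.repr ⁅b.basis x, b.basis y⁆ z = -b.basis.repr ⁅b.basis y, b.basis x⁆ z := by
    rw [← lie_skew, map_neg, Finsupp.neg_apply]
  rw [h, C_neg, neg_mul]

theorem onConstraints_rename (F : b.WAlgebra) : b.onConstraints (rename .inl F) = F := by
  rw [onConstraints, aeval_rename]
  simp

theorem liePoisson_constraint_right (F : MvPolynomial (Fin b.r ⊕ Fin b.s) ℂ) (α : Fin b.s) :
    b.liePoisson F (b.constraint α) = b.liePoisson F (X (.inr α)) := by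
  rw [constraint, b.liePoisson_isBiderivation.sub_right, ← MvPolynomial.algebraMap_eq,
    b.liePoisson_isBiderivation.algebraMap_right, sub_zero]

theorem liePoisson_constraint_left (F : MvPolynomial (Fin b.r ⊕ Fin b.s) ℂ) (α : Fin b.s) :
    b.liePoisson (b.constraint α) F = b.liePoisson (X (.inr α)) F := by
  rw [constraint, b.liePoisson_isBiderivation.sub_left, ← MvPolynomial.algebraMap_eq,
    b.liePoisson_isBiderivation.algebraMap_left, sub_zero]

/-- The bracket of two generators, on the constraint surface. -/
def structureFn (z z' : Fin b.r ⊕ Fin b.s) : b.WAlgebra :=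
  b.onConstraints (b.liePoisson (X z) (X z'))

theorem structureFn_skew (z z' : Fin b.r ⊕ Fin b.s) :
    b.structureFn z z' = -b.structureFn z' z := by
  rw [structureFn, liePoisson_skew, map_neg]; rfl

theorem constraintMatrix_apply (α β : Fin b.s) :
    b.constraintMatrix α β = b.structureFn (.inr α) (.inr β) := by
  rw [constraintMatrix, Matrix.of_apply, liePoisson_constraint_left, liePoisson_constraint_right]
  rfl

/-- The chain rule reduces the bracket to its values on generators, restricted to the constraint
surface. From this form both the Leibniz rule and the pointwise evaluation are read off. -/
theorem diracBracket_eq (F G : b.WAlgebra) : b.diracBracket F G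
    = ∑ i, ∑ j, pderiv i F * pderiv j G * b.structureFn (.inl i) (.inl j)
      - ∑ α, ∑ β, (∑ i, pderiv i F * b.structureFn (.inl i) (.inr α)) * b.constraintMatrix⁻¹ α β
        * ∑ j, pderiv j G * b.structureFn (.inr β) (.inl j) := by
  have h := b.liePoisson_isBiderivation
  unfold diracBracket
  simp only [liePoisson_constraint_left, liePoisson_constraint_right, h.rename_left,
    h.rename_right, map_sum, map_mul, onConstraints_rename, Finset.mul_sum]
  simp only [mul_assoc]
  rfl

theorem constraintMatrix_inv_skew (α β : Fin b.s) :
    b.constraintMatrix⁻¹ α β = -b.constraintMatrix⁻¹ β α := by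
  have h1 : b.constraintMatrix.transpose = -b.constraintMatrix := by
    ext α β : 2
    rw [Matrix.transpose_apply, Matrix.neg_apply, constraintMatrix_apply, constraintMatrix_apply,
      structureFn_skew]
  have h2 : (-b.constraintMatrix)⁻¹ = -b.constraintMatrix⁻¹ := by
    -- When the determinant is not a unit the inverse is `0` by convention, so skew-symmetry holds
    -- in that case too.
    by_cases hu : IsUnit b.constraintMatrix.det
    · refine Matrix.inv_eq_right_inv ?_
      rw [neg_mul_neg, Matrix.mul_nonsing_inv _ hu]
    · rw [Matrix.nonsing_inv_apply_not_isUnit _ hu, Matrix.nonsing_inv_apply_not_isUnit, neg_zero]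
      rw [Matrix.det_neg]
      intro hu'
      exact hu (isUnit_of_mul_isUnit_right hu')
  have h3 := Matrix.transpose_nonsing_inv b.constraintMatrix
  rw [h1, h2] at h3
  exact congrFun (congrFun h3 β) α

theorem diracBracket_skew (F G : b.WAlgebra) : b.diracBracket F G = -b.diracBracket G F := by
  rw [diracBracket_eq, diracBracket_eq, neg_sub, sub_eq_add_neg, add_comm, sub_eq_add_neg,
    ← Finset.sum_neg_distrib, ← Finset.sum_neg_distrib]
  congr 1
  · rw [Finset.sum_comm (f := fun α β => (∑ i, pderiv i G * b.structureFn (.inl i) (.inr α))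
      * b.constraintMatrix⁻¹ α β * ∑ j, pderiv j F * b.structureFn (.inr β) (.inl j))]
    refine Finset.sum_congr rfl fun α _ => ?_
    rw [← Finset.sum_neg_distrib]
    refine Finset.sum_congr rfl fun β _ => ?_
    rw [constraintMatrix_inv_skew]
    simp only [b.structureFn_skew (.inl _) (.inr _), mul_neg, Finset.sum_neg_distrib]
    ring
  · rw [Finset.sum_comm]
    refine Finset.sum_congr rfl fun j _ => ?_
    rw [← Finset.sum_neg_distrib]
    refine Finset.sum_congr rfl fun i _ => ?_
    rw [structureFn_skew]
    ring

theorem diracBracket_eq_sum (G : b.WAlgebra) :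
    ∃ D : Fin b.r → b.WAlgebra, ∀ F, b.diracBracket F G = ∑ i, pderiv i F * D i := by
  refine ⟨fun i => ∑ j, pderiv j G * b.structureFn (.inl i) (.inl j)
    - ∑ α, ∑ β, b.structureFn (.inl i) (.inr α) * b.constraintMatrix⁻¹ α β
        * ∑ j, pderiv j G * b.structureFn (.inr β) (.inl j), fun F => ?_⟩
  rw [diracBracket_eq]
  simp only [mul_sub, Finset.sum_sub_distrib]
  congr 1
  · refine Finset.sum_congr rfl fun i _ => ?_
    rw [Finset.mul_sum]
    exact Finset.sum_congr rfl fun j _ => by ring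
  · have h : ∀ α β, (∑ i, pderiv i F * b.structureFn (.inl i) (.inr α))
        * b.constraintMatrix⁻¹ α β * ∑ j, pderiv j G * b.structureFn (.inr β) (.inl j)
        = ∑ i, pderiv i F * (b.structureFn (.inl i) (.inr α) * b.constraintMatrix⁻¹ α β
          * ∑ j, pderiv j G * b.structureFn (.inr β) (.inl j)) := by
      intro α β
      rw [Finset.sum_mul, Finset.sum_mul]
      exact Finset.sum_congr rfl fun i _ => by ring
    simp only [h]
    rw [Finset.sum_congr rfl fun α _ => Finset.sum_comm, Finset.sum_comm]
    refine Finset.sum_congr rfl fun i _ => ?_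
    rw [Finset.mul_sum]
    exact Finset.sum_congr rfl fun α _ => by rw [Finset.mul_sum]

theorem diracBracket_isBiderivation : IsBiderivation b.diracBracket := by
  have hl : (∀ F G H, b.diracBracket (F + G) H = b.diracBracket F H + b.diracBracket G H)
      ∧ (∀ (z : ℂ) F G, b.diracBracket (z • F) G = z • b.diracBracket F G)
      ∧ (∀ F G H, b.diracBracket (F * G) H = F * b.diracBracket G H + b.diracBracket F H * G) := by
    refine ⟨fun F G H => ?_, fun z F G => ?_, fun F G H => ?_⟩
    · obtain ⟨D, hD⟩ := b.diracBracket_eq_sum H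
      simp only [hD, map_add, add_mul, Finset.sum_add_distrib]
    · obtain ⟨D, hD⟩ := b.diracBracket_eq_sum G
      simp only [hD, Derivation.map_smul, smul_mul_assoc, Finset.smul_sum]
    · obtain ⟨D, hD⟩ := b.diracBracket_eq_sum H
      simp only [hD, Derivation.leibniz, smul_eq_mul, Finset.mul_sum, Finset.sum_mul,
        ← Finset.sum_add_distrib]
      exact Finset.sum_congr rfl fun i _ => by ring
  have hs := b.diracBracket_skew
  refine ⟨hl.1, fun F G H => ?_, hl.2.1, fun z F G => ?_, hl.2.2, fun F G H => ?_⟩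
  · rw [hs, hl.1, hs G F, hs H F]; ring
  · rw [hs, hl.2.1, hs G F, smul_neg, neg_neg]
  · rw [hs, hl.2.2, hs G F, hs H F]; ring

end General

/-! ### The Dirac bracket at a point of the slice -/

section Folded

variable {N p : ℕ} {θ : Signs N} (b : HighestWeightBasis (θ.foldedE p) (θ.foldedF p))

theorem eval_onConstraints_X (w : Fin b.r → ℂ) (z : Fin b.r ⊕ Fin b.s) :
    eval w (b.onConstraints (X z)) = (b.slicePoint w * b.mat z).trace := by
  rcases z with i | α
  · rw [onConstraints, aeval_X, Sum.elim_inl, eval_X, ← b.trace_slicePoint_mul_inl w i]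
    rfl
  · rw [onConstraints, aeval_X, Sum.elim_inr, eval_C, b.trace_slicePoint_mul_inr]

/-- On the constraint surface a generator `x` is the function `tr (M x)`, so the Lie–Poisson bracket
becomes the Kirillov form at `M`. -/
theorem eval_structureFn (w : Fin b.r → ℂ) (z z' : Fin b.r ⊕ Fin b.s) :
    eval w (b.structureFn z z') = kirillovForm (b.slicePoint w) (b.mat z) (b.mat z') := by
  rw [structureFn, liePoisson, polyBracket_X_X, map_sum, map_sum]
  have h1 := congrArg (fun q : θ.foldedGl p => (b.slicePoint w * (q : Matrix (Fin N × Fin p)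
    (Fin N × Fin p) ℂ)).trace) (b.basis.sum_repr ⁅b.basis z, b.basis z'⁆)
  rw [kirillovForm_apply]
  refine Eq.trans ?_ h1
  rw [AddSubmonoidClass.coe_finsetSum, Finset.mul_sum, Matrix.trace_sum]
  refine Finset.sum_congr rfl fun x _ => ?_
  rw [map_mul, map_mul, eval_onConstraints_X, ← MvPolynomial.algebraMap_eq, AlgHom.commutes,
    MvPolynomial.algebraMap_eq, eval_C]
  simp [mat]

theorem slicePoint_sub_lower (w : Fin b.r → ℂ) (x y : Fin N × Fin p) (h : (x.2 : ℕ) < y.2) :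
    (b.slicePoint w - matE N p ℂ) x y = 0 := by
  rw [b.slicePoint_eq_companion, companion, add_sub_cancel_left]
  simp only [toeplitz, Matrix.of_apply]
  rw [if_neg (by omega)]

theorem lie_slicePoint_mem (w : Fin b.r → ℂ) {x : Matrix (Fin N × Fin p) (Fin N × Fin p) ℂ}
    (hx : x ∈ θ.foldedGl p) : x * b.slicePoint w - b.slicePoint w * x ∈ θ.foldedGl p :=
  (⁅(⟨x, hx⟩ : θ.foldedGl p), (⟨_, θ.mem_foldedGl.2 (b.isFolded_slicePoint w)⟩ : θ.foldedGl p)⁆ :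
    θ.foldedGl p).2

theorem sum_lower_mem (c : Fin b.s → ℂ) : ∑ α, c α • b.mat (.inr α) ∈ θ.foldedGl p :=
  (θ.foldedGl p).toSubmodule.sum_mem fun _ _ => (θ.foldedGl p).smul_mem _ (b.mat_mem _)

theorem exists_sum_lower_eq (c : Fin b.s → ℂ) : ∃ y,
    ∑ α, c α • b.mat (.inr α) = matF N p ℂ * y - y * matF N p ℂ := by
  choose g hg using b.exists_mat_lower
  refine ⟨∑ α, c α • g α, ?_⟩
  simp only [hg, smul_sub, Finset.mul_sum, Finset.sum_mul, Finset.sum_sub_distrib, Matrix.mul_smul,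
    Matrix.smul_mul]

/-- The form `κ(x, ·)` is the trace pairing with `-[x, M]`, so orthogonality to the constraints says
that `[x, M]` is orthogonal to `im (ad e₋)`. -/
theorem commute_of_kirillovForm (w : Fin b.r → ℂ)
    {x : Matrix (Fin N × Fin p) (Fin N × Fin p) ℂ} (hx : x ∈ θ.foldedGl p)
    (h : ∀ α, kirillovForm (b.slicePoint w) x (b.mat (.inr α)) = 0) :
    Commute (matF N p ℂ) (x * b.slicePoint w - b.slicePoint w * x) :=
  b.commute_matF_of_trace (b.lie_slicePoint_mem w hx) fun _ => by
    rw [← neg_eq_zero, ← kirillovForm_eq_left, h]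

theorem commute_gradeComp {x : Matrix (Fin N × Fin p) (Fin N × Fin p) ℂ}
    (h : Commute (matF N p ℂ) x) (d : ℤ) : Commute (matF N p ℂ) (gradeComp d x) := by
  have h1 := congrArg (gradeComp (d + -1)) h.eq
  rwa [gradeComp_mul_left matF_grade, gradeComp_mul_right matF_grade] at h1

/-- The matrix of constraints at a point of the slice. -/
def constraintAt (w : Fin b.r → ℂ) : Matrix (Fin b.s) (Fin b.s) ℂ :=
  Matrix.of fun α β => kirillovForm (b.slicePoint w) (b.mat (.inr α)) (b.mat (.inr β))

theorem kirillovForm_sum_lower (w : Fin b.r → ℂ) (c : Fin b.s → ℂ) (β : Fin b.s) :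
    kirillovForm (b.slicePoint w) (∑ α, c α • b.mat (.inr α)) (b.mat (.inr β))
      = Matrix.vecMul c (b.constraintAt w) β := by
  simp [constraintAt, Matrix.vecMul, dotProduct]

/-- A null vector would give `a ∈ im (ad e₋)` for which `[a, M]` commutes with `e₋`. The grading
argument, with no restriction on the degree, then kills every component of `a`. -/
theorem det_constraintAt_ne_zero (w : Fin b.r → ℂ) : (b.constraintAt w).det ≠ 0 := by
  intro h
  obtain ⟨c, hc, h0⟩ := Matrix.exists_vecMul_eq_zero_iff.2 h
  obtain ⟨y, hy⟩ := b.exists_sum_lower_eq c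
  have h1 := b.commute_of_kirillovForm w (b.sum_lower_mem c) fun β => by
    rw [kirillovForm_sum_lower, h0, Pi.zero_apply]
  have h2 : ∀ d, gradeComp d (∑ α, c α • b.mat (.inr α)) = 0 := fun d =>
    gradeComp_eq_zero_of_lie (K := b.slicePoint w - matE N p ℂ) (b.slicePoint_sub_lower w) hy
      (d₀ := d) (fun d' _ => by rw [add_sub_cancel]; exact commute_gradeComp h1 _) le_rfl
  have h3 : ∑ α, c α • b.mat (.inr α) = 0 := by
    ext x y
    have := congrFun (congrFun (h2 (((y.2 : ℕ) : ℤ) - (x.2 : ℕ))) x) y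
    rwa [gradeComp, Matrix.of_apply, if_pos rfl] at this
  refine hc (funext fun α => ?_)
  have h4 := congrArg (fun q => (b.dual (.inr α) * q).trace) h3
  simpa [Finset.mul_sum, Matrix.trace_sum, trace_dual_mul_mat] using h4

theorem map_constraintMatrix (w : Fin b.r → ℂ) :
    b.constraintMatrix.map (eval w) = b.constraintAt w := by
  ext α β
  rw [Matrix.map_apply, constraintMatrix_apply, eval_structureFn]
  rfl

/-- The constraints are second class. -/
theorem isUnit_det_constraintMatrix : IsUnit b.constraintMatrix.det := by
  refine isUnit_of_eval_ne_zero fun w => ?_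
  rw [RingHom.map_det]
  change (b.constraintMatrix.map (eval w)).det ≠ 0
  rw [map_constraintMatrix]
  exact b.det_constraintAt_ne_zero w

theorem eval_constraintMatrix_inv (w : Fin b.r → ℂ) (α β : Fin b.s) :
    eval w (b.constraintMatrix⁻¹ α β) = (b.constraintAt w)⁻¹ α β := by
  have h : (b.constraintMatrix⁻¹).map (eval w) = (b.constraintAt w)⁻¹ := by
    refine (Matrix.inv_eq_right_inv ?_).symm
    rw [← map_constraintMatrix, ← Matrix.map_mul, Matrix.mul_nonsing_inv _
      b.isUnit_det_constraintMatrix, Matrix.map_one _ (map_zero _) (map_one _)]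
  exact congrFun (congrFun h α) β

theorem sum_trace_dual {x : Matrix (Fin N × Fin p) (Fin N × Fin p) ℂ} (hx : x ∈ θ.foldedGl p) :
    x = ∑ i, (b.dual (.inl i) * x).trace • b.mat (.inl i)
      + ∑ α, (b.dual (.inr α) * x).trace • b.mat (.inr α) := by
  rw [← Fintype.sum_sum_type fun z => (b.dual z * x).trace • b.mat z]
  have h1 := congrArg Subtype.val (b.basis.sum_repr ⟨x, hx⟩)
  rw [AddSubmonoidClass.coe_finsetSum] at h1
  have h2 : x = ∑ z, b.basis.repr ⟨x, hx⟩ z • b.mat z := by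
    exact h1.symm
  refine h2.trans (Finset.sum_congr rfl fun z _ => ?_)
  congr 1
  conv_rhs => rw [h2]
  rw [Finset.mul_sum, Matrix.trace_sum, Finset.sum_eq_single z]
  · rw [Matrix.mul_smul, Matrix.trace_smul, trace_dual_mul_mat, if_pos rfl, smul_eq_mul, mul_one]
  · intro z' _ hz
    rw [Matrix.mul_smul, Matrix.trace_smul, trace_dual_mul_mat, if_neg hz, smul_zero]
  · simp

/-- The Dirac bracket at a point of the slice, by means of gradients that are invariant under
`exp (gl(Np)^τ_{<0})` to first order. -/
theorem eval_diracBracket (w : Fin b.r → ℂ) (F G : b.WAlgebra)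
    {ξ ζ : Matrix (Fin N × Fin p) (Fin N × Fin p) ℂ} (hξ : ξ ∈ θ.foldedGl p)
    (hζ : ζ ∈ θ.foldedGl p) (hF : ∀ i, (b.dual (.inl i) * ξ).trace = eval w (pderiv i F))
    (hG : ∀ i, (b.dual (.inl i) * ζ).trace = eval w (pderiv i G))
    (hξl : ∀ x y : Fin N × Fin p, (x.2 : ℕ) < y.2 →
      (ξ * b.slicePoint w - b.slicePoint w * ξ) x y = 0)
    (hζl : ∀ x y : Fin N × Fin p, (x.2 : ℕ) < y.2 →
      (ζ * b.slicePoint w - b.slicePoint w * ζ) x y = 0) :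
    eval w (b.diracBracket F G) = kirillovForm (b.slicePoint w) ξ ζ := by
  set κ := kirillovForm (b.slicePoint w) with hκ
  have hdet : IsUnit (b.constraintAt w).det := isUnit_iff_ne_zero.2 (b.det_constraintAt_ne_zero w)
  -- The combination `a` of lower vectors with these coefficients makes `ξ + a` orthogonal, under
  -- `κ`, to all the constraints.
  set c := Matrix.vecMul (fun β => -κ ξ (b.mat (.inr β))) (b.constraintAt w)⁻¹ with hc
  have hcc : Matrix.vecMul c (b.constraintAt w) = fun β => -κ ξ (b.mat (.inr β)) := by
    rw [hc, Matrix.vecMul_vecMul, Matrix.nonsing_inv_mul _ hdet, Matrix.vecMul_one]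
  set a := ∑ α, c α • b.mat (.inr α) with ha
  have haL : a ∈ θ.foldedGl p := b.sum_lower_mem c
  have hperp : ∀ β, κ (ξ + a) (b.mat (.inr β)) = 0 := by
    intro β
    rw [map_add, LinearMap.add_apply, ha, kirillovForm_sum_lower, hcc, add_neg_cancel]
  have hcomm := b.commute_of_kirillovForm w ((θ.foldedGl p).add_mem hξ haL) hperp
  obtain ⟨y, hy⟩ := b.exists_sum_lower_eq c
  -- Write `[a, M] = [ξ + a, M] - [ξ, M]`. The first term commutes with `e₋` and the second has no
  -- component of positive degree, so `a` has strictly negative degree.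
  have ha0 : ∀ x y : Fin N × Fin p, (x.2 : ℕ) ≤ y.2 → a x y = 0 := by
    intro x' y' hxy
    have h1 : gradeComp (((y'.2 : ℕ) : ℤ) - (x'.2 : ℕ)) a = 0 := by
      refine gradeComp_eq_zero_of_lie (K := b.slicePoint w - matE N p ℂ)
        (b.slicePoint_sub_lower w) hy (d₀ := 0) (fun d hd => ?_) (by omega)
      rw [add_sub_cancel]
      have h2 : a * b.slicePoint w - b.slicePoint w * a
          = ((ξ + a) * b.slicePoint w - b.slicePoint w * (ξ + a))
            - (ξ * b.slicePoint w - b.slicePoint w * ξ) := by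
        rw [Matrix.add_mul, Matrix.mul_add]; abel
      have h3 : gradeComp (d + 1) (ξ * b.slicePoint w - b.slicePoint w * ξ) = 0 := by
        ext u v
        rw [gradeComp, Matrix.of_apply, Matrix.zero_apply]
        split_ifs with h
        · exact hξl u v (by omega)
        · rfl
      rw [← ha, h2, gradeComp_sub, h3, sub_zero]
      exact commute_gradeComp hcomm _
    have := congrFun (congrFun h1 x') y'
    rwa [gradeComp, Matrix.of_apply, if_pos rfl] at this
  -- This is the trace of the strictly lower `a` times `[ζ, M]`, which has no entries above the
  -- block diagonal.
  have haζ : κ a ζ = 0 := by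
    rw [hκ, kirillovForm_eq_right, Matrix.trace]
    refine Finset.sum_eq_zero fun x _ => ?_
    rw [Matrix.diag_apply, Matrix.mul_apply]
    refine Finset.sum_eq_zero fun z _ => ?_
    by_cases h : (x.2 : ℕ) ≤ z.2
    · rw [ha0 x z h, zero_mul]
    · rw [hζl z x (by omega), mul_zero]
  set F' := ∑ i, eval w (pderiv i F) • b.mat (.inl i) with hF'
  set G' := ∑ i, eval w (pderiv i G) • b.mat (.inl i) with hG'
  set c' : Fin b.s → ℂ := fun α => (b.dual (.inr α) * ξ).trace + c α with hc'
  have hξa : ξ + a = F' + ∑ α, c' α • b.mat (.inr α) := by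
    conv_lhs => rw [b.sum_trace_dual hξ]
    simp only [hF, hc', add_smul, Finset.sum_add_distrib]
    rw [add_assoc]
  -- The elements `ζ` and `G'` differ by lower vectors, to which `ξ + a` is orthogonal.
  have hζG : κ (ξ + a) ζ = κ (ξ + a) G' := by
    have hφ : ∀ φ : Matrix (Fin N × Fin p) (Fin N × Fin p) ℂ →ₗ[ℂ] ℂ,
        (∀ β, φ (b.mat (.inr β)) = 0) → φ ζ = φ G' := by
      intro φ h
      conv_lhs => rw [b.sum_trace_dual hζ]
      simp only [hG, map_add, map_sum, map_smul, h, smul_zero, Finset.sum_const_zero, add_zero, hG']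
    exact hφ _ hperp
  have hFβ : ∀ β, κ F' (b.mat (.inr β)) = -Matrix.vecMul c' (b.constraintAt w) β := by
    intro β
    have h1 := hperp β
    rw [hξa, map_add, LinearMap.add_apply, kirillovForm_sum_lower] at h1
    exact eq_neg_of_add_eq_zero_left h1
  have main : eval w (b.diracBracket F G) = κ F' G'
      - ∑ α, ∑ β, κ F' (b.mat (.inr α)) * (b.constraintAt w)⁻¹ α β * κ (b.mat (.inr β)) G' := by
    have hκF : ∀ m, κ F' m = ∑ i, eval w (pderiv i F) * κ (b.mat (.inl i)) m := fun m => by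
      rw [hF', map_sum, LinearMap.sum_apply]
      exact Finset.sum_congr rfl fun i _ => by
        rw [map_smul, LinearMap.smul_apply, smul_eq_mul]
    have hκG : ∀ m, κ m G' = ∑ i, eval w (pderiv i G) * κ m (b.mat (.inl i)) := fun m => by
      rw [hG', map_sum]
      exact Finset.sum_congr rfl fun i _ => by rw [map_smul, smul_eq_mul]
    rw [diracBracket_eq]
    simp only [map_sub, map_sum, map_mul, eval_structureFn, eval_constraintMatrix_inv, ← hκ]
    simp only [hκF, hκG]
    congr 1
    refine Finset.sum_congr rfl fun i _ => ?_
    rw [Finset.mul_sum]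
    exact Finset.sum_congr rfl fun j _ => by ring
  -- Orthogonality of `ξ + a = F' + (lower part)` writes the pairing of `F'` with the constraints as
  -- minus `c'` times the constraint matrix. The inverse matrix cancels, and the Dirac correction is
  -- the pairing of the lower part with `G'`.
  have h5 : ∑ α, ∑ β, κ F' (b.mat (.inr α)) * (b.constraintAt w)⁻¹ α β * κ (b.mat (.inr β)) G'
      = -∑ β, c' β * κ (b.mat (.inr β)) G' := by
    rw [Finset.sum_comm, ← Finset.sum_neg_distrib]
    refine Finset.sum_congr rfl fun β _ => ?_
    rw [← Finset.sum_mul]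
    have h6 : ∑ α, κ F' (b.mat (.inr α)) * (b.constraintAt w)⁻¹ α β = -c' β := by
      simp only [hFβ, neg_mul, Finset.sum_neg_distrib]
      have := congrFun (Matrix.vecMul_vecMul c' (b.constraintAt w) (b.constraintAt w)⁻¹) β
      rw [Matrix.mul_nonsing_inv _ hdet, Matrix.vecMul_one] at this
      rw [← this]
      rfl
    rw [h6, neg_mul]
  rw [main, h5, sub_neg_eq_add]
  have h7 : κ (∑ β, c' β • b.mat (.inr β)) G' = ∑ β, c' β * κ (b.mat (.inr β)) G' := by
    simp [LinearMap.sum_apply]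
  rw [← h7, ← LinearMap.add_apply, ← map_add, ← hξa, ← hζG, map_add, LinearMap.add_apply, haζ,
    add_zero]

end Folded

end HighestWeightBasis

/-! ### The bracket of the entries of `T(u)` -/

section Naturality

variable {N p : ℕ} {B B' : Type*} [CommRing B] [Algebra ℂ B] [CommRing B'] [Algebra ℂ B']

theorem map_colCoeff_matrix (φ : B →ₐ[ℂ] B') (κ : ℕ → ℕ → ℂ) (A : ℕ → Matrix (Fin N) (Fin N) B)
    (k j : ℕ) : (colCoeff κ A k j).map φ = colCoeff κ (fun t => (A t).map φ) k j :=
  map_colCoeff κ A φ.mapMatrix k j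

theorem map_colSeries (φ : B →ₐ[ℂ] B') (κ : ℕ → ℕ → ℂ) (A : ℕ → Matrix (Fin N) (Fin N) B)
    (u : ℂ) (k : ℕ) : (colSeries κ A u k).map φ = colSeries κ (fun t => (A t).map φ) u k := by
  change φ.mapMatrix (colSeries κ A u k) = _
  simp only [colSeries, map_sum, map_smul, map_colCoeff]
  rfl

theorem map_charMatrix (φ : B →ₐ[ℂ] B') (A : ℕ → Matrix (Fin N) (Fin N) B) (u : ℂ) :
    (charMatrix p A u).map φ = charMatrix p (fun t => (A t).map φ) u := by
  rw [charMatrix, charMatrix, ← map_colSeries]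
  ext i j
  simp

theorem map_colMatrix (φ : B →ₐ[ℂ] B') (A : ℕ → Matrix (Fin N) (Fin N) B) (u : ℂ) :
    (colMatrix p A u).map φ = colMatrix p (fun t => (A t).map φ) u := by
  ext x j
  simp only [colMatrix, Matrix.map_apply, Matrix.of_apply, ← map_colSeries, map_smul]

theorem map_rowMatrix (θ : Signs N) (φ : B →ₐ[ℂ] B') (A : ℕ → Matrix (Fin N) (Fin N) B) (u : ℂ) :
    (θ.rowMatrix p A u).map φ = θ.rowMatrix p (fun t => (A t).map φ) u := by
  ext i y
  simp [Signs.rowMatrix, ← map_colMatrix]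

end Naturality

namespace Signs

variable {N p : ℕ} (θ : Signs N)

section Derivative

variable {B : Type*} [CommRing B] [Algebra ℂ B]

theorem derivation_matrix_mul {l m n : Type*} [Fintype m] (D : Derivation ℂ B B)
    (P : Matrix l m B) (Q : Matrix m n B) :
    (P * Q).map D = P.map D * Q + P * Q.map D := by
  ext i j
  simp only [Matrix.map_apply, Matrix.mul_apply, Matrix.add_apply, map_sum, Derivation.leibniz,
    smul_eq_mul, ← Finset.sum_add_distrib]
  exact Finset.sum_congr rfl fun k _ => by ring

/-- The derivative of `T(u)` along the slice. -/
theorem derivation_charMatrix (hp : 0 < p) {A : ℕ → Matrix (Fin N) (Fin N) B}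
    (hA : θ.IsFolded (companion p A)) (u : ℂ) (D : Derivation ℂ B B) :
    (charMatrix p A u).map D
      = -(θ.rowMatrix p A u * (companion p A).map D * colMatrix p A u) := by
  have h1 : (companion p A).map D * colMatrix p A u + companion p A * (colMatrix p A u).map D
      = u • (colMatrix p A u).map D - lastCol p ((charMatrix p A u).map D) := by
    rw [← derivation_matrix_mul, companion_mul_colMatrix]
    ext x j
    simp only [Matrix.map_apply, Matrix.sub_apply, Matrix.smul_apply, map_sub, lastCol,
      Matrix.of_apply, Derivation.map_smul]
    split_ifs <;> simp
  -- The first block of `X(u)` is the constant `1`, so its derivative does not meet the first block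
  -- column, where the remainder of `Y(u) (u - M)` sits.
  have h2 : firstRow p (charMatrix p A u) * (colMatrix p A u).map D = 0 := by
    ext i j
    rw [Matrix.mul_apply]
    refine Finset.sum_eq_zero fun x _ => ?_
    by_cases h : (x.2 : ℕ) = 0
    · have : colMatrix p A u x j = algebraMap ℂ B (if x.1 = j then 1 else 0) := by
        simp only [colMatrix, Matrix.of_apply, h, colSeries_zero, weight, Matrix.one_apply]
        split_ifs <;> simp
      rw [Matrix.map_apply, this, Derivation.map_algebraMap, mul_zero]
    · simp [firstRow, h]
  have h3 := congrArg (θ.rowMatrix p A u * ·) h1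
  simp only [Matrix.mul_add, Matrix.mul_sub, ← Matrix.mul_assoc, rowMatrix_mul_companion' θ hp hA,
    Matrix.sub_mul, h2, sub_zero, rowMatrix_mul_lastCol θ hp, Matrix.mul_smul,
    Matrix.smul_mul] at h3
  rw [← sub_eq_zero] at h3 ⊢
  rw [← h3]
  abel

end Derivative

/-- The (extended) gradient of `-T_{ij}(u)` with respect to the trace form of `gl(Np)`. -/
def gradient (p : ℕ) (A : ℕ → Matrix (Fin N) (Fin N) ℂ) (u : ℂ) (i j : Fin N) :
    Matrix (Fin N × Fin p) (Fin N × Fin p) ℂ :=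
  colMatrix p A u * Matrix.single j i (1 : ℂ) * θ.rowMatrix p A u

theorem gradient_apply (A : ℕ → Matrix (Fin N) (Fin N) ℂ) (u : ℂ) (i j : Fin N)
    (x y : Fin N × Fin p) :
    θ.gradient p A u i j x y = colMatrix p A u x j * θ.rowMatrix p A u i y := by
  rw [gradient, Matrix.mul_apply, Finset.sum_eq_single i]
  · rw [Matrix.mul_single_apply_same, mul_one]
  · intro k _ hk
    rw [Matrix.mul_single_apply_of_ne _ _ _ _ _ hk, zero_mul]
  · simp

theorem trace_mul_single {m n : Type*} [Fintype m] [Fintype n] [DecidableEq m] [DecidableEq n]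
    (K : Matrix m n ℂ) (i : m) (j : n) : (K * Matrix.single j i (1 : ℂ)).trace = K i j := by
  simp [Matrix.trace_mul_single]

theorem trace_mul_gradient (A : ℕ → Matrix (Fin N) (Fin N) ℂ) (u : ℂ) (i j : Fin N)
    (η : Matrix (Fin N × Fin p) (Fin N × Fin p) ℂ) :
    (η * θ.gradient p A u i j).trace
      = (θ.rowMatrix p A u * η * colMatrix p A u) i j := by
  rw [gradient, ← Matrix.mul_assoc, Matrix.trace_mul_comm, ← Matrix.mul_assoc, ← Matrix.mul_assoc,
    trace_mul_single]

variable {A : ℕ → Matrix (Fin N) (Fin N) ℂ}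

/-- Multiplication by `M` acts on `X(u)` and `Y(u)` as `u` up to one extreme block. The terms in `u`
cancel in the commutator and only the two boundary terms remain. -/
theorem lie_gradient (hp : 0 < p) (hA : θ.IsFolded (companion p A)) (u : ℂ) (i j : Fin N) :
    θ.gradient p A u i j * companion p A - companion p A * θ.gradient p A u i j
      = lastCol p (charMatrix p A u) * Matrix.single j i (1 : ℂ) * θ.rowMatrix p A u
        - colMatrix p A u * Matrix.single j i (1 : ℂ) * firstRow p (charMatrix p A u) := by
  rw [gradient, Matrix.mul_assoc (colMatrix p A u * Matrix.single j i (1 : ℂ)),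
    rowMatrix_mul_companion' θ hp hA, ← Matrix.mul_assoc, ← Matrix.mul_assoc,
    companion_mul_colMatrix]
  simp only [Matrix.mul_sub, Matrix.sub_mul, Matrix.mul_smul, Matrix.smul_mul]
  abel

/-- The boundary terms occupy the last block row and the first block column, neither of which meets
the region above the block diagonal. This is the condition on gradients under which the Dirac
correction disappears. -/
theorem lie_gradient_lower (hp : 0 < p) (hA : θ.IsFolded (companion p A)) (u : ℂ) (i j : Fin N)
    (x y : Fin N × Fin p) (h : (x.2 : ℕ) < y.2) :
    (θ.gradient p A u i j * companion p A - companion p A * θ.gradient p A u i j) x y = 0 := by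
  have hy := y.2.isLt
  rw [lie_gradient θ hp hA, Matrix.sub_apply, Matrix.mul_assoc, Matrix.mul_apply, Matrix.mul_apply,
    Finset.sum_eq_zero, Finset.sum_eq_zero, sub_zero]
  · intro k _
    simp only [firstRow, Matrix.of_apply]
    rw [if_neg (by omega), mul_zero]
  · intro k _
    simp only [lastCol, Matrix.of_apply]
    rw [if_neg (by omega), zero_mul]

/-- The boundary terms of `[gradient, M]` at `v`, sandwiched between `Y(u)` and `X(u)`, give
products of `T(v)` with the mixed products `Y(v) X(u)` and `Y(u) X(v)`, which are divided
differences of `T`. -/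
theorem kirillovForm_gradient (hp : 0 < p) (hA : θ.IsFolded (companion p A)) (u v : ℂ)
    (i j k l : Fin N) :
    (u - v) * kirillovForm (companion p A) (θ.gradient p A u i j) (θ.gradient p A v k l)
      = charMatrix p A u k j * charMatrix p A v i l
        - charMatrix p A v k j * charMatrix p A u i l := by
  have h1 : (u - v) * (θ.rowMatrix p A v * colMatrix p A u) k j
      = charMatrix p A u k j - charMatrix p A v k j := by
    have := congrFun (congrFun (θ.rowMatrix_mul_colMatrix hp hA v u) k) j
    rw [Matrix.smul_apply, Matrix.sub_apply, smul_eq_mul] at this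
    linear_combination -this
  have h2 : (u - v) * (θ.rowMatrix p A u * colMatrix p A v) i l
      = charMatrix p A u i l - charMatrix p A v i l := by
    have := congrFun (congrFun (θ.rowMatrix_mul_colMatrix hp hA u v) i) l
    rw [Matrix.smul_apply, Matrix.sub_apply, smul_eq_mul] at this
    linear_combination this
  have sandwich : ∀ P Q : Matrix (Fin N) (Fin N) ℂ, (P * Matrix.single l k (1 : ℂ) * Q) i j
      = P i l * Q k j := by
    intro P Q
    rw [Matrix.mul_apply, Finset.sum_eq_single k]
    · rw [Matrix.mul_single_apply_same, mul_one]
    · intro k' _ hk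
      rw [Matrix.mul_single_apply_of_ne _ _ _ _ _ hk, zero_mul]
    · simp
  have h3 : kirillovForm (companion p A) (θ.gradient p A u i j) (θ.gradient p A v k l)
      = charMatrix p A v i l * (θ.rowMatrix p A v * colMatrix p A u) k j
        - (θ.rowMatrix p A u * colMatrix p A v) i l * charMatrix p A v k j := by
    rw [kirillovForm_eq_right, lie_gradient θ hp hA, Matrix.trace_mul_comm, trace_mul_gradient]
    simp only [Matrix.mul_sub, Matrix.sub_mul, Matrix.sub_apply]
    have e1 : θ.rowMatrix p A u * (lastCol p (charMatrix p A v) * Matrix.single l k (1 : ℂ)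
        * θ.rowMatrix p A v) * colMatrix p A u
        = charMatrix p A v * Matrix.single l k (1 : ℂ) * (θ.rowMatrix p A v * colMatrix p A u) := by
      simp only [← Matrix.mul_assoc, rowMatrix_mul_lastCol θ hp]
    have e2 : θ.rowMatrix p A u * (colMatrix p A v * Matrix.single l k (1 : ℂ)
        * firstRow p (charMatrix p A v)) * colMatrix p A u
        = (θ.rowMatrix p A u * colMatrix p A v) * Matrix.single l k (1 : ℂ) * charMatrix p A v := by
      simp only [Matrix.mul_assoc, firstRow_mul_colMatrix hp]
    rw [e1, e2, sandwich, sandwich]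
  rw [h3]
  linear_combination charMatrix p A v i l * h1 - charMatrix p A v k j * h2

end Signs

/-! ### The bracket of the entries of `T(u)` in the W-algebra -/

namespace Signs

variable {N p : ℕ} (θ : Signs N)

/-- Folding exchanges the column and the row solution and reverses the sign of the parameter. This
is where `r'(u + v)` comes from. -/
theorem tau_gradient (A : ℕ → Matrix (Fin N) (Fin N) ℂ) (v : ℂ) (k l : Fin N) :
    θ.tau p (θ.gradient p A v k l)
      = ((-1) ^ p * ((θ.sgn k : ℤ) : ℂ) * ((θ.sgn l : ℤ) : ℂ))
        • θ.gradient p A (-v) l.rev k.rev := by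
  ext ⟨a, x⟩ ⟨b, y⟩
  have hx := x.isLt
  rw [Matrix.smul_apply, gradient_apply, smul_eq_mul]
  simp only [tau, Matrix.of_apply]
  rw [gradient_apply]
  simp only [rowMatrix, Matrix.of_apply, neg_neg, Fin.rev_rev, sgn_rev, Fin.val_rev]
  have h1 : (-1 : ℂ) ^ (p + 1 + (p - ((x : ℕ) + 1))) = (-1) ^ (x : ℕ) := by
    rw [neg_one_pow_eq_pow_mod_two, neg_one_pow_eq_pow_mod_two (n := (x : ℕ))]
    congr 1
    omega
  rw [h1]
  simp only [pow_add, pow_one]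
  have e1 := sgn_sq (A := ℂ) (θ.sgn a)
  have e2 : ((-1 : ℂ) ^ (x : ℕ)) * (-1) ^ (x : ℕ) = 1 := by rw [← mul_pow]; simp
  have e3 : ((-1 : ℂ) ^ p) * (-1) ^ p = 1 := by rw [← mul_pow]; simp
  have e4 := sgn_sq (A := ℂ) (θ.sgn l)
  generalize colMatrix p A v (b.rev, y.rev) l = q at *
  generalize colMatrix p A (-v) (a, x) k.rev = q' at *
  generalize ((θ.sgn₀ : ℤ) : ℂ) = t0 at *
  generalize ((θ.sgn a : ℤ) : ℂ) = ta at *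
  generalize ((θ.sgn b : ℤ) : ℂ) = tb at *
  generalize ((θ.sgn k : ℤ) : ℂ) = tk at *
  generalize ((θ.sgn l : ℤ) : ℂ) = tl at *
  generalize ((-1 : ℂ) ^ (x : ℕ)) = sx at *
  generalize ((-1 : ℂ) ^ (y : ℕ)) = sy at *
  generalize ((-1 : ℂ) ^ p) = sp at *
  grind

variable {A : ℕ → Matrix (Fin N) (Fin N) ℂ}

theorem charMatrix_symm (hp : 0 < p) (hA : θ.IsFolded (companion p A)) (u : ℂ) (i j : Fin N) :
    charMatrix p A u i j = (-1) ^ p * ((θ.sgn i : ℤ) : ℂ) * ((θ.sgn j : ℤ) : ℂ)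
      * charMatrix p A (-u) j.rev i.rev :=
  congrFun (congrFun (θ.foldedChar_eq hp hA u).symm i) j

theorem kirillovForm_tau_gradient (hp : 0 < p) (hA : θ.IsFolded (companion p A)) (u v : ℂ)
    (i j k l : Fin N) :
    (u + v) * kirillovForm (companion p A) (θ.gradient p A u i j) (θ.tau p (θ.gradient p A v k l))
      = ((θ.sgn₀ : ℤ) : ℂ) * (((θ.sgn i : ℤ) : ℂ) * ((θ.sgn l : ℤ) : ℂ)
          * charMatrix p A v k i.rev * charMatrix p A u l.rev j
        - ((θ.sgn k : ℤ) : ℂ) * ((θ.sgn j : ℤ) : ℂ)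
          * charMatrix p A u i k.rev * charMatrix p A v j.rev l) := by
  have h1 := θ.kirillovForm_gradient hp hA u (-v) i j l.rev k.rev
  have h2 := θ.charMatrix_symm hp hA v k i.rev
  have h3 := θ.charMatrix_symm hp hA v j.rev l
  rw [Fin.rev_rev, sgn_rev] at h2 h3
  rw [tau_gradient, map_smul, smul_eq_mul, h2, h3]
  have e1 := sgn_sq (A := ℂ) (θ.sgn k)
  have e2 := sgn_sq (A := ℂ) (θ.sgn l)
  have e3 := sgn_sq (A := ℂ) (θ.sgn i)
  have e4 := sgn_sq (A := ℂ) (θ.sgn j)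
  have e5 := sgn_sq (A := ℂ) θ.sgn₀
  rw [sub_neg_eq_add] at h1
  clear h2 h3
  generalize kirillovForm (companion p A) (θ.gradient p A u i j)
    (θ.gradient p A (-v) l.rev k.rev) = K at *
  generalize ((θ.sgn₀ : ℤ) : ℂ) = t0 at *
  generalize ((θ.sgn i : ℤ) : ℂ) = ti at *
  generalize ((θ.sgn j : ℤ) : ℂ) = tj at *
  generalize ((θ.sgn k : ℤ) : ℂ) = tk at *
  generalize ((θ.sgn l : ℤ) : ℂ) = tl at *
  generalize ((-1 : ℂ) ^ p) = sp at *
  generalize charMatrix p A (-v) i k.rev = q1 at *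
  generalize charMatrix p A (-v) l.rev j = q2 at *
  generalize charMatrix p A u i k.rev = q3 at *
  generalize charMatrix p A u l.rev j = q4 at *
  generalize u + v = c at *
  linear_combination sp * tk * tl * h1 - sp * tk * tl * q1 * q4 * ti * ti * e5
    - sp * tk * tl * q1 * q4 * e3 + sp * tk * tl * q2 * q3 * tj * tj * e5
    + sp * tk * tl * q2 * q3 * e4

/-- The gradient of `T_{ij}(u)`, projected to `gl(Np)^τ`. -/
def foldedGradient (p : ℕ) (A : ℕ → Matrix (Fin N) (Fin N) ℂ) (u : ℂ) (i j : Fin N) :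
    Matrix (Fin N × Fin p) (Fin N × Fin p) ℂ :=
  (-1 / 2 : ℂ) • (θ.gradient p A u i j + θ.tau p (θ.gradient p A u i j))

theorem foldedGradient_mem (u : ℂ) (i j : Fin N) :
    θ.foldedGradient p A u i j ∈ θ.foldedGl p :=
  (θ.foldedGl p).smul_mem _ (θ.add_tau_mem _)

theorem trace_mul_foldedGradient {c : Matrix (Fin N × Fin p) (Fin N × Fin p) ℂ}
    (hc : c ∈ θ.foldedGl p) (u : ℂ) (i j : Fin N) :
    (c * θ.foldedGradient p A u i j).trace = -(c * θ.gradient p A u i j).trace := by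
  rw [foldedGradient, Matrix.mul_smul, Matrix.trace_smul, trace_mul_add_tau θ hc, smul_eq_mul]
  ring

theorem lie_foldedGradient_lower (hp : 0 < p) (hA : θ.IsFolded (companion p A)) (u : ℂ)
    (i j : Fin N) (x y : Fin N × Fin p) (h : (x.2 : ℕ) < y.2) :
    (θ.foldedGradient p A u i j * companion p A
      - companion p A * θ.foldedGradient p A u i j) x y = 0 := by
  have h1 := θ.lie_gradient_lower hp hA u i j x y h
  have h2 := θ.lie_gradient_lower hp hA (-u) j.rev i.rev x y h
  rw [foldedGradient, tau_gradient]
  simp only [Matrix.mul_smul, Matrix.smul_mul, Matrix.mul_add, Matrix.add_mul, Matrix.sub_apply,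
    Matrix.smul_apply, Matrix.add_apply, smul_eq_mul] at *
  generalize ((-1) ^ p * ((θ.sgn i : ℤ) : ℂ) * ((θ.sgn j : ℤ) : ℂ)) = c
  linear_combination (-1 / 2 : ℂ) * h1 + (-1 / 2 : ℂ) * c * h2

/-- Against an element of `gl(Np)^τ` the projected gradient may be replaced by minus the unprojected
one. This applies to the argument at `u`, while the one at `v` keeps both the gradient and its image
under τ, each with weight one half. -/
theorem kirillovForm_foldedGradient (hp : 0 < p) (hA : θ.IsFolded (companion p A)) {u v : ℂ}
    (huv : u - v ≠ 0) (huv' : u + v ≠ 0) (i j k l : Fin N) :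
    kirillovForm (companion p A) (θ.foldedGradient p A u i j) (θ.foldedGradient p A v k l)
      = (1 / 2) * θ.sklyanin (charMatrix p A) u i j v k l := by
  have hc : θ.foldedGradient p A v k l * companion p A
      - companion p A * θ.foldedGradient p A v k l ∈ θ.foldedGl p :=
    (⁅(⟨_, θ.foldedGradient_mem v k l⟩ : θ.foldedGl p),
      (⟨_, θ.mem_foldedGl.2 hA⟩ : θ.foldedGl p)⁆ : θ.foldedGl p).2
  have h1 := θ.kirillovForm_gradient hp hA u v i j k l
  have h2 := θ.kirillovForm_tau_gradient hp hA u v i j k l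
  rw [kirillovForm_eq_right, Matrix.trace_mul_comm, θ.trace_mul_foldedGradient hc,
    Matrix.trace_mul_comm, ← kirillovForm_eq_right]
  conv_lhs => rw [foldedGradient.eq_def θ p A v k l]
  rw [map_smul, map_add, smul_eq_mul]
  simp only [sklyanin, Algebra.algebraMap_self, RingHom.id_apply]
  field_simp
  linear_combination (u + v) * h1 + (u - v) * h2

end Signs

namespace HighestWeightBasis

variable {N p : ℕ} {θ : Signs N} (b : HighestWeightBasis (θ.foldedE p) (θ.foldedF p))

/-- The matrix `T(u)` of elements of the W-algebra. -/
def charSeries (u : ℂ) : Matrix (Fin N) (Fin N) b.WAlgebra :=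
  charMatrix p (b.sliceCoeff X) u

theorem isFolded_companion {B : Type*} [CommRing B] [Algebra ℂ B] (w : Fin b.r → B) :
    θ.IsFolded (companion p (b.sliceCoeff w)) := by
  rw [← b.slicePoint_eq_companion]
  exact b.isFolded_slicePoint w

theorem map_sliceCoeff_X (w : Fin b.r → ℂ) :
    (fun t => (b.sliceCoeff X t).map (aeval (R := ℂ) w)) = b.sliceCoeff w := by
  funext t
  rw [map_sliceCoeff]
  simp

theorem eval_charSeries (w : Fin b.r → ℂ) (u : ℂ) (i j : Fin N) :
    eval w (b.charSeries u i j) = charMatrix p (b.sliceCoeff w) u i j := by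
  rw [← map_sliceCoeff_X, ← map_charMatrix]
  rfl

theorem derivation_slicePoint (i : Fin b.r) :
    (b.slicePoint (B := b.WAlgebra) X).map (pderiv i) = (b.dual (.inl i)).map C := by
  ext x y : 2
  rw [slicePoint]
  simp only [Matrix.map_apply, Matrix.add_apply, Matrix.sum_apply, Matrix.smul_apply, map_add,
    map_sum, smul_eq_mul, Derivation.leibniz, map_sub, matE, pderiv_X, MvPolynomial.algebraMap_eq]
  rw [Finset.sum_eq_single i]
  · simp
  · intro j _ hj
    simp [Pi.single_eq_of_ne hj]
  · simp

theorem eval_pderiv_charSeries (hp : 0 < p) (w : Fin b.r → ℂ) (u : ℂ) (i j : Fin N)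
    (m : Fin b.r) : (b.dual (.inl m) * θ.foldedGradient p (b.sliceCoeff w) u i j).trace
      = eval w (pderiv m (b.charSeries u i j)) := by
  have h1 := congrFun (congrFun (θ.derivation_charMatrix hp (b.isFolded_companion X) u
    (pderiv m)) i) j
  rw [← b.slicePoint_eq_companion, derivation_slicePoint, Matrix.map_apply, Matrix.neg_apply] at h1
  rw [θ.trace_mul_foldedGradient (b.dual_mem _), θ.trace_mul_gradient, charSeries, h1, map_neg]
  congr 1
  have h2 : ((b.dual (.inl m)).map C).map (aeval (R := ℂ) w) = b.dual (.inl m) := by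
    ext x y
    simp
  change _ = ((_ : Matrix (Fin N) (Fin N) b.WAlgebra).map (aeval (R := ℂ) w)) i j
  rw [Matrix.map_mul, Matrix.map_mul, map_rowMatrix, map_colMatrix, map_sliceCoeff_X, h2]

/-- Polynomials are compared at the points of the slice, where the projected gradients meet the
hypotheses of `eval_diracBracket`. -/
theorem diracBracket_charSeries (hp : 0 < p) {u v : ℂ} (huv : u - v ≠ 0) (huv' : u + v ≠ 0)
    (i j k l : Fin N) : b.diracBracket (b.charSeries u i j) (b.charSeries v k l)
      = algebraMap ℂ _ (1 / 2) * θ.sklyanin (A := b.WAlgebra) b.charSeries u i j v k l := by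
  refine MvPolynomial.funext fun w => ?_
  have hA := b.isFolded_companion w
  rw [b.eval_diracBracket w _ _ (θ.foldedGradient_mem u i j) (θ.foldedGradient_mem v k l)
    (b.eval_pderiv_charSeries hp w u i j) (b.eval_pderiv_charSeries hp w v k l),
    b.slicePoint_eq_companion, θ.kirillovForm_foldedGradient hp hA huv huv', map_mul,
    MvPolynomial.algebraMap_eq, eval_C]
  · congr 1
    refine Eq.trans ?_ (θ.sklyanin_map (aeval (R := ℂ) w) b.charSeries u i j v k l).symm
    congr 1
    funext u i j
    exact (b.eval_charSeries w u i j).symm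
  all_goals
    intro x y h
    rw [b.slicePoint_eq_companion]
    exact θ.lie_foldedGradient_lower hp hA _ _ _ x y h

end HighestWeightBasis

/-! ### The generators of the W-algebra -/

section ScaledCoeff

variable {N p : ℕ} {B B' : Type*} [CommRing B] [Algebra ℂ B] [CommRing B'] [Algebra ℂ B']

/-- The coefficients of `2^p T(u/2)`, up to a common factor. -/
def scaledCoeff (p : ℕ) (A : ℕ → Matrix (Fin N) (Fin N) B) (m : ℕ) (i j : Fin N) : B :=
  (2 : ℂ) ^ m • colCoeff (weightRatio p) A p m i j

theorem scaledCoeff_zero (A : ℕ → Matrix (Fin N) (Fin N) B) (i j : Fin N) :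
    scaledCoeff p A 0 i j = if i = j then 1 else 0 := by
  simp [scaledCoeff, colCoeff_zero_right, Matrix.one_apply]

theorem scaledCoeff_eq_zero (A : ℕ → Matrix (Fin N) (Fin N) B) {m : ℕ} (h : p < m) (i j : Fin N) :
    scaledCoeff p A m i j = 0 := by
  simp [scaledCoeff, colCoeff_eq_zero _ _ h]

theorem map_scaledCoeff (φ : B →ₐ[ℂ] B') (A : ℕ → Matrix (Fin N) (Fin N) B) (m : ℕ) (i j : Fin N) :
    φ (scaledCoeff p A m i j) = scaledCoeff p (fun t => (A t).map φ) m i j := by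
  rw [scaledCoeff, scaledCoeff, map_smul, ← map_colCoeff_matrix]
  rfl

theorem scaledCoeff_congr {A A' : ℕ → Matrix (Fin N) (Fin N) B} (h : ∀ t < p, A t = A' t) (m : ℕ)
    (i j : Fin N) : scaledCoeff p A m i j = scaledCoeff p A' m i j := by
  by_cases hm : p < m
  · rw [scaledCoeff_eq_zero _ hm, scaledCoeff_eq_zero _ hm]
  · rw [scaledCoeff, scaledCoeff, colCoeff_congr _ fun t ht => h t (by omega)]

theorem scaledCoeff_injective {A A' : ℕ → Matrix (Fin N) (Fin N) B}
    (h : ∀ m i j, scaledCoeff p A m i j = scaledCoeff p A' m i j) {t : ℕ} (ht : t < p) :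
    A t = A' t := by
  refine colCoeff_injective (weightRatio p) A (fun _ => sum_weightRatio_ne_zero) (fun m _ => ?_) ht
  ext i j
  exact smul_right_injective B (pow_ne_zero (m + 1) (two_ne_zero : (2 : ℂ) ≠ 0)) (h (m + 1) i j)

theorem scaledCoeff_surjective {S : ℕ → Fin N → Fin N → B}
    (hS : ∀ i j, S 0 i j = if i = j then 1 else 0) (hp : ∀ m i j, p < m → S m i j = 0) :
    ∃ A : ℕ → Matrix (Fin N) (Fin N) B, ∀ m i j, scaledCoeff p A m i j = S m i j := by
  obtain ⟨A, hA⟩ := colCoeff_surjective (weightRatio p) (fun _ => sum_weightRatio_ne_zero)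
    (R := Matrix (Fin N) (Fin N) B) (p := p)
    fun m => (((2 : ℂ) ^ (m + 1))⁻¹) • (Matrix.of (S (m + 1)))
  refine ⟨A, fun m i j => ?_⟩
  rcases m with _ | m
  · rw [scaledCoeff_zero, hS]
  · by_cases hm : p < m + 1
    · rw [scaledCoeff_eq_zero _ hm, hp _ _ _ hm]
    · rw [scaledCoeff, hA m (by omega), Matrix.smul_apply, Matrix.of_apply, smul_smul,
        mul_inv_cancel₀ (pow_ne_zero _ two_ne_zero), one_smul]

theorem genSeries_scaledCoeff (A : ℕ → Matrix (Fin N) (Fin N) B) (u : ℂ) (i j : Fin N) :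
    genSeries (scaledCoeff p A) p (algebraMap ℂ B u) i j
      = (2 : ℂ) ^ p • colSeries (weightRatio p) A (u / 2) p i j := by
  rw [genSeries, colSeries, Matrix.sum_apply, Finset.smul_sum]
  refine Finset.sum_congr rfl fun m hm => ?_
  have hm' := Finset.mem_range.1 hm
  rw [scaledCoeff, ← map_pow, ← Algebra.smul_def, Matrix.smul_apply, smul_smul, smul_smul]
  congr 1
  obtain ⟨q, hq⟩ := Nat.exists_eq_add_of_le (Nat.lt_succ_iff.1 hm')
  rw [hq, Nat.add_sub_cancel_left, pow_add, div_pow]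
  field_simp

theorem companion_congr {A A' : ℕ → Matrix (Fin N) (Fin N) B} (h : ∀ t < p, A t = A' t) :
    companion p A = companion p A' := by
  rw [companion, companion]
  congr 1
  ext x y
  have := x.2.isLt
  simp only [toeplitz, Matrix.of_apply]
  rw [h _ (by omega)]

theorem companion_injective {A A' : ℕ → Matrix (Fin N) (Fin N) B}
    (h : companion p A = companion p A') {t : ℕ} (ht : t < p) : A t = A' t := by
  have h1 := add_left_cancel h
  ext i j
  have h2 := congrFun (congrFun h1 (i, ⟨t, ht⟩)) (j, ⟨0, by omega⟩)
  change (if 0 ≤ t then A (t - 0) i j else 0) = (if 0 ≤ t then A' (t - 0) i j else 0) at h2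
  rwa [if_pos t.zero_le, if_pos t.zero_le] at h2

theorem map_companion (φ : B →ₐ[ℂ] B') (A : ℕ → Matrix (Fin N) (Fin N) B) :
    (companion p A).map φ = companion p (fun t => (A t).map φ) := by
  ext x y
  simp only [companion, toeplitz, matE, Matrix.map_apply, Matrix.add_apply, Matrix.of_apply,
    map_add, AlgHom.commutes]
  split_ifs <;> simp

end ScaledCoeff

namespace Signs

variable {N p : ℕ} (θ : Signs N) {B : Type*} [CommRing B] [Algebra ℂ B]

/-- The image under the folding of the blocks of a matrix in companion form. -/
def foldCoeff (A : ℕ → Matrix (Fin N) (Fin N) B) (t : ℕ) : Matrix (Fin N) (Fin N) B :=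
  Matrix.of fun a b => (-1) ^ (t + 1) * ((θ.sgn a : ℤ) : B) * ((θ.sgn b : ℤ) : B) * A t b.rev a.rev

theorem isFoldOf_companion (A : ℕ → Matrix (Fin N) (Fin N) B) :
    θ.IsFoldOf (companion p (θ.foldCoeff A)) (companion p A) := by
  intro x y
  have hx := x.2.isLt
  have hy := y.2.isLt
  have h1 := θ.isFolded_matE (p := p) (B := B) x y
  simp only [companion, Matrix.add_apply, mul_add, ← h1, add_right_inj, toeplitz, Matrix.of_apply,
    Fin.val_rev]
  by_cases h : (y.2 : ℕ) ≤ x.2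
  · rw [if_pos h, if_pos (by omega),
      show p - ((y.2 : ℕ) + 1) - (p - (x.2 + 1)) = (x.2 : ℕ) - y.2 by omega]
    have h2 : (-1 : B) ^ ((x.2 : ℕ) - y.2) = (-1) ^ ((x.2 : ℕ) + y.2) := by
      rw [neg_one_pow_eq_pow_mod_two, neg_one_pow_eq_pow_mod_two (n := (x.2 : ℕ) + y.2)]
      congr 1
      omega
    simp only [foldCoeff, Matrix.of_apply]
    rw [pow_succ, h2]
    ring
  · rw [if_neg h, if_neg (by omega), mul_zero]

/-- The folding identity for `T(u)` holds for all numbers `u`, so its coefficients may be compared;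
the substitution `u ↦ -u` contributes `(-1) ^ (p - m)` beside `(-1) ^ p`. -/
theorem scaledCoeff_foldCoeff (hp : 0 < p) (A : ℕ → Matrix (Fin N) (Fin N) B) (m : ℕ)
    (i j : Fin N) : scaledCoeff p (θ.foldCoeff A) m i j
      = (-1) ^ m * ((θ.sgn i : ℤ) : B) * ((θ.sgn j : ℤ) : B) * scaledCoeff p A m j.rev i.rev := by
  by_cases hm : p < m
  · rw [scaledCoeff_eq_zero _ hm, scaledCoeff_eq_zero _ hm, mul_zero]
  have hw : (((weight p (p - 1))⁻¹ : ℝ) : ℂ) ≠ 0 :=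
    Complex.ofReal_ne_zero.2 (inv_ne_zero (weight_pos (by omega)).ne')
  have h1 : ∀ u : ℂ, colSeries (weightRatio p) (θ.foldCoeff A) u p i j
      - (-1) ^ p * ((θ.sgn i : ℤ) : B) * ((θ.sgn j : ℤ) : B)
        * colSeries (weightRatio p) A (-u) p j.rev i.rev = 0 := by
    intro u
    have := congrFun (congrFun (θ.foldedChar_eq hp (θ.isFoldOf_companion (p := p) A) u) i) j
    simp only [foldedChar, charMatrix, Matrix.of_apply, Matrix.smul_apply, mul_smul_comm] at this
    rw [sub_eq_zero]
    exact (smul_right_injective B hw this).symm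
  have h2 := coeff_mem_of_infinite (⊥ : Submodule ℂ B)
    (fun q => colCoeff (weightRatio p) (θ.foldCoeff A) p (p - q) i j
      - (-1) ^ (p - q) * ((θ.sgn i : ℤ) : B) * ((θ.sgn j : ℤ) : B)
        * colCoeff (weightRatio p) A p (p - q) j.rev i.rev) (p + 1) Set.infinite_univ
    (fun u _ => ?_) (show p - m < p + 1 by omega)
  · rw [Submodule.mem_bot, Nat.sub_sub_self (not_lt.1 hm), sub_eq_zero] at h2
    rw [scaledCoeff, scaledCoeff, h2, mul_smul_comm]
  · rw [Submodule.mem_bot, ← h1 u, colSeries, colSeries, Matrix.sum_apply, Matrix.sum_apply,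
      Finset.mul_sum, ← Finset.sum_sub_distrib, ← Finset.sum_range_reflect]
    refine Finset.sum_congr rfl fun q hq => ?_
    have hq' := Finset.mem_range.1 hq
    have h3 : (-1 : B) ^ p = (-1) ^ q * (-1) ^ (p - q) := by rw [← pow_add]; congr 1; omega
    have h4 : ((-1 : B) ^ (p - q)) * (-1) ^ (p - q) = 1 := by rw [← mul_pow]; simp
    rw [show p + 1 - 1 - q = p - q by omega, Nat.sub_sub_self (by omega), h3]
    simp only [Matrix.smul_apply, Algebra.smul_def, map_pow, map_neg]
    rw [neg_pow (algebraMap ℂ B u)]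
    linear_combination (algebraMap ℂ B u ^ (p - q) * (-1 : B) ^ q * ((θ.sgn i : ℤ) : B)
      * ((θ.sgn j : ℤ) : B) * colCoeff (weightRatio p) A p q j.rev i.rev) * h4

theorem scaledCoeff_symm (hp : 0 < p) {A : ℕ → Matrix (Fin N) (Fin N) B}
    (hA : θ.IsFolded (companion p A)) (m : ℕ) (i j : Fin N) :
    scaledCoeff p A m i j
      = (-1) ^ m * ((θ.sgn i : ℤ) : B) * ((θ.sgn j : ℤ) : B) * scaledCoeff p A m j.rev i.rev := by
  rw [← θ.scaledCoeff_foldCoeff hp]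
  refine scaledCoeff_congr (fun t ht => companion_injective (p := p) ?_ ht) m i j
  ext x y
  rw [hA x y, θ.isFoldOf_companion A x y]

/-- The blocks and the folded blocks have the same coefficients, so they coincide because the
coefficients determine the blocks. -/
theorem isFolded_of_scaledCoeff (hp : 0 < p) {A : ℕ → Matrix (Fin N) (Fin N) B}
    (h : ∀ m i j, scaledCoeff p A m i j
      = (-1) ^ m * ((θ.sgn i : ℤ) : B) * ((θ.sgn j : ℤ) : B) * scaledCoeff p A m j.rev i.rev) :
    θ.IsFolded (companion p A) := by
  have h1 : companion p (θ.foldCoeff A) = companion p A :=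
    companion_congr fun t ht => scaledCoeff_injective (fun m i j => by
      rw [θ.scaledCoeff_foldCoeff hp, ← h]) ht
  have h2 := θ.isFoldOf_companion (p := p) A
  rwa [h1] at h2

end Signs

/-- The arithmetic progression `r, r + 3, r + 6, …`. -/
def progression (r : ℕ) : Set ℂ := Set.range fun n : ℕ => ((3 * n + r : ℕ) : ℂ)

theorem progression_infinite (r : ℕ) : (progression r).Infinite :=
  Set.infinite_range_of_injective fun m n h => by
    have := Nat.cast_injective (R := ℂ) h
    omega

/-- Distinct residues modulo `3` exclude equality, and positivity excludes opposite values. -/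
theorem progression_sub_add {r r' : ℕ} (hr : 0 < r) (h : ¬ r ≡ r' [MOD 3]) {u v : ℂ}
    (hu : u ∈ progression r) (hv : v ∈ progression r') : u - v ≠ 0 ∧ u + v ≠ 0 := by
  obtain ⟨m, rfl⟩ := hu
  obtain ⟨n, rfl⟩ := hv
  constructor
  · intro h'
    have := Nat.cast_injective (R := ℂ) (sub_eq_zero.1 h')
    simp only [Nat.ModEq] at h
    omega
  · rw [← Nat.cast_add]
    exact Nat.cast_ne_zero.2 (by omega)

/-! ### The isomorphism of the twisted Yangian and the W-algebra -/

namespace HighestWeightBasis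

variable {N p : ℕ} {θ : Signs N} (b : HighestWeightBasis (θ.foldedE p) (θ.foldedF p))

/-- Every folded companion matrix lies on the slice: its difference from the point with the same
coordinates is folded, commutes with `e₋`, and is orthogonal to the highest weight vectors. -/
theorem slicePoint_of_companion {B : Type*} [CommRing B] [Algebra ℂ B]
    {A : ℕ → Matrix (Fin N) (Fin N) B} (hA : θ.IsFolded (companion p A)) :
    b.slicePoint (fun i => (companion p A * (b.mat (.inl i)).map (algebraMap ℂ B)).trace)
      = companion p A := by
  rw [← sub_eq_zero]
  refine b.eq_zero_of_trace_inl ((b.isFolded_slicePoint _).sub hA) ?_ fun i => ?_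
  · have h1 := b.matF_mul_slicePoint_sub
      fun i => (companion p A * (b.mat (.inl i)).map (algebraMap ℂ B)).trace
    have h2 := matF_mul_toeplitz (p := p) A
    have h3 : companion p A = matE N p B + toeplitz p A := rfl
    generalize b.slicePoint
      (fun i => (companion p A * (b.mat (.inl i)).map (algebraMap ℂ B)).trace) = K at *
    rw [h3, ← sub_sub, Matrix.mul_sub, h1, h2, ← Matrix.sub_mul]
  · rw [Matrix.sub_mul, Matrix.trace_sub, b.trace_slicePoint_mul_inl, sub_self]

/-- The generators `S_(m)^{ij}` of the W-algebra. -/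
def gen (m : ℕ) (i j : Fin N) : b.WAlgebra := scaledCoeff p (b.sliceCoeff X) m i j

/-- `Y → W`. -/
def ofYangian (hp : 0 < p) : θ.TruncTwistedYangian p →ₐ[ℂ] b.WAlgebra :=
  Ideal.Quotient.liftₐ (θ.relIdeal p) (aeval fun x => b.gen (x.1 + 1) x.2.1 x.2.2) (by
    have hs : ∀ m i j, aeval (R := ℂ) (fun x : ℕ × Fin N × Fin N => b.gen (x.1 + 1) x.2.1 x.2.2)
        (Signs.symS m i j) = b.gen m i j := by
      intro m i j
      rcases m with _ | m
      · rw [gen, scaledCoeff_zero, Signs.symS]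
        split_ifs <;> simp
      · rw [Signs.symS, aeval_X]
    intro a ha
    refine Submodule.span_induction (p := fun a _ => aeval (R := ℂ) _ a = 0) ?_ (map_zero _)
      (fun a c _ _ h h' => by rw [map_add, h, h', add_zero])
      (fun c a _ h => by rw [smul_eq_mul, map_mul, h, mul_zero]) ha
    rintro _ (⟨m, i, j, rfl⟩ | ⟨m, i, j, hm, rfl⟩)
    · simp only [map_sub, map_mul, map_pow, map_neg, map_one, map_intCast, hs]
      exact sub_eq_zero.2 (θ.scaledCoeff_symm hp (b.isFolded_companion X) m i j)
    · rw [hs]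
      exact scaledCoeff_eq_zero _ hm i j)

theorem ofYangian_yangianS (hp : 0 < p) (m : ℕ) (i j : Fin N) :
    b.ofYangian hp (θ.yangianS p m i j) = b.gen m i j := by
  rcases m with _ | m
  · rw [gen, scaledCoeff_zero, Signs.yangianS_zero]
    split_ifs <;> simp
  · change aeval (R := ℂ) (fun x : ℕ × Fin N × Fin N => b.gen (x.1 + 1) x.2.1 x.2.2)
      (X (m, i, j)) = _
    rw [aeval_X]

/-- A point of the W-algebra over an algebra is a folded companion matrix; a point of the Yangian is
a truncated series with the required symmetry. The triangular correspondence between them, applied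
to the two universal points, yields mutually inverse morphisms. -/
theorem exists_algEquiv (hp : 0 < p) : ∃ Φ : θ.TruncTwistedYangian p ≃ₐ[ℂ] b.WAlgebra,
    ∀ m i j, Φ (θ.yangianS p m i j) = b.gen m i j := by
  -- Blocks with entries in the Yangian itself whose coefficients are its own generators; their
  -- coordinates on the slice define the inverse morphism.
  obtain ⟨A, hA⟩ := scaledCoeff_surjective (θ.yangianS_zero p) (θ.yangianS_trunc p)
  have hf : θ.IsFolded (companion p A) := θ.isFolded_of_scaledCoeff hp fun m i j => by
    rw [hA, hA]
    exact θ.yangianS_symm p m i j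
  set wY : Fin b.r → θ.TruncTwistedYangian p :=
    fun i => (companion p A * (b.mat (.inl i)).map (algebraMap ℂ _)).trace with hw
  have h1 : companion p (b.sliceCoeff wY) = companion p A := by
    rw [← b.slicePoint_eq_companion]
    exact b.slicePoint_of_companion hf
  have h2 : ∀ m i j, aeval (R := ℂ) wY (b.gen m i j) = θ.yangianS p m i j := by
    intro m i j
    have h3 : (fun t => (b.sliceCoeff X t).map (aeval (R := ℂ) wY)) = b.sliceCoeff wY := by
      funext t
      rw [map_sliceCoeff]
      simp
    rw [gen, map_scaledCoeff, h3, ← hA]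
    exact scaledCoeff_congr (fun t ht => companion_injective h1 ht) m i j
  -- The universal point of the slice is recovered from the generators, since a companion matrix is
  -- determined by its coefficients.
  have h4 : companion p (fun t => (A t).map (b.ofYangian hp)) = b.slicePoint X := by
    rw [b.slicePoint_eq_companion]
    refine companion_congr fun t ht =>
      scaledCoeff_injective (A := fun t => (A t).map (b.ofYangian hp)) (A' := b.sliceCoeff X) (fun m i j => ?_) ht
    rw [← map_scaledCoeff, hA, ofYangian_yangianS, gen]
  refine ⟨AlgEquiv.ofAlgHom (b.ofYangian hp) (aeval wY) ?_ ?_, b.ofYangian_yangianS hp⟩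
  · refine MvPolynomial.algHom_ext fun i => ?_
    rw [AlgHom.comp_apply, aeval_X, hw, AlgHom.id_apply, ← b.trace_slicePoint_mul_inl X i, ← h4,
      ← map_companion]
    simp [Matrix.trace, Matrix.mul_apply]
  · refine Ideal.Quotient.algHom_ext _ (MvPolynomial.algHom_ext fun x => ?_)
    change aeval wY (b.ofYangian hp (θ.yangianS p (x.1 + 1) x.2.1 x.2.2)) = _
    rw [ofYangian_yangianS, h2]
    rfl

/-- The series of the `S_(m)^{ij}` at the number `u`. -/
def genValue (u : ℂ) (i j : Fin N) : b.WAlgebra := genSeries b.gen p (algebraMap ℂ _ u) i j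

theorem genValue_eq (hp : 0 < p) (u : ℂ) (i j : Fin N) : b.genValue u i j
    = ((2 : ℂ) ^ p * (weight p (p - 1) : ℝ)) • b.charSeries (u / 2) i j := by
  have hw : ((weight p (p - 1) : ℝ) : ℂ) ≠ 0 :=
    Complex.ofReal_ne_zero.2 (weight_pos (by omega)).ne'
  refine (genSeries_scaledCoeff _ u i j).trans ?_
  rw [charSeries, charMatrix, Matrix.smul_apply, smul_smul]
  congr 1
  push_cast
  field_simp

/-- Replacing `u`, `v` by `u / 2`, `v / 2` doubles the inverses of `u ± v` and absorbs the factor `1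
/ 2` left by the projection. The common scalar of the series does no harm, as both sides are
quadratic in it. -/
theorem diracBracket_genValue (hp : 0 < p) {u v : ℂ} (huv : u - v ≠ 0) (huv' : u + v ≠ 0)
    (i j k l : Fin N) : b.diracBracket (b.genValue u i j) (b.genValue v k l)
      = θ.sklyanin b.genValue u i j v k l := by
  have hb := b.diracBracket_isBiderivation
  have h1 : u / 2 - v / 2 ≠ 0 := by
    rw [← sub_div]; exact div_ne_zero huv two_ne_zero
  have h2 : u / 2 + v / 2 ≠ 0 := by
    rw [← add_div]; exact div_ne_zero huv' two_ne_zero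
  rw [genValue_eq b hp, genValue_eq b hp, hb.smul_left, hb.smul_right,
    b.diracBracket_charSeries hp h1 h2]
  simp only [Signs.sklyanin, genValue_eq b hp, Algebra.smul_def]
  have h3 : (u / 2 - v / 2)⁻¹ = 2 * (u - v)⁻¹ := by field_simp
  have h4 : (u / 2 + v / 2)⁻¹ = 2 * (u + v)⁻¹ := by field_simp
  have h5 : algebraMap ℂ b.WAlgebra (1 / 2) * algebraMap ℂ b.WAlgebra 2 = 1 := by
    rw [← map_mul]; simp
  rw [h3, h4]
  simp only [map_mul]
  generalize algebraMap ℂ b.WAlgebra (1 / 2) = c at *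
  generalize algebraMap ℂ b.WAlgebra 2 = d at *
  linear_combination (algebraMap ℂ b.WAlgebra (2 ^ p) ^ 2
    * algebraMap ℂ b.WAlgebra (weight p (p - 1) : ℝ) ^ 2
    * (algebraMap ℂ b.WAlgebra (u - v)⁻¹ * (b.charSeries (u / 2) k j * b.charSeries (v / 2) i l
        - b.charSeries (v / 2) k j * b.charSeries (u / 2) i l)
      - algebraMap ℂ b.WAlgebra (u + v)⁻¹ * (((θ.sgn₀ : ℤ) : b.WAlgebra)
        * (((θ.sgn k : ℤ) : b.WAlgebra) * ((θ.sgn j : ℤ) : b.WAlgebra)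
          * b.charSeries (u / 2) i k.rev * b.charSeries (v / 2) j.rev l
        - ((θ.sgn i : ℤ) : b.WAlgebra) * ((θ.sgn l : ℤ) : b.WAlgebra)
          * b.charSeries (v / 2) k i.rev * b.charSeries (u / 2) l.rev j)))) * h5

theorem adjoin_genValue (hp : 0 < p) {U : Set ℂ} (hU : U.Infinite) :
    Algebra.adjoin ℂ (Signs.entrySet b.genValue U) = ⊤ := by
  obtain ⟨Φ, hΦ⟩ := b.exists_algEquiv hp
  have h1 : Signs.entrySet b.genValue U = (Φ : _ →ₐ[ℂ] b.WAlgebra) ''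
      Signs.entrySet (θ.yangianSeries p) U := by
    have h2 : ∀ u i j, b.genValue u i j = Φ (θ.yangianSeries p u i j) := fun u i j => by
      simp [genValue, Signs.yangianSeries, genSeries, hΦ]
    ext a
    constructor
    · rintro ⟨u, hu, i, j, rfl⟩
      exact ⟨_, ⟨u, hu, i, j, rfl⟩, (h2 u i j).symm⟩
    · rintro ⟨_, ⟨u, hu, i, j, rfl⟩, rfl⟩
      exact ⟨u, hu, i, j, (h2 u i j).symm⟩
  rw [h1, ← AlgHom.map_adjoin, θ.adjoin_yangianSeries p hU, Algebra.map_top, AlgHom.range_eq_top]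
  exact Φ.surjective

/-- Only the Jacobi identity is at stake. Parameters from three residue classes modulo `3` suffice
to generate the algebra and never meet the poles; the class of `0` starts at `3` to keep them
positive. -/
theorem diracBracket_isPoissonBracket (hp : 0 < p) : IsPoissonBracket b.diracBracket := by
  have hb := b.diracBracket_isBiderivation
  refine hb.isPoissonBracket b.diracBracket_skew (hb.jacobi_of_adjoin b.diracBracket_skew
    (b.adjoin_genValue hp (progression_infinite 1)) (b.adjoin_genValue hp (progression_infinite 2))
    (b.adjoin_genValue hp (progression_infinite 3)) ?_)
  rintro _ ⟨u, hu, i, j, rfl⟩ _ ⟨v, hv, k, l, rfl⟩ _ ⟨w, hw, m, n, rfl⟩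
  have h1 := progression_sub_add one_pos (by decide) hu hv
  have h2 := progression_sub_add two_pos (by decide) hv hw
  have h3 := progression_sub_add three_pos (by decide) hw hu
  exact θ.jacobi_sklyanin hb (fun u v h h' => b.diracBracket_genValue hp h h') h1.1 h1.2 h2.1 h2.2
    h3.1 h3.2 i j k l m n

/-- The brackets agree on values at parameters from two disjoint progressions, hence everywhere. The
Jacobi identity of the Yangian is then inherited from the W-algebra. -/
theorem poissonIsomorphic (hp : 0 < p) : PoissonIsomorphic (θ.truncBracket p) b.diracBracket := by
  obtain ⟨Φ, hΦ⟩ := b.exists_algEquiv hp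
  have h2 : ∀ u i j, Φ (θ.yangianSeries p u i j) = b.genValue u i j := fun u i j => by
    simp [genValue, Signs.yangianSeries, genSeries, hΦ]
  have h : ∀ a c, Φ (θ.truncBracket p a c) = b.diracBracket (Φ a) (Φ c) := by
    refine (θ.truncBracket_isBiderivation p).map_eq_of_adjoin b.diracBracket_isBiderivation
      (Φ : _ →ₐ[ℂ] b.WAlgebra) (θ.adjoin_yangianSeries p (progression_infinite 1))
      (θ.adjoin_yangianSeries p (progression_infinite 2)) ?_
    rintro _ ⟨u, hu, i, j, rfl⟩ _ ⟨v, hv, k, l, rfl⟩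
    obtain ⟨h3, h4⟩ := progression_sub_add one_pos (by decide) hu hv
    have h5 : (fun u i j => (Φ : _ →ₐ[ℂ] b.WAlgebra) (θ.yangianSeries p u i j)) = b.genValue := by
      funext u i j
      exact h2 u i j
    rw [θ.truncBracket_yangianSeries p h3 h4, Signs.sklyanin_map, h5,
      ← b.diracBracket_genValue hp h3 h4, ← h2, ← h2]
    rfl
  exact ⟨(b.diracBracket_isPoissonBracket hp).of_algEquiv Φ h,
    b.diracBracket_isPoissonBracket hp, Φ, h⟩

end HighestWeightBasis

/-- The truncated twisted Yangians are the W-algebras of the folded linear algebras. -/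
theorem Signs.isTruncatedTwistedYangian {N p : ℕ} (θ : Signs N) (hp : 0 < p) :
    IsTruncatedTwistedYangian θ p (θ.foldedE p) (θ.foldedF p) :=
  ⟨θ.nonempty_highestWeightBasis p,
    fun b => ⟨b.isUnit_det_constraintMatrix, b.poissonIsomorphic hp⟩⟩

/-! ### Transport along isomorphisms of Lie algebras -/

section Transport

variable {ι ι' : Type} [Fintype ι] [DecidableEq ι] [Fintype ι'] [DecidableEq ι']
  {L : LieSubalgebra ℂ (Matrix ι ι ℂ)} {L' : LieSubalgebra ℂ (Matrix ι' ι' ℂ)} {e f : L} {e' f' : L'}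

/-- The image of a basis under an isomorphism. -/
def HighestWeightBasis.map (b : HighestWeightBasis e f) (φ : L ≃ₗ⁅ℂ⁆ L') (he : φ e = e')
    (hf : φ f = f') : HighestWeightBasis e' f' where
  r := b.r
  s := b.s
  basis := b.basis.map φ.toLinearEquiv
  highest i := by
    rw [Module.Basis.map_apply, ← he]
    change ⁅φ e, φ (b.basis (.inl i))⁆ = 0
    rw [← LieEquiv.map_lie, b.highest, map_zero]
  lower α := by
    obtain ⟨y, hy⟩ := b.lower α
    refine ⟨φ y, ?_⟩
    rw [Module.Basis.map_apply, hy, ← hf, ← LieEquiv.map_lie]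
    rfl

namespace HighestWeightBasis

variable (b : HighestWeightBasis e f) (φ : L ≃ₗ⁅ℂ⁆ L') (he : φ e = e') (hf : φ f = f')

theorem liePoisson_map : (b.map φ he hf).liePoisson = b.liePoisson := by
  have h : ∀ x y z, (b.map φ he hf).basis.repr
      ⁅(b.map φ he hf).basis x, (b.map φ he hf).basis y⁆ z
        = b.basis.repr ⁅b.basis x, b.basis y⁆ z := by
    intro x y z
    change b.basis.repr (φ.symm ⁅φ (b.basis x), φ (b.basis y)⁆) z = _
    rw [← LieEquiv.map_lie, LieEquiv.symm_apply_apply]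
  funext F G
  unfold liePoisson
  simp only [h]
  rfl

variable (htr : ∀ x : L, ((e' : Matrix ι' ι' ℂ) * (φ x : Matrix ι' ι' ℂ)).trace
    = ((e : Matrix ι ι ℂ) * (x : Matrix ι ι ℂ)).trace)

include htr

theorem value_map : (b.map φ he hf).value = b.value :=
  funext fun _ => htr _

theorem constraint_map : (b.map φ he hf).constraint = b.constraint := by
  funext α
  exact congrArg (fun c => (X (Sum.inr α) - C c : MvPolynomial (Fin b.r ⊕ Fin b.s) ℂ))
    (congrFun (b.value_map φ he hf htr) α)

theorem onConstraints_map : (b.map φ he hf).onConstraints = b.onConstraints :=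
  congrArg (fun c : Fin b.s → ℂ => (aeval (Sum.elim X fun α => C (c α)) :
    MvPolynomial (Fin b.r ⊕ Fin b.s) ℂ →ₐ[ℂ] b.WAlgebra)) (b.value_map φ he hf htr)

theorem constraintMatrix_map : (b.map φ he hf).constraintMatrix = b.constraintMatrix := by
  unfold constraintMatrix
  rw [b.onConstraints_map φ he hf htr, b.constraint_map φ he hf htr, b.liePoisson_map φ he hf]
  rfl

theorem diracBracket_map : (b.map φ he hf).diracBracket = b.diracBracket := by
  funext F G
  unfold diracBracket
  rw [b.constraintMatrix_map φ he hf htr, b.onConstraints_map φ he hf htr,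
    b.constraint_map φ he hf htr, b.liePoisson_map φ he hf]
  rfl

end HighestWeightBasis

/-- Apart from the structure constants, the reduction sees only the numbers `tr (e x)`; the trace
form as a whole need not be preserved. -/
theorem IsTruncatedTwistedYangian.of_lieEquiv {N p : ℕ} {θ : Signs N}
    (h : IsTruncatedTwistedYangian θ p e' f') (φ : L ≃ₗ⁅ℂ⁆ L') (he : φ e = e') (hf : φ f = f')
    (htr : ∀ x : L, ((e' : Matrix ι' ι' ℂ) * (φ x : Matrix ι' ι' ℂ)).trace
      = ((e : Matrix ι ι ℂ) * (x : Matrix ι ι ℂ)).trace) :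
    IsTruncatedTwistedYangian θ p e f := by
  obtain ⟨⟨b⟩, h'⟩ := h
  refine ⟨⟨b.map φ.symm (by rw [← he, LieEquiv.symm_apply_apply])
    (by rw [← hf, LieEquiv.symm_apply_apply])⟩, fun b' => ?_⟩
  have := h' (b'.map φ he hf)
  rwa [b'.constraintMatrix_map φ he hf htr, b'.diracBracket_map φ he hf htr] at this

end Transport

/-! ### Orthogonal and symplectic algebras as folded algebras -/

section Monomial

variable {ι ι' : Type} [Fintype ι] [DecidableEq ι] [Fintype ι'] [DecidableEq ι']

/-- Conjugation by a signed permutation matrix. -/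
def monomialConj (ρ : ι ≃ ι') (d : ι → ℤˣ) : Matrix ι ι ℂ ≃ₐ[ℂ] Matrix ι' ι' ℂ :=
  -- The simple entrywise formula pulls matrices back from `ι'` to `ι`, so the map wanted is its
  -- inverse.
  AlgEquiv.symm
  { toFun := fun M => Matrix.of fun x y => ((d x : ℤ) : ℂ) * ((d y : ℤ) : ℂ) * M (ρ x) (ρ y)
    invFun := fun M => Matrix.of fun x y => ((d (ρ.symm x) : ℤ) : ℂ) * ((d (ρ.symm y) : ℤ) : ℂ)
      * M (ρ.symm x) (ρ.symm y)
    left_inv := fun M => by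
      ext x y
      have h1 := Signs.sgn_sq (A := ℂ) (d (ρ.symm x))
      have h2 := Signs.sgn_sq (A := ℂ) (d (ρ.symm y))
      simp only [Matrix.of_apply, Equiv.apply_symm_apply]
      linear_combination ((d (ρ.symm y) : ℤ) : ℂ) * ((d (ρ.symm y) : ℤ) : ℂ) * M x y * h1
        + M x y * h2
    right_inv := fun M => by
      ext x y
      have h1 := Signs.sgn_sq (A := ℂ) (d x)
      have h2 := Signs.sgn_sq (A := ℂ) (d y)
      simp only [Matrix.of_apply, Equiv.symm_apply_apply]
      linear_combination ((d y : ℤ) : ℂ) * ((d y : ℤ) : ℂ) * M x y * h1 + M x y * h2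
    map_mul' := fun M M' => by
      ext x y
      simp only [Matrix.of_apply, Matrix.mul_apply, Finset.mul_sum]
      refine (Fintype.sum_equiv ρ _ _ fun z => ?_).symm
      linear_combination ((d x : ℤ) : ℂ) * ((d y : ℤ) : ℂ) * M (ρ x) (ρ z) * M' (ρ z) (ρ y)
        * Signs.sgn_sq (A := ℂ) (d z)
    map_add' := fun M M' => by
      ext x y
      simp [mul_add]
    commutes' := fun z => by
      ext x y
      by_cases h : x = y
      · subst h
        simp [Matrix.algebraMap_matrix_apply, Signs.sgn_sq]
      · simp [Matrix.algebraMap_matrix_apply, h] }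

theorem monomialConj_symm_apply (ρ : ι ≃ ι') (d : ι → ℤˣ) (M : Matrix ι' ι' ℂ) (x y : ι) :
    (monomialConj ρ d).symm M x y = ((d x : ℤ) : ℂ) * ((d y : ℤ) : ℂ) * M (ρ x) (ρ y) := rfl

theorem monomialConj_apply (ρ : ι ≃ ι') (d : ι → ℤˣ) (M : Matrix ι ι ℂ) (x y : ι) :
    monomialConj ρ d M (ρ x) (ρ y) = ((d x : ℤ) : ℂ) * ((d y : ℤ) : ℂ) * M x y := by
  change ((d (ρ.symm (ρ x)) : ℤ) : ℂ) * ((d (ρ.symm (ρ y)) : ℤ) : ℂ)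
    * M (ρ.symm (ρ x)) (ρ.symm (ρ y)) = _
  rw [Equiv.symm_apply_apply, Equiv.symm_apply_apply]

theorem trace_monomialConj (ρ : ι ≃ ι') (d : ι → ℤˣ) (M : Matrix ι ι ℂ) :
    (monomialConj ρ d M).trace = M.trace := by
  refine (Fintype.sum_equiv ρ _ _ fun x => ?_).symm
  rw [Matrix.diag_apply, Matrix.diag_apply, monomialConj_apply, Signs.sgn_sq, one_mul]

/-- Matrix Lie algebras that are obtained from `gl(Np)^τ` by conjugation with a signed permutation
matrix. -/
theorem Signs.isTruncatedTwistedYangian_of_conj {N p : ℕ} (θ : Signs N) (hp : 0 < p)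
    {L : LieSubalgebra ℂ (Matrix ι ι ℂ)} (ρ : ι ≃ Fin N × Fin p) (d j : ι → ℤˣ) (ν : ι → ι) (c : ℤˣ)
    (hν : ∀ x, ρ (ν x) = ((ρ x).1.rev, (ρ x).2.rev))
    (hd : ∀ x, d x * d (ν x) * ((-1) ^ ((ρ x).2 : ℕ) * θ.sgn (ρ x).1) = c * j x)
    (hL : ∀ M, M ∈ L ↔ ∀ x y, M x y = -(((j x : ℤ) : ℂ) * ((j y : ℤ) : ℂ) * M (ν y) (ν x)))
    {e f : L}
    (he : ∀ x y, (e : Matrix ι ι ℂ) x y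
      = ((d x : ℤ) : ℂ) * ((d y : ℤ) : ℂ) * matE N p ℂ (ρ x) (ρ y))
    (hf : ∀ x y, (f : Matrix ι ι ℂ) x y
      = ((d x : ℤ) : ℂ) * ((d y : ℤ) : ℂ) * matF N p ℂ (ρ x) (ρ y)) :
    IsTruncatedTwistedYangian θ p e f := by
  have hd' : ∀ x, ((d x : ℤ) : ℂ) * ((d (ν x) : ℤ) : ℂ)
      * ((-1) ^ ((ρ x).2 : ℕ) * ((θ.sgn (ρ x).1 : ℤ) : ℂ)) = ((c : ℤ) : ℂ) * ((j x : ℤ) : ℂ) := by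
    intro x
    have := congrArg (fun u : ℤˣ => ((u : ℤ) : ℂ)) (hd x)
    simpa using this
  have hmem : ∀ M : Matrix ι ι ℂ, M ∈ L ↔ monomialConj ρ d M ∈ θ.foldedGl p := by
    intro M
    rw [hL, θ.mem_foldedGl]
    have key : ∀ x y, (M x y = -(((j x : ℤ) : ℂ) * ((j y : ℤ) : ℂ) * M (ν y) (ν x)))
        ↔ (monomialConj ρ d M (ρ x) (ρ y)
          = -((-1) ^ (((ρ x).2 : ℕ) + (ρ y).2) * ((θ.sgn (ρ x).1 : ℤ) : ℂ)
            * ((θ.sgn (ρ y).1 : ℤ) : ℂ)) * monomialConj ρ d M ((ρ y).1.rev, (ρ y).2.rev)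
              ((ρ x).1.rev, (ρ x).2.rev)) := by
      intro x y
      rw [← hν, ← hν, monomialConj_apply, monomialConj_apply, pow_add]
      have hx := hd' x
      have hy := hd' y
      have e1 := Signs.sgn_sq (A := ℂ) (d x)
      have e2 := Signs.sgn_sq (A := ℂ) (d y)
      have e3 := Signs.sgn_sq (A := ℂ) c
      generalize ((c : ℤ) : ℂ) = c at *
      generalize ((j x : ℤ) : ℂ) = jx at *
      generalize ((j y : ℤ) : ℂ) = jy at *
      generalize ((d x : ℤ) : ℂ) = dx at *
      generalize ((d y : ℤ) : ℂ) = dy at *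
      generalize ((d (ν x) : ℤ) : ℂ) = dx' at *
      generalize ((d (ν y) : ℤ) : ℂ) = dy' at *
      generalize ((θ.sgn (ρ x).1 : ℤ) : ℂ) = tx at *
      generalize ((θ.sgn (ρ y).1 : ℤ) : ℂ) = ty at *
      generalize ((-1 : ℂ) ^ ((ρ x).2 : ℕ)) = sx at *
      generalize ((-1 : ℂ) ^ ((ρ y).2 : ℕ)) = sy at *
      generalize M x y = m at *
      generalize M (ν y) (ν x) = m' at *
      -- By `hd`, the signed permutation carries the form with entries `j` to the form with entries
      -- `(-1)^k θ^a`, up to the global sign `c`. The membership condition is quadratic in the form,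
      -- so `c` drops out.
      have h1 : jx * jy = dx * dx' * (sx * tx) * (dy * dy' * (sy * ty)) := by
        rw [hx, hy]
        linear_combination (-jx * jy) * e3
      rw [h1]
      clear hx hy h1 hd'
      constructor
      · intro h
        linear_combination dx * dy * h - m' * dx' * dy' * sx * tx * sy * ty * dy * dy * e1
          - m' * dx' * dy' * sx * tx * sy * ty * e2
      · intro h
        linear_combination dx * dy * h - m * dy * dy * e1 - m * e2
    constructor
    · intro h x y
      obtain ⟨x, rfl⟩ := ρ.surjective x
      obtain ⟨y, rfl⟩ := ρ.surjective y
      exact (key x y).1 (h x y)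
    · intro h x y
      exact (key x y).2 (h _ _)
  let φ : L ≃ₗ⁅ℂ⁆ θ.foldedGl p := LieEquiv.ofSubalgebras L (θ.foldedGl p)
    (monomialConj ρ d).toLieEquiv (by
      ext M
      rw [LieSubalgebra.mem_map]
      constructor
      · rintro ⟨M', h, rfl⟩
        exact (hmem M').1 h
      · intro h
        refine ⟨(monomialConj ρ d).symm M, (hmem _).2 ?_, ?_⟩
        · rwa [AlgEquiv.apply_symm_apply]
        · exact AlgEquiv.apply_symm_apply _ _)
  have hφ : ∀ x : L, (φ x : Matrix (Fin N × Fin p) (Fin N × Fin p) ℂ)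
      = monomialConj ρ d (x : Matrix ι ι ℂ) := fun x => rfl
  have hE : φ e = θ.foldedE p := Subtype.ext <| by
    rw [hφ, coe_foldedE, ← AlgEquiv.eq_symm_apply]
    ext x y
    rw [he, monomialConj_symm_apply]
  have hF : φ f = θ.foldedF p := Subtype.ext <| by
    rw [hφ, coe_foldedF, ← AlgEquiv.eq_symm_apply]
    ext x y
    rw [hf, monomialConj_symm_apply]
  refine (θ.isTruncatedTwistedYangian hp).of_lieEquiv φ hE hF fun x => ?_
  rw [← hE, hφ, hφ, ← map_mul, trace_monomialConj]

/-- The matrix Lie algebra that preserves a form with one non-zero entry, `1` or `-1`, in every row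
and column. -/
theorem mem_skewAdjoint_iff {J : Matrix ι ι ℂ} {j : ι → ℤˣ} {ν : ι → ι} (hν : ∀ x, ν (ν x) = x)
    (hJ : ∀ x y, J x y = if y = ν x then ((j x : ℤ) : ℂ) else 0) (M : Matrix ι ι ℂ) :
    M ∈ skewAdjointMatricesLieSubalgebra J
      ↔ ∀ x y, M x y = -(((j x : ℤ) : ℂ) * ((j y : ℤ) : ℂ) * M (ν y) (ν x)) := by
  have h1 : ∀ x y, (M.transpose * J) x (ν y) = ((j y : ℤ) : ℂ) * M y x := by
    intro x y
    rw [Matrix.mul_apply, Finset.sum_eq_single y]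
    · rw [hJ, if_pos rfl, Matrix.transpose_apply, mul_comm]
    · intro z _ hz
      rw [hJ, if_neg, mul_zero]
      intro h
      exact hz (by rw [← hν z, ← h, hν])
    · simp
  have h2 : ∀ x y, (J * -M) x y = -(((j x : ℤ) : ℂ) * M (ν x) y) := by
    intro x y
    rw [Matrix.mul_apply, Finset.sum_eq_single (ν x)]
    · rw [hJ, if_pos rfl, Matrix.neg_apply, mul_neg]
    · intro z _ hz
      rw [hJ, if_neg hz, zero_mul]
    · simp
  rw [mem_skewAdjointMatricesLieSubalgebra, mem_skewAdjointMatricesSubmodule]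
  change M.transpose * J = J * -M ↔ _
  constructor
  · intro h x y
    have h3 := congrFun (congrFun h y) (ν x)
    rw [h1, h2] at h3
    linear_combination (((j x : ℤ) : ℂ)) * h3 - M x y * Signs.sgn_sq (A := ℂ) (j x)
  · intro h
    ext x y
    rw [← hν y, h1, h2, h (ν y) x]
    linear_combination (-((j x : ℤ) : ℂ)) * M (ν x) (ν (ν y)) * Signs.sgn_sq (A := ℂ) (j (ν y))

end Monomial

/-! ### The embedding `M ↦ diag (M, -Mᵀ)` as a signed permutation -/

section Doubling

variable {n N p : ℕ}

/-- The position of the index set of `gl(np)`, doubled, in that of `gl(Np)`, for `2n ≤ N`. -/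
def doublingIndex (h : n ≤ N) : (Fin n × Fin p) ⊕ (Fin n × Fin p) → Fin N × Fin p :=
  Sum.elim (fun x => (Fin.castLE h x.1, x.2)) fun x => ((Fin.castLE h x.1).rev, x.2.rev)

/-- The signs by which the indices in the second half are twisted. -/
def doublingSign : (Fin n × Fin p) ⊕ (Fin n × Fin p) → ℤˣ :=
  Sum.elim (fun _ => 1) fun x => (-1) ^ (x.2.rev : ℕ)

theorem doublingIndex_injective (h : n ≤ N) (h' : 2 * n ≤ N) :
    Function.Injective (doublingIndex (p := p) h) := by
  rintro (⟨a, k⟩ | ⟨a, k⟩) (⟨b, l⟩ | ⟨b, l⟩) hab <;>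
    simp only [doublingIndex, Sum.elim_inl, Sum.elim_inr, Prod.mk.injEq, Fin.ext_iff, Fin.val_rev,
      Fin.val_castLE] at hab <;>
    have ha := a.isLt <;> have hb := b.isLt
  · exact congrArg _ (Prod.ext (Fin.ext hab.1) (Fin.ext hab.2))
  · omega
  · omega
  · have hk := k.isLt
    have hl := l.isLt
    exact congrArg _ (Prod.ext (Fin.ext (show (a : ℕ) = b by omega))
      (Fin.ext (show (k : ℕ) = l by omega)))

theorem doublingIndex_swap (h : n ≤ N) (x : (Fin n × Fin p) ⊕ (Fin n × Fin p)) :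
    doublingIndex h x.swap = ((doublingIndex h x).1.rev, (doublingIndex h x).2.rev) := by
  rcases x with x | x <;> simp [doublingIndex]

/-- Reversing the order of the second half turns the transpose back into a raising matrix, as the
weights of `e₊` are symmetric under reversal. The alternating signs produce the minus of `-Mᵀ`. -/
theorem doubling_blockE (h : n ≤ N) (h' : 2 * n ≤ N) (x y : (Fin n × Fin p) ⊕ (Fin n × Fin p)) :
    doubling (blockE n p) x y = ((doublingSign x : ℤ) : ℂ) * ((doublingSign y : ℤ) : ℂ)
      * matE N p ℂ (doublingIndex h x) (doublingIndex h y) := by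
  have hE : ∀ x y : Fin n × Fin p, blockE n p x y = if x.1 = y.1 ∧ (x.2 : ℕ) + 1 = y.2
      then ((stepWeight p x.2 : ℝ) : ℂ) else 0 := fun x y => by
    refine Eq.trans ?_ (matE_apply (B := ℂ) x y)
    simp [matE, blockE]
  rcases x with ⟨a, k⟩ | ⟨a, k⟩ <;> rcases y with ⟨b, l⟩ | ⟨b, l⟩ <;>
    have ha := a.isLt <;> have hb := b.isLt <;> have hk := k.isLt <;> have hl := l.isLt
  · rw [doubling, Matrix.fromBlocks_apply₁₁, hE, matE_apply]
    simp [doublingIndex, doublingSign]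
  · rw [doubling, Matrix.fromBlocks_apply₁₂, matE_apply, if_neg, mul_zero, Matrix.zero_apply]
    simp only [doublingIndex, Sum.elim_inl, Sum.elim_inr, Fin.ext_iff, Fin.val_rev, Fin.val_castLE]
    omega
  · rw [doubling, Matrix.fromBlocks_apply₂₁, matE_apply, if_neg, mul_zero, Matrix.zero_apply]
    simp only [doublingIndex, Sum.elim_inl, Sum.elim_inr, Fin.ext_iff, Fin.val_rev, Fin.val_castLE]
    omega
  · rw [doubling, Matrix.fromBlocks_apply₂₂, Matrix.neg_apply, Matrix.transpose_apply, hE,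
      matE_apply]
    simp only [doublingIndex, doublingSign, Sum.elim_inr, Fin.rev_inj, Fin.castLE_inj]
    by_cases hab : a = b ∧ (l : ℕ) + 1 = k
    · have h1 : (k.rev : ℕ) + 1 = l.rev := by simp only [Fin.val_rev]; omega
      rw [if_pos ⟨hab.1.symm, hab.2⟩, if_pos ⟨hab.1, h1⟩, ← h1]
      have h2 : stepWeight p k.rev = stepWeight p l := by
        have h3 : ((k.rev : ℕ) : ℝ) = p - (l + 1) - 1 := by
          rw [Fin.val_rev, ← hab.2, Nat.cast_sub (by omega)]
          push_cast
          ring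
        rw [stepWeight, stepWeight, h3]
        ring
      have h4 : ((-1 : ℂ) ^ (k.rev : ℕ)) * (-1) ^ (k.rev : ℕ) = 1 := by rw [← mul_pow]; simp
      rw [h2]
      push_cast
      simp only [pow_succ]
      linear_combination (((stepWeight p l : ℝ) : ℂ)) * h4
    · rw [if_neg fun h => hab ⟨h.1.symm, h.2⟩, if_neg, neg_zero, mul_zero]
      rintro ⟨h1, h2⟩
      refine hab ⟨h1, ?_⟩
      simp only [Fin.val_rev] at h2
      omega

theorem doubling_blockF (h : n ≤ N) (h' : 2 * n ≤ N) (x y : (Fin n × Fin p) ⊕ (Fin n × Fin p)) :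
    doubling (blockF n p) x y = ((doublingSign x : ℤ) : ℂ) * ((doublingSign y : ℤ) : ℂ)
      * matF N p ℂ (doublingIndex h x) (doublingIndex h y) := by
  have hF : ∀ x y : Fin n × Fin p, blockF n p x y = if x.1 = y.1 ∧ (y.2 : ℕ) + 1 = x.2
      then 1 else 0 := fun x y => by
    refine Eq.trans ?_ (matF_apply (B := ℂ) x y)
    simp [matF, blockF]
  rcases x with ⟨a, k⟩ | ⟨a, k⟩ <;> rcases y with ⟨b, l⟩ | ⟨b, l⟩ <;>
    have ha := a.isLt <;> have hb := b.isLt <;> have hk := k.isLt <;> have hl := l.isLt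
  · rw [doubling, Matrix.fromBlocks_apply₁₁, hF, matF_apply]
    simp [doublingIndex, doublingSign]
  · rw [doubling, Matrix.fromBlocks_apply₁₂, matF_apply, if_neg, mul_zero, Matrix.zero_apply]
    simp only [doublingIndex, Sum.elim_inl, Sum.elim_inr, Fin.ext_iff, Fin.val_rev, Fin.val_castLE]
    omega
  · rw [doubling, Matrix.fromBlocks_apply₂₁, matF_apply, if_neg, mul_zero, Matrix.zero_apply]
    simp only [doublingIndex, Sum.elim_inl, Sum.elim_inr, Fin.ext_iff, Fin.val_rev, Fin.val_castLE]
    omega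
  · rw [doubling, Matrix.fromBlocks_apply₂₂, Matrix.neg_apply, Matrix.transpose_apply, hF,
      matF_apply]
    simp only [doublingIndex, doublingSign, Sum.elim_inr, Fin.rev_inj, Fin.castLE_inj]
    by_cases hab : a = b ∧ (k : ℕ) + 1 = l
    · have h1 : (l.rev : ℕ) + 1 = k.rev := by simp only [Fin.val_rev]; omega
      have h4 : ((-1 : ℂ) ^ (l.rev : ℕ)) * (-1) ^ (l.rev : ℕ) = 1 := by rw [← mul_pow]; simp
      rw [if_pos ⟨hab.1.symm, hab.2⟩, if_pos ⟨hab.1, h1⟩, ← h1]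
      push_cast
      simp only [pow_succ]
      linear_combination h4
    · rw [if_neg fun h => hab ⟨h.1.symm, h.2⟩, if_neg, neg_zero, mul_zero]
      rintro ⟨h1, h2⟩
      refine hab ⟨h1, ?_⟩
      simp only [Fin.val_rev] at h2
      omega

/-- These are the signs of the two off-diagonal blocks of the transported form. Their comparison
decides between a symmetric and an alternating form, which is how the parity of `p` enters. -/
theorem doublingSign_mul_swap (θ : Signs N) (h : n ≤ N) (c : ℤˣ)
    (hθ : ∀ a : Fin n, θ.sgn (Fin.castLE h a) = 1) (hθ' : ∀ a : Fin n, θ.sgn (Fin.castLE h a).rev = c)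
    (x : (Fin n × Fin p) ⊕ (Fin n × Fin p)) :
    doublingSign x * doublingSign x.swap
        * ((-1) ^ ((doublingIndex h x).2 : ℕ) * θ.sgn (doublingIndex h x).1)
      = Sum.elim (fun _ => (-1) ^ (p + 1)) (fun _ => c) x := by
  rcases x with ⟨a, k⟩ | ⟨a, k⟩ <;> have hk := k.isLt <;>
    simp only [doublingSign, doublingIndex, Sum.swap_inl, Sum.swap_inr, Sum.elim_inl, Sum.elim_inr,
      hθ, hθ', one_mul, mul_one]
  · rw [← pow_add, Fin.val_rev, show p + 1 = p - (k + 1) + k + 2 by omega, pow_add _ _ 2]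
    simp
  · rw [← mul_assoc, ← pow_add, Even.neg_one_pow ⟨_, rfl⟩, one_mul]

/-- The index sets of `gl(np)`, doubled, and of `gl(2np)`. -/
def doublingEquiv (n p : ℕ) : (Fin n × Fin p) ⊕ (Fin n × Fin p) ≃ Fin (2 * n) × Fin p :=
  Equiv.ofBijective (doublingIndex (by omega)) ((Fintype.bijective_iff_injective_and_card _).2
    ⟨doublingIndex_injective _ le_rfl, by simp; ring⟩)

/-- The form matters only up to a scalar. The sign `z` is left free so that the result can be
matched with the standard forms. -/
theorem isTruncatedTwistedYangian_of_doubling (hp : 0 < p) (θ : Signs (2 * n)) (c : ℤˣ)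
    (hθ : ∀ i : Fin (2 * n), θ.sgn i = if (i : ℕ) < n then 1 else c)
    {J : Matrix ((Fin n × Fin p) ⊕ (Fin n × Fin p)) ((Fin n × Fin p) ⊕ (Fin n × Fin p)) ℂ}
    (z : ℤˣ) (hJ : J = Matrix.fromBlocks 0 ((((z * (-1) ^ (p + 1) : ℤˣ) : ℤ) : ℂ) • 1)
      ((((z * c : ℤˣ) : ℤ) : ℂ) • 1) 0)
    {e f : skewAdjointMatricesLieSubalgebra J}
    (he : (e : Matrix _ _ ℂ) = doubling (blockE n p))
    (hf : (f : Matrix _ _ ℂ) = doubling (blockF n p)) : IsTruncatedTwistedYangian θ p e f := by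
  refine θ.isTruncatedTwistedYangian_of_conj hp (doublingEquiv n p) doublingSign
    (Sum.elim (fun _ => z * (-1) ^ (p + 1)) fun _ => z * c) Sum.swap z (doublingIndex_swap _)
    (fun x => ?_) (mem_skewAdjoint_iff Sum.swap_swap fun x y => ?_)
    (fun x y => by rw [he]; exact doubling_blockE _ le_rfl x y)
    (fun x y => by rw [hf]; exact doubling_blockF _ le_rfl x y)
  · refine (doublingSign_mul_swap θ (by omega) c (fun a => ?_) (fun a => ?_) x).trans ?_
    · rw [hθ, if_pos (by simp)]
    · rw [hθ, if_neg]
      have := a.isLt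
      simp only [Fin.val_rev, Fin.val_castLE]
      omega
    · rcases x with x | x <;> simp [← mul_assoc, Int.units_mul_self]
  · rw [hJ]
    rcases x with x | x <;> rcases y with y | y <;>
      simp [Matrix.one_apply, eq_comm]

end Doubling

/-! ### The orthogonal algebra for odd `N` -/

section OddOrthogonal

variable {n p : ℕ}

/-- The index sets of `so((2n+1)p)` and of `gl((2n+1)p)`. -/
def oddIndex (n p : ℕ) : ((Fin n × Fin p) ⊕ (Fin n × Fin p)) ⊕ Fin p → Fin (2 * n + 1) × Fin p :=
  Sum.elim (doublingIndex (by omega)) fun k => (⟨n, by omega⟩, k)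

/-- The signs by which the indices are twisted. -/
def oddSign : ((Fin n × Fin p) ⊕ (Fin n × Fin p)) ⊕ Fin p → ℤˣ :=
  Sum.elim doublingSign fun _ => 1

theorem doublingIndex_ne_middle (x : (Fin n × Fin p) ⊕ (Fin n × Fin p)) :
    (doublingIndex (N := 2 * n + 1) (by omega) x).1 ≠ ⟨n, by omega⟩ := by
  rcases x with ⟨a, k⟩ | ⟨a, k⟩ <;> have ha := a.isLt <;>
    simp only [doublingIndex, Sum.elim_inl, Sum.elim_inr, ne_eq, Fin.ext_iff, Fin.val_rev,
      Fin.val_castLE] <;> omega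

theorem oddIndex_injective : Function.Injective (oddIndex n p) := by
  rintro (x | k) (y | l) h
  · exact congrArg _ (doublingIndex_injective _ (by omega) h)
  · exact absurd (congrArg Prod.fst h) (doublingIndex_ne_middle x)
  · exact absurd (congrArg Prod.fst h).symm (doublingIndex_ne_middle y)
  · exact congrArg _ (congrArg Prod.snd h)

/-- The bijection between the index sets. -/
def oddEquiv (n p : ℕ) : ((Fin n × Fin p) ⊕ (Fin n × Fin p)) ⊕ Fin p ≃ Fin (2 * n + 1) × Fin p :=
  Equiv.ofBijective (oddIndex n p) ((Fintype.bijective_iff_injective_and_card _).2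
    ⟨oddIndex_injective, by simp; ring⟩)

/-- The middle index of `Fin (2 * n + 1)` is fixed by the reversal, so its `p` coordinates form a
block on which the transported form is `antidiagForm p`, without further signs. On the rest, `(-1) ^
(p + 1) = 1` for odd `p` gives the form `[[0, 1], [1, 0]]`. -/
theorem isTruncatedTwistedYangian_soOdd (n : ℕ) (hp : Odd p) :
    IsTruncatedTwistedYangian (signsPlus (2 * n + 1)) p (soOddE n p) (soOddF n p) := by
  refine (signsPlus (2 * n + 1)).isTruncatedTwistedYangian_of_conj hp.pos (oddEquiv n p) oddSign
    (Sum.elim (fun _ => 1) fun k => (-1) ^ (k : ℕ)) (Sum.map Sum.swap Fin.rev) 1 ?_ ?_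
    (mem_skewAdjoint_iff ?_ ?_) ?_ ?_
  · rintro (x | k)
    · exact doublingIndex_swap _ x
    · refine Prod.ext (Fin.ext ?_) rfl
      change n = ((⟨n, _⟩ : Fin (2 * n + 1)).rev : ℕ)
      rw [Fin.val_rev]
      change n = 2 * n + 1 - (n + 1)
      omega
  · rintro (x | k)
    · refine (doublingSign_mul_swap (signsPlus (2 * n + 1)) (by omega) 1 (fun _ => rfl)
        (fun _ => rfl) x).trans ?_
      rcases x with x | x <;> simp [hp.add_one.neg_one_pow]
    · change 1 * 1 * ((-1) ^ (k : ℕ) * 1) = 1 * (-1 : ℤˣ) ^ (k : ℕ)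
      simp
  · rintro (x | k) <;> simp
  · rintro (x | k) (y | l)
    · rcases x with x | x <;> rcases y with y | y <;>
        simp [LieAlgebra.Orthogonal.JD, Matrix.one_apply, eq_comm]
    · simp
    · simp
    · simp [antidiagForm]
  · rintro (x | k) (y | l)
    · exact doubling_blockE _ (by omega) x y
    · change (0 : ℂ) = _ * matE _ p ℂ (doublingIndex _ x) (⟨n, _⟩, l)
      rw [matE_apply, if_neg fun h => doublingIndex_ne_middle x h.1, mul_zero]
    · change (0 : ℂ) = _ * matE _ p ℂ (⟨n, _⟩, k) (doublingIndex _ y)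
      rw [matE_apply, if_neg fun h => doublingIndex_ne_middle y h.1.symm, mul_zero]
    · change principalE p k l = ((1 : ℤ) : ℂ) * ((1 : ℤ) : ℂ) * matE _ p ℂ (⟨n, _⟩, k) (⟨n, _⟩, l)
      simp [matE]
  · rintro (x | k) (y | l)
    · exact doubling_blockF _ (by omega) x y
    · change (0 : ℂ) = _ * matF _ p ℂ (doublingIndex _ x) (⟨n, _⟩, l)
      rw [matF_apply, if_neg fun h => doublingIndex_ne_middle x h.1, mul_zero]
    · change (0 : ℂ) = _ * matF _ p ℂ (⟨n, _⟩, k) (doublingIndex _ y)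
      rw [matF_apply, if_neg fun h => doublingIndex_ne_middle y h.1.symm, mul_zero]
    · change principalF p k l = ((1 : ℤ) : ℂ) * ((1 : ℤ) : ℂ) * matF _ p ℂ (⟨n, _⟩, k) (⟨n, _⟩, l)
      simp [matF]

end OddOrthogonal

theorem isTruncatedTwistedYangian_sp {n p : ℕ} (hp : 0 < p) (θ : Signs (2 * n)) (c : ℤˣ)
    (hθ : ∀ i : Fin (2 * n), θ.sgn i = if (i : ℕ) < n then 1 else c) (hc : c = -(-1) ^ (p + 1)) :
    IsTruncatedTwistedYangian θ p (spE n p) (spF n p) := by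
  -- Taking `z = c` normalises the lower left block to `1`; the other block is then `-1`.
  refine isTruncatedTwistedYangian_of_doubling hp θ c hθ c ?_ rfl rfl
  have h1 : c * (-1) ^ (p + 1) = -1 := by rw [hc, neg_mul, Int.units_mul_self]
  rw [h1, Int.units_mul_self]
  simp [Matrix.J]

theorem isTruncatedTwistedYangian_so {n p : ℕ} (hp : 0 < p) (θ : Signs (2 * n)) (c : ℤˣ)
    (hθ : ∀ i : Fin (2 * n), θ.sgn i = if (i : ℕ) < n then 1 else c) (hc : c = (-1) ^ (p + 1)) :
    IsTruncatedTwistedYangian θ p (soE n p) (soF n p) := by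
  refine isTruncatedTwistedYangian_of_doubling hp θ c hθ c ?_ rfl rfl
  rw [← hc, Int.units_mul_self]
  simp [LieAlgebra.Orthogonal.JD]

end FoldedW

end

/-! ### The theorem, by the parity of `p` -/

theorem mainTheorem1 :
    (∀ (N p : ℕ) (θ : FoldedW.Signs N), 0 < N → 0 < p →
      FoldedW.IsTruncatedTwistedYangian θ p (θ.foldedE p) (θ.foldedF p)) ∧
    (∀ n p : ℕ, 0 < n → Odd p →
      FoldedW.IsTruncatedTwistedYangian (FoldedW.signsMinus n) p
        (FoldedW.spE n p) (FoldedW.spF n p) ∧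
      FoldedW.IsTruncatedTwistedYangian (FoldedW.signsPlus (2 * n)) p
        (FoldedW.soE n p) (FoldedW.soF n p)) ∧
    (∀ n p : ℕ, 0 < n → 0 < p → Even p →
      FoldedW.IsTruncatedTwistedYangian (FoldedW.signsMinus n) p
        (FoldedW.soE n p) (FoldedW.soF n p) ∧
      FoldedW.IsTruncatedTwistedYangian (FoldedW.signsPlus (2 * n)) p
        (FoldedW.spE n p) (FoldedW.spF n p)) ∧
    (∀ n p : ℕ, Odd p →
      FoldedW.IsTruncatedTwistedYangian (FoldedW.signsPlus (2 * n + 1)) p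
        (FoldedW.soOddE n p) (FoldedW.soOddF n p)) := by
  -- The constant sign is written with two equal branches, to fit the doubling lemmas with `c = 1`.
  have hplus : ∀ n (i : Fin (2 * n)), (FoldedW.signsPlus (2 * n)).sgn i
      = if (i : ℕ) < n then 1 else 1 := fun n i => (ite_self _).symm
  refine ⟨fun N p θ _ hp => θ.isTruncatedTwistedYangian hp, fun n p _ hp => ⟨?_, ?_⟩,
    fun n p _ hp0 hp => ⟨?_, ?_⟩, fun n p hp => FoldedW.isTruncatedTwistedYangian_soOdd n hp⟩
  · exact FoldedW.isTruncatedTwistedYangian_sp hp.pos _ (-1) (fun _ => rfl)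
      (by rw [hp.add_one.neg_one_pow])
  · exact FoldedW.isTruncatedTwistedYangian_so hp.pos _ 1 (hplus n)
      (by rw [hp.add_one.neg_one_pow])
  · exact FoldedW.isTruncatedTwistedYangian_so hp0 _ (-1) (fun _ => rfl)
      (by rw [hp.add_one.neg_one_pow])
  · exact FoldedW.isTruncatedTwistedYangian_sp hp0 _ 1 (hplus n)
      (by rw [hp.add_one.neg_one_pow, neg_neg])
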